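/- **Setting.** Let $N\ge 2$ and $L\ge 2$ be integers, $t\in\mathbb C$ a primitive $2(N+L)$-th root of unity, $\epsilon\in\{1,-1\}$ and $\zeta\in\mathbb C^\times$. Put $[n]=(t^n-t^{-n})/(t-t^{-1})$. Let $\hat 1,\dots,\hat N\in\mathbb R^N$ be the standard basis vectors minus $(1/N,\dots,1/N)$, so that $\sum_k\hat k=0$, and let $$\mathcal V=\Big\{\lambda=\sum_k\lambda_k\hat k \;:\; \lambda_k\in\mathbb Z,\ L\ge\lambda_1\ge\dots\ge\lambda_N=0\Big\}.$$ Let $\mathcal G$ be the oriented graph with vertex set $\mathcal V$ and edges $(\lambda|i)\colon\lambda\to\lambda+\hat i$ whenever $\lambda,\lambda+\hat i\in\mathcal V$. Let $\mathcal G^m$ be the set of its paths $\mathbf p=(\lambda|i_1,\dots,i_m)$ of length $m$ (in particular $\mathcal G^0=\mathcal V$), with source $s(\mathbf p)$ and range $r(\mathbf p)$, and let $\mathcal G^m_{\lambda\mu}$ be the subset of paths from $\lambda$ to $\mu$. Put $$d(\lambda|i,j)=\lambda_i-\lambda_j+j-i,\qquad D(\lambda)=\prod_{1\le i<j\le N}\frac{[d(\lambda|i,j)]}{[d(0|i,j)]},$$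 $$\mathcal L(\lambda|i_1,\dots,i_m)=\#\{(k,l): 1\le k<l\le m,\ i_k<i_l\}.$$ **The algebra.** Let $\mathfrak H(\mathcal G)$ be the $\mathbb C$-algebra with basis $e\binom{\mathbf p}{\mathbf q}$ ($\mathbf p,\mathbf q\in\mathcal G^m$, $m\ge0$), product $$e\tbinom{\mathbf p}{\mathbf q}e\tbinom{\mathbf p'}{\mathbf q'}=\delta_{r(\mathbf p)s(\mathbf p')}\,\delta_{r(\mathbf q)s(\mathbf q')}\,e\tbinom{\mathbf p\cdot\mathbf p'}{\mathbf q\cdot\mathbf q'}$$ and unit $\sum_{\lambda,\mu\in\mathcal V}e\binom\lambda\mu$. Let $w$ be the linear operator on $\mathbb C\mathcal G^2$ given by $w(\lambda|k,k)=\zeta^{-1}t\,(\lambda|k,k)$ and, for $i\ne j$ and $d=d(\lambda|i,j)$, $$w(\lambda|i,j)=-\zeta^{-1}\frac{t^{-d}}{[d]}(\lambda|i,j)+\zeta^{-1}\epsilon\frac{[d-1]}{[d]}(\lambda|j,i),$$ the last term being omitted if $(\lambda|j,i)\notin\mathcal G^2$. Write $w(\mathbf p)=\sum_{\mathbf r}w_{\mathbf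 r\mathbf p}\mathbf r$. Let $\mathfrak A(w)$ be the quotient of $\mathfrak H(\mathcal G)$ by the two-sided ideal generated by the elements $\sum_{\mathbf r\in\mathcal G^2}w_{\mathbf r\mathbf p}\,e\binom{\mathbf a}{\mathbf r}-\sum_{\mathbf c\in\mathcal G^2}w_{\mathbf a\mathbf c}\,e\binom{\mathbf c}{\mathbf p}$ ($\mathbf p,\mathbf a\in\mathcal G^2$). In $\mathfrak A(w)$ let $$\det=\sum_{\lambda,\mu\in\mathcal V}\frac{D(\mu)}{D(\lambda)}\sum_{\mathbf p\in\mathcal G^N_{\lambda\lambda}}(-\epsilon)^{\mathcal L(\mathbf p)+\mathcal L(\mathbf q_\mu)}\,e\tbinom{\mathbf p}{\mathbf q_\mu},$$ where $\mathbf q_\mu$ is a chosen element of $\mathcal G^N_{\mu\mu}$ for each $\mu$, and let $\mathfrak S=\mathfrak S(A_{N-1};t)_\epsilon=\mathfrak A(w)/(\det-1)$. The images of the $e\binom{\mathbf p}{\mathbf q}$ are denoted by the same symbols. Put $\mathring e_\lambda=\sum_\mu e\binom\lambda\mu$ and $e_\mu=\sum_\lambda e\binom\lambda\mu$. **Claim.**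 There is a coalgebra structure on $\mathfrak S$ with $\Delta\big(e\binom{\mathbf p}{\mathbf q}\big)=\sum_{\mathbf r\in\mathcal G^m}e\binom{\mathbf p}{\mathbf r}\otimes e\binom{\mathbf r}{\mathbf q}$ and $\varepsilon\big(e\binom{\mathbf p}{\mathbf q}\big)=\delta_{\mathbf p\mathbf q}$ for all $\mathbf p,\mathbf q\in\mathcal G^m$, $m\ge0$, and with it $\mathfrak S$ is a $\mathcal V$-face algebra, that is, for all $a,b\in\mathfrak S$ and $\lambda,\mu\in\mathcal V$: * $\Delta(ab)=\Delta(a)\Delta(b)$; * $e_\lambda e_\mu=\delta_{\lambda\mu}e_\lambda$, $\mathring e_\lambda\mathring e_\mu=\delta_{\lambda\mu}\mathring e_\lambda$, $e_\lambda\mathring e_\mu=\mathring e_\mu e_\lambda$, and $\sum_\nu e_\nu=1=\sum_\nu\mathring e_\nu$; * $\Delta(\mathring e_\lambda e_\mu)=\sum_\nu\mathring e_\lambda e_\nu\otimes\mathring e_\nu e_\mu$ and $\varepsilon(\mathring e_\lambda e_\mu)=\delta_{\lambda\mu}$; * $\varepsilon(ab)=\sum_\nu\varepsilon(ae_\nu)\varepsilon(\mathring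 e_\nu b)$. This face algebra has an antipode, that is, a linear map $S\colon\mathfrak S\to\mathfrak S$ such that for all $a$ $$\sum_{(a)}S(a_{(1)})a_{(2)}=\sum_\nu\varepsilon(ae_\nu)e_\nu,\qquad \sum_{(a)}a_{(1)}S(a_{(2)})=\sum_\nu\varepsilon(e_\nu a)\mathring e_\nu,\qquad \sum_{(a)}S(a_{(1)})a_{(2)}S(a_{(3)})=S(a),$$ and it satisfies, for all edges $(\lambda|i)$, $(\mu|j)$ and every $\mathbf b\in\mathcal G^{N-1}_{\lambda+\hat i,\,\lambda}$, $$S\Big(e\tbinom{\lambda|i}{\mu|j}\Big)=(-\epsilon)^{i+j}\,\frac{D(\lambda+\hat i)}{D(\mu+\hat j)}\sum_{\mathbf a\in\mathcal G^{N-1}_{\mu+\hat j,\,\mu}}(-\epsilon)^{\mathcal L(\mathbf a)+\mathcal L(\mathbf b)}\,e\tbinom{\mathbf a}{\mathbf b}.$$ Moreover, for all $m\ge0$ and $\mathbf p,\mathbf q\in\mathcal G^m$, $$S^2\Big(e\tbinom{\mathbf p}{\mathbf q}\Big)=\frac{D(r(\mathbf p))\,D(s(\mathbf q))}{D(s(\mathbf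 p))\,D(r(\mathbf q))}\;e\tbinom{\mathbf p}{\mathbf q}.$$ -/

import Mathlib

open scoped TensorProduct

namespace FaceAlgebra

noncomputable section

open scoped Classical in
/-- `δ_{ab}` with values in a field. -/
def delta (K : Type*) [Field K] {X : Type*} (a b : X) : K := if a = b then 1 else 0

/-! ### Face algebras and antipodes -/

/-- `H`, an algebra and a coalgebra over `K`, is a `V`-face algebra with face idempotents
`e v` (lower) and `e' v` (upper, written with a ring on top of the letter). -/
structure IsFaceAlgebra {K V H : Type*} [Field K] [Fintype V] [Ring H] [Algebra K H]
    [Coalgebra K H] (e e' : V → H) : Prop where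
  comul_mul : ∀ a b : H, Coalgebra.comul (R := K) (a * b) =
    Coalgebra.comul (R := K) a * Coalgebra.comul (R := K) b
  e_mul_e : ∀ v w : V, e v * e w = delta K v w • e v
  e'_mul_e' : ∀ v w : V, e' v * e' w = delta K v w • e' v
  e_mul_e' : ∀ v w : V, e v * e' w = e' w * e v
  sum_e : ∑ v, e v = 1
  sum_e' : ∑ v, e' v = 1
  comul_e'_e : ∀ v w : V, Coalgebra.comul (R := K) (e' v * e w) =
    ∑ u, (e' v * e u) ⊗ₜ[K] (e' u * e w)
  counit_e'_e : ∀ v w : V, Coalgebra.counit (R := K) (e' v * e w) = delta K v w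
  counit_mul : ∀ a b : H, Coalgebra.counit (R := K) (a * b) =
    ∑ u, Coalgebra.counit (R := K) (a * e u) * Coalgebra.counit (R := K) (e' u * b)

/-- The convolution product `a ↦ ∑ f(a₍₁₎) g(a₍₂₎)` of two linear endomorphisms. -/
def conv {K H : Type*} [Field K] [Ring H] [Algebra K H] [Coalgebra K H]
    (f g : H →ₗ[K] H) : H →ₗ[K] H :=
  LinearMap.mul' K H ∘ₗ TensorProduct.map f g ∘ₗ Coalgebra.comul

/-- `S` is an antipode of the `V`-face algebra `H` with face idempotents `e`, `e'`. -/
structure IsAntipode {K V H : Type*} [Field K] [Fintype V] [Ring H] [Algebra K H]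
    [Coalgebra K H] (e e' : V → H) (S : H →ₗ[K] H) : Prop where
  /-- `∑ S(a₍₁₎) a₍₂₎ = ∑_ν ε(a e_ν) e_ν` -/
  left : ∀ a : H, conv S LinearMap.id a = ∑ v, Coalgebra.counit (R := K) (a * e v) • e v
  /-- `∑ a₍₁₎ S(a₍₂₎) = ∑_ν ε(e_ν a) e'_ν` -/
  right : ∀ a : H, conv LinearMap.id S a = ∑ v, Coalgebra.counit (R := K) (e v * a) • e' v
  /-- `∑ S(a₍₁₎) a₍₂₎ S(a₍₃₎) = S(a)` -/
  middle : ∀ a : H, conv (conv S LinearMap.id) S a = S a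

/-! ### Oriented graphs and their paths -/

/-- An oriented graph with vertices `V`, edges `E`, and source and range maps. -/
structure OrientedGraph (V E : Type*) where
  s : E → V
  r : E → V

namespace OrientedGraph

/-- The edges of the list can be composed, starting from the given vertex. -/
def IsWalk {V E : Type*} (G : OrientedGraph V E) : V → List E → Prop
  | _, [] => True
  | v, a :: l => G.s a = v ∧ G.IsWalk (G.r a) l

/-- The last vertex of a walk. -/
def endpoint {V E : Type*} (G : OrientedGraph V E) : V → List E → V
  | v, [] => v
  | _, a :: l => G.endpoint (G.r a) l

theorem endpoint_append {V E : Type*} (G : OrientedGraph V E) (v : V) (l l' : List E) :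
    G.endpoint v (l ++ l') = G.endpoint (G.endpoint v l) l' := by
  induction l generalizing v with
  | nil => rfl
  | cons a l ih => exact ih _

theorem isWalk_append {V E : Type*} (G : OrientedGraph V E) (v : V) (l l' : List E)
    (h : G.IsWalk v l) (h' : G.IsWalk (G.endpoint v l) l') : G.IsWalk v (l ++ l') := by
  induction l generalizing v with
  | nil => exact h'
  | cons a l ih => exact ⟨h.1, ih _ h.2 h'⟩

/-- A path of arbitrary length: a starting vertex and a composable list of edges. -/
@[ext]
structure Walk {V E : Type*} (G : OrientedGraph V E) where
  source : V
  edges : List E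
  isWalk : G.IsWalk source edges

namespace Walk

def length {V E : Type*} {G : OrientedGraph V E} (p : G.Walk) : ℕ := p.edges.length

def range {V E : Type*} {G : OrientedGraph V E} (p : G.Walk) : V := G.endpoint p.source p.edges

/-- The concatenation `p · q` of composable paths. -/
def append {V E : Type*} {G : OrientedGraph V E} (p q : G.Walk) (h : p.range = q.source) :
    G.Walk where
  source := p.source
  edges := p.edges ++ q.edges
  isWalk := G.isWalk_append _ _ _ p.isWalk (by
    have := q.isWalk
    rw [← h] at this
    exact this)

theorem range_append {V E : Type*} {G : OrientedGraph V E} (p q : G.Walk)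
    (h : p.range = q.source) : (p.append q h).range = q.range := by
  show G.endpoint p.source (p.edges ++ q.edges) = G.endpoint q.source q.edges
  rw [endpoint_append]
  exact congrArg (fun v => G.endpoint v q.edges) h

theorem length_append {V E : Type*} {G : OrientedGraph V E} (p q : G.Walk)
    (h : p.range = q.source) : (p.append q h).length = p.length + q.length :=
  List.length_append

end Walk

/-- The set `G^m` of paths of length `m`. -/
def Path {V E : Type*} (G : OrientedGraph V E) (m : ℕ) : Type _ := {p : G.Walk // p.length = m}

namespace Path

def source {V E : Type*} {G : OrientedGraph V E} {m : ℕ} (p : G.Path m) : V := p.1.source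

def range {V E : Type*} {G : OrientedGraph V E} {m : ℕ} (p : G.Path m) : V := p.1.range

/-- A vertex as a path of length `0`. -/
def vertex {V E : Type*} (G : OrientedGraph V E) (v : V) : G.Path 0 :=
  ⟨⟨v, [], trivial⟩, rfl⟩

/-- An edge as a path of length `1`. -/
def ofEdge {V E : Type*} (G : OrientedGraph V E) (a : E) : G.Path 1 :=
  ⟨⟨G.s a, [a], rfl, trivial⟩, rfl⟩

instance {V E : Type*} [Finite V] [Finite E] (G : OrientedGraph V E) (m : ℕ) :
    Finite (G.Path m) := by
  have : Finite {l : List E // l.length = m} := (List.finite_length_eq E m).to_subtype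
  refine Finite.of_injective
    (fun p : G.Path m => (p.1.source, (⟨p.1.edges, p.2⟩ : {l : List E // l.length = m}))) ?_
  intro p q h
  have h1 := congrArg Prod.fst h
  have h2 := congrArg (fun x => x.2.1) h
  exact Subtype.ext (Walk.ext h1 h2)

instance {V E : Type*} [Finite V] [Finite E] (G : OrientedGraph V E) (m : ℕ) :
    Fintype (G.Path m) := Fintype.ofFinite _

end Path

open scoped Classical in
/-- The set `G^m_{vw}` of paths of length `m` from `v` to `w`. -/
def pathsBetween {V E : Type*} [Finite V] [Finite E] (G : OrientedGraph V E) (m : ℕ) (v w : V) :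
    Finset (G.Path m) :=
  Finset.univ.filter fun p => p.source = v ∧ p.range = w

theorem mem_pathsBetween {V E : Type*} [Finite V] [Finite E] {G : OrientedGraph V E} {m : ℕ}
    {v w : V} {p : G.Path m} : p ∈ G.pathsBetween m v w ↔ p.source = v ∧ p.range = w := by
  simp [pathsBetween]

/-- Pairs of paths of the same length: the indices of the basis symbols `e(p;q)`. -/
def PathPair {V E : Type*} (G : OrientedGraph V E) : Type _ :=
  {x : G.Walk × G.Walk // x.1.length = x.2.length}

namespace PathPair

/-- Both components of the two pairs can be concatenated. -/
def Composable {V E : Type*} {G : OrientedGraph V E} (x y : G.PathPair) : Prop :=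
  x.1.1.range = y.1.1.source ∧ x.1.2.range = y.1.2.source

def append {V E : Type*} {G : OrientedGraph V E} (x y : G.PathPair) (h : x.Composable y) :
    G.PathPair :=
  ⟨(x.1.1.append y.1.1 h.1, x.1.2.append y.1.2 h.2), by
    simp only [Walk.length_append, x.2, y.2]⟩

theorem ext' {V E : Type*} {G : OrientedGraph V E} {x y : G.PathPair}
    (h1 : x.1.1.source = y.1.1.source) (h2 : x.1.1.edges = y.1.1.edges)
    (h3 : x.1.2.source = y.1.2.source) (h4 : x.1.2.edges = y.1.2.edges) : x = y :=
  Subtype.ext (Prod.ext (Walk.ext h1 h2) (Walk.ext h3 h4))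

end PathPair

end OrientedGraph

open OrientedGraph

/-! ### The face algebra `H(G)` of a finite oriented graph -/

/-- The linear span of the symbols `e(p;q)`, with `p`, `q` paths of the same length. -/
def PathFaceAlgebra (K : Type*) [Field K] {V E : Type*} (G : OrientedGraph V E) : Type _ :=
  G.PathPair →₀ K

namespace PathFaceAlgebra

instance (K : Type*) [Field K] {V E : Type*} (G : OrientedGraph V E) :
    AddCommGroup (PathFaceAlgebra K G) :=
  inferInstanceAs (AddCommGroup (G.PathPair →₀ K))

instance (K : Type*) [Field K] {V E : Type*} (G : OrientedGraph V E) :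
    Module K (PathFaceAlgebra K G) :=
  inferInstanceAs (Module K (G.PathPair →₀ K))

/-- The basis symbol of a pair of paths. -/
def basisElt (K : Type*) [Field K] {V E : Type*} {G : OrientedGraph V E} (x : G.PathPair) :
    PathFaceAlgebra K G :=
  Finsupp.single (M := K) x 1

open scoped Classical in
/-- The product of basis symbols:
`e(p;q) e(p';q') = δ_{r(p) s(p')} δ_{r(q) s(q')} e(p·p'; q·q')`. -/
def mulBasis (K : Type*) [Field K] {V E : Type*} {G : OrientedGraph V E} (x y : G.PathPair) :
    PathFaceAlgebra K G :=
  if h : x.Composable y then basisElt K (x.append y h) else 0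

/-- The linear map with prescribed values on the basis symbols. -/
def lift (K : Type*) [Field K] {V E M : Type*} {G : OrientedGraph V E} [AddCommGroup M]
    [Module K M] (f : G.PathPair → M) : PathFaceAlgebra K G →ₗ[K] M :=
  Finsupp.linearCombination K f

theorem lift_basisElt (K : Type*) [Field K] {V E M : Type*} {G : OrientedGraph V E}
    [AddCommGroup M] [Module K M] (f : G.PathPair → M) (x : G.PathPair) :
    lift K f (basisElt K x) = f x := by
  have h : Finsupp.linearCombination K f (Finsupp.single x 1) = f x := by simp
  exact h

theorem hom_ext {K : Type*} [Field K] {V E M : Type*} {G : OrientedGraph V E}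
    [AddCommGroup M] [Module K M] {f g : PathFaceAlgebra K G →ₗ[K] M}
    (h : ∀ x, f (basisElt K x) = g (basisElt K x)) : f = g :=
  Finsupp.lhom_ext' (M := K) (fun x => LinearMap.ext_ring (h x))

/-- The bilinear extension of the product of basis symbols. -/
def mulLin (K : Type*) [Field K] {V E : Type*} (G : OrientedGraph V E) :
    PathFaceAlgebra K G →ₗ[K] PathFaceAlgebra K G →ₗ[K] PathFaceAlgebra K G :=
  lift K fun x => lift K fun y => mulBasis K x y

instance (K : Type*) [Field K] {V E : Type*} (G : OrientedGraph V E) :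
    Mul (PathFaceAlgebra K G) := ⟨fun a b => mulLin K G a b⟩

theorem mul_def {K : Type*} [Field K] {V E : Type*} {G : OrientedGraph V E}
    (a b : PathFaceAlgebra K G) : a * b = mulLin K G a b := rfl

theorem basisElt_mul (K : Type*) [Field K] {V E : Type*} {G : OrientedGraph V E}
    (x y : G.PathPair) : basisElt K x * basisElt K y = mulBasis K x y := by
  rw [mul_def, mulLin, lift_basisElt, lift_basisElt]

/-- The pair of paths of length `0` given by two vertices. -/
def vertexPair {V E : Type*} (G : OrientedGraph V E) (v w : V) : G.PathPair :=
  ⟨((Path.vertex G v).1, (Path.vertex G w).1), rfl⟩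

instance (K : Type*) [Field K] {V E : Type*} [Fintype V] (G : OrientedGraph V E) :
    One (PathFaceAlgebra K G) := ⟨∑ v : V, ∑ w : V, basisElt K (vertexPair G v w)⟩

theorem one_def (K : Type*) [Field K] {V E : Type*} [Fintype V] (G : OrientedGraph V E) :
    (1 : PathFaceAlgebra K G) = ∑ v : V, ∑ w : V, basisElt K (vertexPair G v w) := rfl

theorem mul_assoc_basis (K : Type*) [Field K] {V E : Type*} {G : OrientedGraph V E}
    (x y z : G.PathPair) :
    basisElt K x * basisElt K y * basisElt K z = basisElt K x * (basisElt K y * basisElt K z) := by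
  rw [basisElt_mul, basisElt_mul, mulBasis, mulBasis]
  by_cases h : x.Composable y <;> by_cases h' : y.Composable z
  · rw [dif_pos h, dif_pos h', basisElt_mul, basisElt_mul, mulBasis, mulBasis]
    have h1 : (x.append y h).Composable z :=
      ⟨(Walk.range_append _ _ h.1).trans h'.1, (Walk.range_append _ _ h.2).trans h'.2⟩
    have h2 : x.Composable (y.append z h') := h
    rw [dif_pos h1, dif_pos h2]
    congr 1
    exact PathPair.ext' rfl (List.append_assoc _ _ _) rfl (List.append_assoc _ _ _)
  · rw [dif_pos h, dif_neg h', basisElt_mul, mulBasis, dif_neg]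
    · simp [mul_def]
    · intro h1
      exact h' ⟨(Walk.range_append _ _ h.1).symm.trans h1.1,
        (Walk.range_append _ _ h.2).symm.trans h1.2⟩
  · rw [dif_neg h, dif_pos h', basisElt_mul, mulBasis, dif_neg]
    · simp [mul_def]
    · intro h1
      exact h h1
  · rw [dif_neg h, dif_neg h']
    simp [mul_def]

theorem mul_assoc' {K : Type*} [Field K] {V E : Type*} {G : OrientedGraph V E}
    (a b c : PathFaceAlgebra K G) : a * b * c = a * (b * c) := by
  have h1 : ∀ x y, mulLin K G (basisElt K x * basisElt K y) =
      mulLin K G (basisElt K x) ∘ₗ mulLin K G (basisElt K y) := fun x y =>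
    hom_ext fun z => mul_assoc_basis K x y z
  have h2 : ∀ x, (mulLin K G).flip c ∘ₗ mulLin K G (basisElt K x) =
      mulLin K G (basisElt K x) ∘ₗ (mulLin K G).flip c := fun x =>
    hom_ext fun y => congrArg (fun f => f c) (h1 x y)
  have h3 : (mulLin K G).flip c ∘ₗ (mulLin K G).flip b = (mulLin K G).flip (b * c) :=
    hom_ext fun x => congrArg (fun f => f b) (h2 x)
  exact congrArg (fun f => f a) h3

theorem one_mul_basis (K : Type*) [Field K] {V E : Type*} [Fintype V] {G : OrientedGraph V E}
    (x : G.PathPair) : 1 * basisElt K x = basisElt K x := by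
  rw [one_def, mul_def]
  simp only [map_sum, LinearMap.sum_apply]
  rw [Finset.sum_eq_single x.1.1.source, Finset.sum_eq_single x.1.2.source]
  · rw [← mul_def, basisElt_mul, mulBasis, dif_pos ⟨rfl, rfl⟩]
    congr 1
  · intro w _ hw
    rw [← mul_def, basisElt_mul, mulBasis, dif_neg]
    exact fun h => hw h.2
  · intro h; exact absurd (Finset.mem_univ _) h
  · intro v _ hv
    refine Finset.sum_eq_zero fun w _ => ?_
    rw [← mul_def, basisElt_mul, mulBasis, dif_neg]
    exact fun h => hv h.1
  · intro h; exact absurd (Finset.mem_univ _) h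

theorem mul_one_basis (K : Type*) [Field K] {V E : Type*} [Fintype V] {G : OrientedGraph V E}
    (x : G.PathPair) : basisElt K x * 1 = basisElt K x := by
  rw [one_def, mul_def]
  simp only [map_sum]
  rw [Finset.sum_eq_single x.1.1.range, Finset.sum_eq_single x.1.2.range]
  · rw [← mul_def, basisElt_mul, mulBasis, dif_pos ⟨rfl, rfl⟩]
    congr 1
    exact PathPair.ext' rfl (List.append_nil _) rfl (List.append_nil _)
  · intro w _ hw
    rw [← mul_def, basisElt_mul, mulBasis, dif_neg]
    exact fun h => hw h.2.symm
  · intro h; exact absurd (Finset.mem_univ _) h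
  · intro v _ hv
    refine Finset.sum_eq_zero fun w _ => ?_
    rw [← mul_def, basisElt_mul, mulBasis, dif_neg]
    exact fun h => hv h.1.symm
  · intro h; exact absurd (Finset.mem_univ _) h

instance (K : Type*) [Field K] {V E : Type*} [Fintype V] (G : OrientedGraph V E) :
    Ring (PathFaceAlgebra K G) :=
  { (inferInstance : AddCommGroup (PathFaceAlgebra K G)) with
    mul := (· * ·)
    one := 1
    left_distrib := fun a b c => map_add (mulLin K G a) b c
    right_distrib := fun a b c => by
      show mulLin K G (a + b) c = mulLin K G a c + mulLin K G b c
      rw [map_add, LinearMap.add_apply]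
    zero_mul := fun a => by
      show mulLin K G 0 a = 0
      rw [map_zero, LinearMap.zero_apply]
    mul_zero := fun a => map_zero (mulLin K G a)
    mul_assoc := mul_assoc'
    one_mul := fun a => by
      have : mulLin K G 1 = LinearMap.id := hom_ext fun x => one_mul_basis K x
      exact congrArg (fun f => f a) this
    mul_one := fun a => by
      have : (mulLin K G).flip 1 = LinearMap.id := hom_ext fun x => mul_one_basis K x
      exact congrArg (fun f => f a) this }

instance (K : Type*) [Field K] {V E : Type*} [Fintype V] (G : OrientedGraph V E) :
    Algebra K (PathFaceAlgebra K G) :=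
  Algebra.ofModule
    (fun c a b => by
      show mulLin K G (c • a) b = c • mulLin K G a b
      rw [map_smul, LinearMap.smul_apply])
    (fun c a b => map_smul (mulLin K G a) c b)

/-- The symbol `e(p;q)`, for paths `p`, `q` of length `m`. -/
def e (K : Type*) [Field K] {V E : Type*} {G : OrientedGraph V E} {m : ℕ} (p q : G.Path m) :
    PathFaceAlgebra K G :=
  basisElt K ⟨(p.1, q.1), p.2.trans q.2.symm⟩

end PathFaceAlgebra

/-! ### The face version of the FRT construction -/

/-- The two-sided ideal of `H(G)` generated by
`∑_r w(r, p) e(a; r) - ∑_c w(a, c) e(c; p)`, where `p`, `a` are paths of length `2` and `w(r, p)`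
is the coefficient of `r` in the image of `p` under the Boltzmann weight, viewed as an operator on
the span of the paths of length `2`. -/
def frtIdeal {K : Type*} [Field K] {V E : Type*} [Fintype V] [Finite E] (G : OrientedGraph V E)
    (w : G.Path 2 → G.Path 2 → K) : Ideal (PathFaceAlgebra K G) :=
  (TwoSidedIdeal.span {x | ∃ p a : G.Path 2,
    x = ∑ r, w r p • PathFaceAlgebra.e K a r - ∑ c, w a c • PathFaceAlgebra.e K c p}).asIdeal

instance {K : Type*} [Field K] {V E : Type*} [Fintype V] [Finite E] (G : OrientedGraph V E)
    (w : G.Path 2 → G.Path 2 → K) : (frtIdeal G w).IsTwoSided := by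
  unfold frtIdeal; infer_instance

/-- The algebra `A(w)` of a face model. -/
abbrev FRTAlgebra {K : Type*} [Field K] {V E : Type*} [Fintype V] [Finite E]
    (G : OrientedGraph V E) (w : G.Path 2 → G.Path 2 → K) : Type _ :=
  PathFaceAlgebra K G ⧸ frtIdeal G w

/-- The image of `e(p;q)` in `A(w)`. -/
def FRTAlgebra.e {K : Type*} [Field K] {V E : Type*} [Fintype V] [Finite E]
    {G : OrientedGraph V E} (w : G.Path 2 → G.Path 2 → K) {m : ℕ} (p q : G.Path m) :
    FRTAlgebra G w :=
  Ideal.Quotient.mk (frtIdeal G w) (PathFaceAlgebra.e K p q)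

/-! ### The graph of the `SU(N)_L`-SOS model

Vectors `∑ λ_k k̂` are recorded by their coordinates `λ_k`, which are unique up to adding a
constant (the vectors `1̂, …, N̂` of `ℝ^N` satisfy the single relation `∑ k̂ = 0`). Indices
`1, …, N` are written `0, …, N - 1`. -/

/-- The vertices `L ≥ λ_1 ≥ ⋯ ≥ λ_N = 0`. -/
def Vertex (N L : ℕ) : Type :=
  {l : Fin N → Fin (L + 1) // Antitone l ∧ ∀ k : Fin N, (k : ℕ) + 1 = N → l k = 0}

instance (N L : ℕ) : Fintype (Vertex N L) := by
  classical
  unfold Vertex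
  exact inferInstance

/-- The integer coordinate `λ_k`. -/
def Vertex.coord {N L : ℕ} (l : Vertex N L) (k : Fin N) : ℤ := ((l.1 k : ℕ) : ℤ)

/-- The vertex `0`. -/
def Vertex.zero (N L : ℕ) : Vertex N L := ⟨fun _ => 0, fun _ _ _ => le_refl _, fun _ _ => rfl⟩

/-- `l' = l + î`. -/
def IsStep {N L : ℕ} (l : Vertex N L) (i : Fin N) (l' : Vertex N L) : Prop :=
  ∃ c : ℤ, ∀ k, l'.coord k = l.coord k + (if k = i then 1 else 0) + c

/-- The edges `(λ | i)`: a vertex `λ`, an index `i` and the vertex `λ + î`. -/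
def Edge (N L : ℕ) : Type :=
  {x : Vertex N L × Fin N × Vertex N L // IsStep x.1 x.2.1 x.2.2}

instance (N L : ℕ) : Finite (Edge N L) := by
  unfold Edge
  exact inferInstance

/-- The index `i` of the edge `(λ | i)`. -/
def Edge.index {N L : ℕ} (a : Edge N L) : Fin N := a.1.2.1

/-- The graph of the `SU(N)_L`-SOS model. -/
def sosGraph (N L : ℕ) : OrientedGraph (Vertex N L) (Edge N L) where
  s a := a.1.1
  r a := a.1.2.2

/-- The list of indices `i_1, …, i_m` of the path `(λ | i_1, …, i_m)`. -/
def indices {N L m : ℕ} (p : (sosGraph N L).Path m) : List (Fin N) := p.1.edges.map Edge.index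

/-- `𝓛(λ | i_1, …, i_m)`, the number of pairs `k < l` with `i_k < i_l`. -/
def ell {N L m : ℕ} (p : (sosGraph N L).Path m) : ℕ :=
  (Finset.univ.filter fun x : Fin (indices p).length × Fin (indices p).length =>
    x.1 < x.2 ∧ (indices p).get x.1 < (indices p).get x.2).card

/-- `d(λ | i, j) = λ_i - λ_j + j - i`. -/
def dist {N L : ℕ} (l : Vertex N L) (i j : Fin N) : ℤ :=
  l.coord i - l.coord j + (j : ℤ) - (i : ℤ)

/-- `[n] = (t^n - t^{-n}) / (t - t^{-1})`. -/
def qInt (t : ℂ) (n : ℤ) : ℂ := (t ^ n - t ^ (-n)) / (t - t⁻¹)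

/-- `D(λ) = ∏_{i < j} [d(λ | i, j)] / [d(0 | i, j)]`. -/
def qDim {N L : ℕ} (t : ℂ) (l : Vertex N L) : ℂ :=
  ∏ x ∈ Finset.univ.filter (fun x : Fin N × Fin N => x.1 < x.2),
    qInt t (dist l x.1 x.2) / qInt t (dist (Vertex.zero N L) x.1 x.2)

open scoped Classical in
/-- The Boltzmann weight with parameters `t`, `ε`, `ζ`: the coefficient of the path `q` in the
image of the path `p`. In terms of faces, `p` runs along the top and the right hand side of the
face, and `q` along the left hand side and the bottom. For `p = (λ | i, j)` with `i ≠ j`, the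
coefficient of `p` is `-ζ⁻¹ t^{-d} / [d]` and that of `(λ | j, i)` is `ζ⁻¹ ε [d - 1] / [d]`, with
`d = d(λ | i, j)`; for `p = (λ | k, k)`, the coefficient of `p` is `ζ⁻¹ t`. -/
def boltzmann {N L : ℕ} (t ε ζ : ℂ) (q p : (sosGraph N L).Path 2) : ℂ :=
  ∑ i : Fin N, ∑ j : Fin N,
    if indices p = [i, j] ∧ q.source = p.source then
      if i = j then
        if indices q = [i, j] then ζ⁻¹ * t else 0
      else if indices q = [i, j] then
        -ζ⁻¹ * t ^ (-dist p.source i j) * (1 / qInt t (dist p.source i j))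
      else if indices q = [j, i] then
        ζ⁻¹ * ε * (qInt t (dist p.source i j - 1) / qInt t (dist p.source i j))
      else 0
    else 0

/-- The algebra `A(w_{N,t,ε,ζ})`. -/
abbrev SOSBialgebra (N L : ℕ) (t ε ζ : ℂ) : Type :=
  FRTAlgebra (sosGraph N L) (boltzmann t ε ζ)

/-! ### Loops of length `N` -/

/-- The rank of `a` in the cyclic order that starts at `i`. -/
def cyclicRank (N i a : ℕ) : ℕ := if i ≤ a then a - i else a + N - i

/-- For a suitable `i`, the vertices of the path `(μ | i, i + 1, …, N, 1, …, i - 1)` exist. -/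
theorem exists_cyclic_vertex {N L : ℕ} (m : Vertex N L) (i : Fin N)
    (hA : ∀ a b : Fin N, a < i → i ≤ b → m.coord b + 1 ≤ m.coord a)
    (hB : (i : ℕ) = 0 → ∀ a, m.coord a + 1 ≤ L) (k : ℕ) :
    ∃ v : Vertex N L, ∀ a : Fin N, v.coord a = m.coord a +
      (if cyclicRank N i a < k then 1 else 0) - (if cyclicRank N i (N - 1) < k then 1 else 0) := by
  have hi := i.2
  let last : Fin N := ⟨N - 1, by omega⟩
  have hlast : m.coord last = 0 := by
    have := m.2.2 last (show N - 1 + 1 = N by omega)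
    simp only [Vertex.coord, this]
    rfl
  have hanti : ∀ a b : Fin N, a ≤ b → m.coord b ≤ m.coord a := fun a b h => by
    have := m.2.1 h
    exact Int.ofNat_le.mpr this
  have hle : ∀ a : Fin N, m.coord a ≤ L := fun a => by
    have := (m.1 a).2
    simp only [Vertex.coord]
    omega
  have h0 : ∀ a : Fin N, 0 ≤ m.coord a := fun a => Int.natCast_nonneg _
  let c : Fin N → ℤ := fun a => m.coord a +
      (if cyclicRank N i a < k then 1 else 0) - (if cyclicRank N i (N - 1) < k then 1 else 0)
  have c0 : ∀ a, 0 ≤ c a := fun a => by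
    have := h0 a
    by_cases h : a < i
    · have := hA a last h (Fin.le_def.mpr (show (i : ℕ) ≤ N - 1 by omega))
      simp only [c]
      split_ifs <;> omega
    · have h' : (i : ℕ) ≤ a := not_lt.mp h
      have := a.2
      simp only [c, cyclicRank]
      split_ifs <;> omega
  have cL : ∀ a, c a ≤ L := fun a => by
    have h1 := hle a
    have ha := a.2
    by_cases h : a < i
    · have h' : (a : ℕ) < i := h
      simp only [c, cyclicRank]
      split_ifs <;> omega
    · by_cases hi0 : (i : ℕ) = 0
      · have := hB hi0 a
        simp only [c]
        split_ifs <;> omega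
      · let z : Fin N := ⟨0, by omega⟩
        have h2 := hA z a (Fin.lt_def.mpr (show 0 < (i : ℕ) by omega)) (not_lt.mp h)
        have h3 := hle z
        simp only [c]
        split_ifs <;> omega
  have cA : ∀ a b : Fin N, a ≤ b → c b ≤ c a := fun a b h => by
    have h1 := hanti a b h
    have h' : (a : ℕ) ≤ b := h
    have hb := b.2
    by_cases hab : a < i ∧ i ≤ b
    · have h2 := hA a b hab.1 hab.2
      simp only [c]
      split_ifs <;> omega
    · have hab' : ¬ ((a : ℕ) < i ∧ (i : ℕ) ≤ b) := hab
      simp only [c, cyclicRank]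
      split_ifs <;> omega
  refine ⟨⟨fun a => ⟨(c a).toNat, ?_⟩, ?_, ?_⟩, ?_⟩
  · have := c0 a
    have := cL a
    omega
  · intro a b h
    have := cA a b h
    exact Fin.le_def.mpr (Int.toNat_le_toNat this)
  · intro a ha
    have hal : a = last := Fin.ext (show (a : ℕ) = N - 1 by omega)
    apply Fin.ext
    show (c a).toNat = 0
    have : c a = 0 := by
      rw [hal]
      simp only [c, hlast, last]
      omega
    rw [this]
    rfl
  · intro a
    show ((c a).toNat : ℤ) = c a
    exact Int.toNat_of_nonneg (c0 a)

theorem Vertex.ext_coord {N L : ℕ} {v w : Vertex N L} (h : ∀ a, v.coord a = w.coord a) : v = w :=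
  Subtype.ext (funext fun a => Fin.ext (Int.ofNat_inj.mp (h a)))

theorem exists_cyclic_walk {N L : ℕ} (m : Vertex N L) (i : Fin N)
    (hA : ∀ a b : Fin N, a < i → i ≤ b → m.coord b + 1 ≤ m.coord a)
    (hB : (i : ℕ) = 0 → ∀ a, m.coord a + 1 ≤ L) :
    ∃ v : ℕ → Vertex N L, (∀ k a, (v k).coord a = m.coord a +
      (if cyclicRank N i a < k then 1 else 0) - (if cyclicRank N i (N - 1) < k then 1 else 0)) ∧
      v 0 = m ∧ v N = m ∧ ∀ n k : ℕ, k + n ≤ N → ∃ l : List (Edge N L), l.length = n ∧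
      (sosGraph N L).IsWalk (v k) l ∧ (sosGraph N L).endpoint (v k) l = v (k + n) := by
  choose v hv using exists_cyclic_vertex m i hA hB
  have hi := i.2
  have hwalk : ∀ n k : ℕ, k + n ≤ N → ∃ l : List (Edge N L), l.length = n ∧
      (sosGraph N L).IsWalk (v k) l ∧ (sosGraph N L).endpoint (v k) l = v (k + n) := by
    intro n
    induction n with
    | zero => exact fun k _ => ⟨[], rfl, trivial, rfl⟩
    | succ n ih =>
      intro k hk
      obtain ⟨l, h1, h2, h3⟩ := ih (k + 1) (by omega)
      let a : Fin N := ⟨if k + i < N then k + i else k + i - N, by split_ifs <;> omega⟩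
      have hstep : IsStep (v k) a (v (k + 1)) := by
        refine ⟨-(if cyclicRank N i (N - 1) = k then 1 else 0), fun b => ?_⟩
        have hb : b = a ↔ cyclicRank N i b = k := by
          have := b.2
          rw [Fin.ext_iff]
          simp only [a, cyclicRank]
          split_ifs <;> omega
        rw [hv, hv]
        simp only [hb]
        split_ifs <;> omega
      refine ⟨⟨(v k, a, v (k + 1)), hstep⟩ :: l, congrArg (· + 1) h1, ⟨rfl, h2⟩, ?_⟩
      rw [show k + (n + 1) = k + 1 + n by omega]
      exact h3
  have hv0 : v 0 = m := Vertex.ext_coord fun a => by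
    rw [hv]
    simp
  have hvN : v N = m := Vertex.ext_coord fun a => by
    have := a.2
    rw [hv, if_pos, if_pos]
    · omega
    · simp only [cyclicRank]
      split_ifs <;> omega
    · simp only [cyclicRank]
      split_ifs <;> omega
  exact ⟨v, hv, hv0, hvN, hwalk⟩

/-- For every edge `(λ | i)`, there are paths of length `N - 1` from `λ + î` to `λ`. -/
theorem exists_return {N L : ℕ} (hN : 2 ≤ N) (x : Edge N L) :
    (pathsBetween (sosGraph N L) (N - 1) ((sosGraph N L).r x) ((sosGraph N L).s x)).Nonempty := by
  obtain ⟨⟨m, i, m'⟩, c, hc⟩ := x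
  simp only at hc
  have hi := i.2
  have hanti : ∀ (u : Vertex N L) (a b : Fin N), a ≤ b → u.coord b ≤ u.coord a :=
    fun u a b h => Int.ofNat_le.mpr (u.2.1 h)
  let last : Fin N := ⟨N - 1, by omega⟩
  have hlast : ∀ u : Vertex N L, u.coord last = 0 := fun u => by
    have := u.2.2 last (show N - 1 + 1 = N by omega)
    simp only [Vertex.coord, this]
    rfl
  have hii := hc i
  rw [if_pos rfl] at hii
  have hl := hc last
  rw [hlast, hlast] at hl
  have hA : ∀ a b : Fin N, a < i → i ≤ b → m.coord b + 1 ≤ m.coord a := fun a b ha hb => by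
    have h1 := hanti m' a i ha.le
    have h2 := hanti m i b hb
    have h3 := hc a
    rw [if_neg ha.ne] at h3
    omega
  have hB : (i : ℕ) = 0 → ∀ a, m.coord a + 1 ≤ L := fun h0 a => by
    have h1 := hanti m i a (Fin.le_def.mpr (by omega))
    have h2 : last ≠ i := fun h => by
      have := congrArg Fin.val h
      simp only [last] at this
      omega
    rw [if_neg h2] at hl
    have h3 : m'.coord i ≤ L := by
      have := (m'.1 i).2
      simp only [Vertex.coord]
      omega
    omega
  obtain ⟨v, hv, hv0, hvN, hwalk⟩ := exists_cyclic_walk m i hA hB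
  have hv1 : v 1 = m' := Vertex.ext_coord fun a => by
    have h1 : cyclicRank N i a < 1 ↔ a = i := by
      have := a.2
      rw [Fin.ext_iff]
      simp only [cyclicRank]
      split_ifs <;> omega
    have h2 : cyclicRank N i (N - 1) < 1 ↔ last = i := by
      rw [Fin.ext_iff]
      simp only [cyclicRank, last]
      split_ifs <;> omega
    rw [hv, hc]
    simp only [h1, h2]
    omega
  obtain ⟨l, h1, h2, h3⟩ := hwalk (N - 1) 1 (by omega)
  rw [show 1 + (N - 1) = N by omega, hvN, hv1] at h3
  rw [hv1] at h2
  exact ⟨⟨⟨m', l, h2⟩, h1⟩, mem_pathsBetween.mpr ⟨rfl, h3⟩⟩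

/-- There are paths of length `N` from every vertex to itself. -/
theorem exists_loop {N L : ℕ} (hN : 0 < N) (hL : 0 < L) (m : Vertex N L) :
    (pathsBetween (sosGraph N L) N m m).Nonempty := by
  have hex : ∃ i : Fin N, (∀ a b : Fin N, a < i → i ≤ b → m.coord b + 1 ≤ m.coord a) ∧
      ((i : ℕ) = 0 → ∀ a, m.coord a + 1 ≤ L) := by
    have hanti : ∀ a b : Fin N, a ≤ b → m.coord b ≤ m.coord a := fun a b h =>
      Int.ofNat_le.mpr (m.2.1 h)
    let z : Fin N := ⟨0, hN⟩
    let last : Fin N := ⟨N - 1, by omega⟩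
    have hlast : m.coord last = 0 := by
      have := m.2.2 last (show N - 1 + 1 = N by omega)
      simp only [Vertex.coord, this]
      rfl
    by_cases hz : m.coord z + 1 ≤ L
    · refine ⟨z, fun a b h => absurd (Fin.lt_def.mp h) (by simp [z]), fun _ a => ?_⟩
      have := hanti z a (Fin.le_def.mpr (Nat.zero_le _))
      omega
    · have hn : ∃ n : ℕ, ∃ h : n < N, m.coord ⟨n, h⟩ < m.coord z :=
        ⟨N - 1, by omega, by
          have : m.coord last = 0 := hlast
          simp only [last] at this
          omega⟩
      classical
      obtain ⟨hlt, hc⟩ := Nat.find_spec hn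
      refine ⟨⟨Nat.find hn, hlt⟩, fun a b ha hb => ?_, fun h0 => ?_⟩
      · have h1 := Nat.find_min hn (Fin.lt_def.mp ha)
        have h2 : ¬ m.coord a < m.coord z := fun h => h1 ⟨a.2, h⟩
        have h3 := hanti _ _ hb
        omega
      · exfalso
        have : (⟨Nat.find hn, hlt⟩ : Fin N) = z := Fin.ext h0
        rw [this] at hc
        exact lt_irrefl _ hc
  obtain ⟨i, hA, hB⟩ := hex
  obtain ⟨v, hv, hv0, hvN, hwalk⟩ := exists_cyclic_walk m i hA hB
  obtain ⟨l, h1, h2, h3⟩ := hwalk N 0 (by omega)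
  rw [Nat.zero_add, hvN, hv0] at h3
  rw [hv0] at h2
  exact ⟨⟨⟨m, l, h2⟩, h1⟩, mem_pathsBetween.mpr ⟨rfl, h3⟩⟩

/-! ### The quantum determinant and the `SU(N)_L`-SOS algebra -/

open scoped Classical in
/-- `det(λ; μ) = D(μ)/D(λ) ∑_p (-ε)^{𝓛(p) + 𝓛(q)} e(p;q)`, where `q` is a chosen path of length
`N` from `μ` to `μ` and `p` runs over all paths of length `N` from `λ` to `λ`. The path `q` exists
for positive `N`, `L`, by `exists_loop`. -/
def detEntry {N L : ℕ} (t ε ζ : ℂ) (l m : Vertex N L) : SOSBialgebra N L t ε ζ :=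
  if h : (pathsBetween (sosGraph N L) N m m).Nonempty then
    (qDim t m / qDim t l) • ∑ p ∈ pathsBetween (sosGraph N L) N l l,
      (-ε) ^ (ell p + ell h.choose) • FRTAlgebra.e (boltzmann t ε ζ) p h.choose
  else 0

/-- The quantum determinant `det = ∑_{λ, μ} det(λ; μ)`. -/
def qDet (N L : ℕ) (t ε ζ : ℂ) : SOSBialgebra N L t ε ζ :=
  ∑ l : Vertex N L, ∑ m : Vertex N L, detEntry t ε ζ l m

/-- The two-sided ideal of `A(w_{N,t,ε,ζ})` generated by `det - 1`. -/
def detIdeal (N L : ℕ) (t ε ζ : ℂ) : Ideal (SOSBialgebra N L t ε ζ) :=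
  (TwoSidedIdeal.span {qDet N L t ε ζ - 1}).asIdeal

instance (N L : ℕ) (t ε ζ : ℂ) : (detIdeal N L t ε ζ).IsTwoSided := by
  unfold detIdeal; infer_instance

/-- The `SU(N)_L`-SOS algebra `S(A_{N-1};t)_ε = A(w_{N,t,ε,ζ}) / (det - 1)`. -/
abbrev SOSAlgebra (N L : ℕ) (t ε ζ : ℂ) : Type :=
  SOSBialgebra N L t ε ζ ⧸ detIdeal N L t ε ζ

/-- The image of `e(p;q)` in the `SU(N)_L`-SOS algebra. -/
def sosE {N L : ℕ} (t ε ζ : ℂ) {m : ℕ} (p q : (sosGraph N L).Path m) : SOSAlgebra N L t ε ζ :=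
  Ideal.Quotient.mk (detIdeal N L t ε ζ) (FRTAlgebra.e (boltzmann t ε ζ) p q)

/-- The lower face idempotent `e_μ = ∑_λ e(λ;μ)`. -/
def sosFace {N L : ℕ} (t ε ζ : ℂ) (m : Vertex N L) : SOSAlgebra N L t ε ζ :=
  ∑ l, sosE t ε ζ (Path.vertex (sosGraph N L) l) (Path.vertex (sosGraph N L) m)

/-- The upper face idempotent `e'_λ = ∑_μ e(λ;μ)`. -/
def sosFace' {N L : ℕ} (t ε ζ : ℂ) (l : Vertex N L) : SOSAlgebra N L t ε ζ :=
  ∑ m, sosE t ε ζ (Path.vertex (sosGraph N L) l) (Path.vertex (sosGraph N L) m)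

end

end FaceAlgebra

open FaceAlgebra

namespace FaceAlgebra

noncomputable section

open OrientedGraph

/-! ### Vertices, letters and words -/

/-! The relations of `A(w)` say that the matrix of symbols e(p;q), with p and q of length 2,
commutes with the weight w. A functional that is antisymmetric in the two letters of a path is an
eigenvector of w (`SOSParams.wDiag_sub`). Hence summing symbols over their rows against an
alternating function of words gives a function of the column that is again antisymmetric
(`FaceRep.Rel.antisym`).

On the truncated graph antisymmetry is only available between words that are both paths, so it is
not evident that it behaves as in an exterior algebra. It does: values on orderings of the same
distinct letters agree up to sign (`Antisym.perm`), and words with a repeated letter give zero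
(`Antisym.eq_zero`). The proof is arithmetic modulo N + L: the numbers d(λ|i,j) with i ≠ j are never
divisible by N + L, and λ + î is a vertex exactly when no d(λ|i,j) + 1 with j ≠ i is (`ok_iff`). By
`SOSParams.qInt_eq_zero_iff` these are also the conditions under which quantum integers vanish.

Once det = 1, the antisymmetrised symbol of a full column is a known multiple of a vertex symbol
(`FaceRep.IsSOS.Phi_univ`). Laplace expansion along the last letter makes the cofactors a left
inverse of the matrix of edge symbols (`FaceRep.IsSOS.cof_mul`). Expansion along the first letter
gives a relation in the other order, contracted over the other index and twisted by ratios of D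
(`FaceRep.IsSOS.mul_cof`). To turn it into a right inverse one transposes: e(p;q) ↦ g(p)/g(q)
e(q;p), with g a product of quantum integers along the path. The relations survive because w is
symmetric up to g, and det = 1 survives because the sum of g over all loops at λ is a constant times
D(λ)² (`SOSParams.gaugeSum_eq`, `SOSParams.gaugeSum_mul`), which rests on a Lagrange interpolation
identity (`SOSParams.sum_prod_qInt`). The transposed twisted relation is a right inverse, and a left
and a right inverse coincide (`FaceRep.IsSOS.cof_eq_cofRight`).

The structure maps come from one universal property. A `FaceRep` encodes a multiplicative map from
the path algebra, and this map factors through the SOS algebra if it respects the relations and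
sends the determinant to the image of 1 (`FaceRep.exists_hom`). Units need not be preserved, because
Δ(1) ≠ 1 ⊗ 1 in a face algebra. The coproduct is such a map into the tensor square, the antipode one
into the opposite algebra, and the counit is the sum of the entries of such a map into matrices
indexed by the vertices. The antipode respects the relations because the inverse of a matrix that
commutes with w also commutes with w. Finally, applying S to the left inverse relation and comparing
with the twisted relation gives S² on edges, and multiplicativity of S² extends the formula to all
paths. -/

/-- The edge `(v | i)` exists. -/
def Ok {N L : ℕ} (v : Vertex N L) (i : Fin N) : Prop := ∃ v', IsStep v i v'

open scoped Classical in
/-- The vertex `v + î`, or `v` if there is no such vertex. -/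
def act {N L : ℕ} (v : Vertex N L) (i : Fin N) : Vertex N L :=
  if h : Ok v i then h.choose else v

/-- The word `w` is the sequence of indices of a path that starts at `v`. -/
def Valid {N L : ℕ} : Vertex N L → List (Fin N) → Prop
  | _, [] => True
  | v, i :: w => Ok v i ∧ Valid (act v i) w

/-- The endpoint of the path with source `v` and indices `w`. -/
def run {N L : ℕ} : Vertex N L → List (Fin N) → Vertex N L
  | v, [] => v
  | v, i :: w => run (act v i) w

/-! ### Which steps and words stay inside the set of vertices. -/

section Combinatorics

variable {N L : ℕ}

theorem dist_add (v : Vertex N L) (i j k : Fin N) : dist v i j + dist v j k = dist v i k := by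
  simp only [dist]; ring

theorem dist_swap (v : Vertex N L) (i j : Fin N) : dist v j i = -dist v i j := by
  simp only [dist]; ring

theorem coord_antitone (v : Vertex N L) {i j : Fin N} (h : i ≤ j) : v.coord j ≤ v.coord i :=
  Int.ofNat_le.mpr (v.2.1 h)

theorem coord_nonneg (v : Vertex N L) (i : Fin N) : 0 ≤ v.coord i := Int.natCast_nonneg _

theorem coord_le (v : Vertex N L) (i : Fin N) : v.coord i ≤ L := by
  have := (v.1 i).2
  simp only [Vertex.coord]
  omega

theorem coord_last (v : Vertex N L) (i : Fin N) (h : (i : ℕ) + 1 = N) : v.coord i = 0 := by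
  simp only [Vertex.coord, v.2.2 i h]
  rfl

theorem dist_pos (v : Vertex N L) {i j : Fin N} (h : i < j) : 0 < dist v i j := by
  have h1 := coord_antitone v h.le
  have h2 : (i : ℕ) < j := h
  simp only [dist]
  omega

theorem dist_lt (v : Vertex N L) (i j : Fin N) : dist v i j < (N + L : ℕ) := by
  have h1 := coord_le v i
  have h2 := coord_nonneg v j
  have h3 := j.2
  simp only [dist]
  omega

/-- For i < j the coordinates decrease weakly and the index shift is positive, so the distance lies
strictly between 0 and N + L; the case i > j follows by sign. -/
theorem not_dvd_dist (v : Vertex N L) {i j : Fin N} (h : i ≠ j) :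
    ¬ ((N + L : ℕ) : ℤ) ∣ dist v i j := by
  rcases lt_or_gt_of_ne h with h | h
  · exact fun hd => absurd (Int.le_of_dvd (dist_pos v h) hd) (not_le.mpr (dist_lt v i j))
  · rw [dist_swap, dvd_neg]
    exact fun hd => absurd (Int.le_of_dvd (dist_pos v h) hd) (not_le.mpr (dist_lt v j i))

/-- The last coordinate is normalised to zero, so the distances to the last index recover all
coordinates. -/
theorem Vertex.ext_dist {v w : Vertex N L} (h : ∀ i j, dist v i j = dist w i j) : v = w := by
  refine Vertex.ext_coord fun a => ?_
  have ha := a.2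
  have h1 := h a ⟨N - 1, by omega⟩
  have h2 := coord_last v ⟨N - 1, by omega⟩ (by simp only; omega)
  have h3 := coord_last w ⟨N - 1, by omega⟩ (by simp only; omega)
  simp only [dist] at h1
  omega

/-- Distances do not see a common shift of the coordinates, so the undetermined constant in `IsStep`
disappears. -/
theorem isStep_iff_dist {v v' : Vertex N L} {i : Fin N} : IsStep v i v' ↔
    ∀ a b, dist v' a b = dist v a b + (if a = i then 1 else 0) - (if b = i then 1 else 0) := by
  constructor
  · rintro ⟨c, hc⟩ a b
    simp only [dist, hc]
    ring
  · intro h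
    -- The value of the shift is forced by the coordinate at `i`.
    refine ⟨v'.coord i - v.coord i - 1, fun k => ?_⟩
    have := h k i
    simp only [dist, if_pos] at this
    split_ifs at this ⊢ <;> omega

theorem isStep_act {v : Vertex N L} {i : Fin N} (h : Ok v i) : IsStep v i (act v i) := by
  rw [act, dif_pos h]
  exact h.choose_spec

theorem dist_act {v : Vertex N L} {i : Fin N} (h : Ok v i) (a b : Fin N) :
    dist (act v i) a b = dist v a b + (if a = i then 1 else 0) - (if b = i then 1 else 0) :=
  isStep_iff_dist.mp (isStep_act h) a b

theorem isStep_iff {v v' : Vertex N L} {i : Fin N} : IsStep v i v' ↔ Ok v i ∧ act v i = v' := by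
  constructor
  · intro h
    refine ⟨⟨v', h⟩, Vertex.ext_dist fun a b => ?_⟩
    rw [dist_act ⟨v', h⟩, isStep_iff_dist.mp h]
  · rintro ⟨h, rfl⟩
    exact isStep_act h

theorem act_injective {u v : Vertex N L} {i : Fin N} (hu : Ok u i) (hv : Ok v i)
    (h : act u i = act v i) : u = v := by
  refine Vertex.ext_dist fun a b => ?_
  have h1 := dist_act hu a b
  rw [h, dist_act hv] at h1
  omega

/-- This is `not_dvd_dist` at the end of the edge, where the distance has grown by one. -/
theorem not_dvd_of_ok {v : Vertex N L} {i j : Fin N} (h : Ok v i) (hj : j ≠ i) :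
    ¬ ((N + L : ℕ) : ℤ) ∣ dist v i j + 1 := by
  have := not_dvd_dist (act v i) hj.symm
  rw [dist_act h, if_pos rfl, if_neg hj] at this
  simpa using this

/-- A vector of integers is the coordinate vector of a vertex. -/
theorem exists_vertex (c : Fin N → ℤ) (h0 : ∀ a, 0 ≤ c a) (hL : ∀ a, c a ≤ L)
    (ha : ∀ a b, a ≤ b → c b ≤ c a) (hlast : ∀ a : Fin N, (a : ℕ) + 1 = N → c a = 0) :
    ∃ v : Vertex N L, ∀ a, v.coord a = c a := by
  refine ⟨⟨fun a => ⟨(c a).toNat, ?_⟩, ?_, ?_⟩, ?_⟩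
  · have := h0 a
    have := hL a
    omega
  · intro a b h
    exact Fin.le_def.mpr (Int.toNat_le_toNat (ha a b h))
  · intro a h
    apply Fin.ext
    show (c a).toNat = 0
    rw [hlast a h]
    rfl
  · intro a
    show ((c a).toNat : ℤ) = c a
    exact Int.toNat_of_nonneg (h0 a)

/-- Adding one to the coordinate at `i` can only fail in two ways: it meets an equal coordinate
before it, or, for the first index, it exceeds the level. Each failure is a divisibility excluded by
the hypothesis. -/
theorem ok_of_not_dvd (hN : 2 ≤ N) {v : Vertex N L} {i : Fin N}
    (h : ∀ j, j ≠ i → ¬ ((N + L : ℕ) : ℤ) ∣ dist v i j + 1) : Ok v i := by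
  have hi := i.2
  have hlt : ∀ j, j < i → v.coord i < v.coord j := by
    intro j hj
    by_contra hc
    have hj' : (j : ℕ) < i := hj
    -- By monotonicity the coordinates at `i - 1` and `i` are equal, so d(v | i, i - 1) = -1.
    let k : Fin N := ⟨i - 1, by omega⟩
    have hk : k ≠ i := fun h => by
      have := congrArg Fin.val h
      simp only [k] at this
      omega
    have h1 := coord_antitone v (show j ≤ k from Fin.le_def.mpr (by simp only [k]; omega))
    have h2 := coord_antitone v (show k ≤ i from Fin.le_def.mpr (by simp only [k]; omega))
    have h3 : dist v i k + 1 = 0 := by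
      simp only [dist]
      simp only [k] at h1 h2 ⊢
      omega
    exact h k hk (by rw [h3]; exact dvd_zero _)
  have hroom : (i : ℕ) = 0 → v.coord i + 1 ≤ L := by
    intro h0
    by_contra hc
    have h1 := coord_le v i
    -- The cyclic wall: a full first coordinate is at distance N + L - 1 from the last index, which
    -- differs from the first since N ≥ 2.
    let k : Fin N := ⟨N - 1, by omega⟩
    have hk : k ≠ i := fun h => by
      have := congrArg Fin.val h
      simp only [k] at this
      omega
    have h2 := coord_last v k (by simp only [k]; omega)
    have h3 : dist v i k + 1 = ((N + L : ℕ) : ℤ) := by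
      simp only [dist, h2]
      simp only [k]
      push_cast
      omega
    exact h k hk (by rw [h3])
  have hroom' : v.coord i + 1 ≤ L := by
    by_cases h0 : (i : ℕ) = 0
    · exact hroom h0
    · have := hlt ⟨0, by omega⟩ (Fin.lt_def.mpr (by simp only; omega))
      have := coord_le v ⟨0, by omega⟩
      omega
  -- Raising the last coordinate breaks the normalisation, so one is subtracted everywhere; `hlt`
  -- guarantees that the other coordinates are positive.
  by_cases hl : (i : ℕ) + 1 = N
  · have hi0 := coord_last v i hl
    obtain ⟨v', hv'⟩ := exists_vertex (L := L)
      (fun a => v.coord a + (if a = i then 1 else 0) - 1) (fun a => by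
        split_ifs with hai
        · rw [hai, hi0]; omega
        · have := hlt a (Fin.lt_def.mpr (by have := a.2; have := Fin.val_ne_of_ne hai; omega))
          omega) (fun a => by
        have := coord_le v a
        split_ifs <;> omega) (fun a b hab => by
        have h1 := coord_antitone v hab
        split_ifs with h2 h3 h3
        · omega
        · have := hlt a (lt_of_le_of_ne (h2 ▸ hab) h3)
          rw [h2]
          omega
        · omega
        · omega) (fun a ha => by
        have : a = i := Fin.ext (by omega)
        simp only [this, if_true, hi0]
        norm_num)
    exact ⟨v', -1, fun k => by rw [hv']; ring⟩
  · obtain ⟨v', hv'⟩ := exists_vertex (L := L)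
      (fun a => v.coord a + (if a = i then 1 else 0)) (fun a => by
        have := coord_nonneg v a
        split_ifs <;> omega) (fun a => by
        have := coord_le v a
        split_ifs with h1
        · rw [h1]; exact hroom'
        · omega) (fun a b hab => by
        have h1 := coord_antitone v hab
        split_ifs with h2 h3 h3
        · omega
        · have := hlt a (lt_of_le_of_ne (h2 ▸ hab) h3)
          rw [h2]
          omega
        · omega
        · omega) (fun a ha => by
        have : a ≠ i := fun h => hl (h ▸ ha)
        simp only [this, if_false, coord_last v a ha]
        norm_num)
    exact ⟨v', 0, fun k => by rw [hv']; ring⟩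

/-- From here on coordinates are hardly needed: existence of edges becomes a condition on residues
modulo N + L in which no index is special. -/
theorem ok_iff (hN : 2 ≤ N) {v : Vertex N L} {i : Fin N} :
    Ok v i ↔ ∀ j, j ≠ i → ¬ ((N + L : ℕ) : ℤ) ∣ dist v i j + 1 :=
  ⟨fun h _ hj => not_dvd_of_ok h hj, ok_of_not_dvd hN⟩

theorem valid_append {v : Vertex N L} {w w' : List (Fin N)} :
    Valid v (w ++ w') ↔ Valid v w ∧ Valid (run v w) w' := by
  induction w generalizing v with
  | nil => simp [Valid, run]
  | cons i w ih => simp only [List.cons_append, Valid, run, ih, and_assoc]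

theorem dist_run {v : Vertex N L} {w : List (Fin N)} (h : Valid v w) (a b : Fin N) :
    dist (run v w) a b = dist v a b + w.count a - w.count b := by
  induction w generalizing v with
  | nil => simp [run]
  | cons i w ih =>
    rw [run, ih h.2, dist_act h.1, List.count_cons, List.count_cons]
    simp only [beq_iff_eq, eq_comm (a := i)]
    push_cast
    split_ifs <;> omega

/-- By `dist_run` the endpoint depends only on how often each letter occurs. -/
theorem run_eq_of_perm {v : Vertex N L} {w w' : List (Fin N)} (h : Valid v w) (h' : Valid v w')
    (hp : w.Perm w') : run v w = run v w' :=
  Vertex.ext_dist fun a b => by rw [dist_run h, dist_run h', hp.count_eq, hp.count_eq]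

theorem not_dvd_sub_one_of_ok {v : Vertex N L} {i j : Fin N} (h : Ok v j) (hij : i ≠ j) :
    ¬ ((N + L : ℕ) : ℤ) ∣ dist v i j - 1 := by
  have := not_dvd_of_ok h hij
  rwa [dist_swap, show -dist v i j + 1 = -(dist v i j - 1) by ring, dvd_neg] at this

/-- If `(v | i, j)` is a path, then so is `(v | j, i)`, provided that `d(v | i, j) ≠ 1`. -/
theorem valid_swap (hN : 2 ≤ N) {v : Vertex N L} {i j : Fin N} (h : Valid v [i, j]) (hij : i ≠ j)
    (hd : ¬ ((N + L : ℕ) : ℤ) ∣ dist v i j - 1) : Valid v [j, i] := by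
  obtain ⟨hi, hj, -⟩ := h
  have hvj : Ok v j := by
    rw [ok_iff hN]
    intro k hk
    -- The step `i` changes the distance from `j` to `k` only for `k = i`; every other obstruction
    -- to `j` at `v` would also be present after `i`.
    by_cases hki : k = i
    · rwa [hki, dist_swap, show -dist v i j + 1 = -(dist v i j - 1) by ring, dvd_neg]
    · have := not_dvd_of_ok hj hk
      rwa [dist_act hi, if_neg hij.symm, if_neg hki, add_zero, sub_zero] at this
  refine ⟨hvj, ?_, trivial⟩
  rw [ok_iff hN]
  intro k hk
  rw [dist_act hvj, if_neg hij]
  by_cases hkj : k = j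
  · rw [if_pos hkj, hkj]
    simpa using not_dvd_dist v hij
  · simpa [if_neg hkj] using not_dvd_of_ok hi hk

/-- The step `j` changes only the distance from `i` to `j` among those starting at `i`, and there
the condition becomes that d(v | i, j) itself is not divisible by N + L, which always holds. -/
theorem ok_act_of_ok (hN : 2 ≤ N) {v : Vertex N L} {i j : Fin N} (hi : Ok v i) (hj : Ok v j)
    (hij : i ≠ j) : Ok (act v j) i := by
  rw [ok_iff hN]
  intro k hk
  rw [dist_act hj, if_neg hij]
  by_cases hkj : k = j
  · rw [if_pos hkj, hkj]
    simpa using not_dvd_dist v hij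
  · simpa [if_neg hkj] using not_dvd_of_ok hi hk

theorem valid_cons_cons_swap {v : Vertex N L} {i j : Fin N} {w : List (Fin N)}
    (h : Valid v (i :: j :: w)) (h' : Valid v [j, i]) : Valid v (j :: i :: w) := by
  refine ⟨h'.1, h'.2.1, ?_⟩
  have : run v [j, i] = run v [i, j] :=
    run_eq_of_perm h' ⟨h.1, h.2.1, trivial⟩ (List.Perm.swap i j [])
  rw [show act (act v j) i = act (act v i) j from this]
  exact h.2.2

end Combinatorics

/-! ### Antisymmetric functions on words -/

/-- The sign `(-ε)^𝓛` of a word. -/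
def sgn {N : ℕ} (ε : ℂ) : List (Fin N) → ℂ
  | [] => 1
  | i :: w => (-ε) ^ (w.countP fun j => i < j) * sgn ε w

/-- `F` is antisymmetric on the paths that start at `v`. -/
structure Antisym {N L : ℕ} {M : Type*} [AddCommGroup M] [Module ℂ M] (ε : ℂ) (v : Vertex N L)
    (F : List (Fin N) → M) : Prop where
  swap : ∀ (α : List (Fin N)) (i j : Fin N) (β : List (Fin N)), i ≠ j →
    Valid v (α ++ i :: j :: β) → Valid v (α ++ j :: i :: β) →
    F (α ++ j :: i :: β) = (-ε) • F (α ++ i :: j :: β)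
  same : ∀ (α : List (Fin N)) (k : Fin N) (β : List (Fin N)), Valid v (α ++ k :: k :: β) →
    F (α ++ k :: k :: β) = 0

section Words

variable {N L : ℕ} {M : Type*} [AddCommGroup M] [Module ℂ M] {ε : ℂ}

theorem sgn_ne_zero (hε : ε ^ 2 = 1) (w : List (Fin N)) : sgn ε w ≠ 0 := by
  have : -ε ≠ 0 := by
    rintro h
    rw [neg_eq_zero.mp h] at hε
    norm_num at hε
  induction w with
  | nil => exact one_ne_zero
  | cons i w ih => exact mul_ne_zero (pow_ne_zero _ this) ih

theorem neg_pow_mul_self (hε : ε ^ 2 = 1) (n : ℕ) : (-ε) ^ n * (-ε) ^ n = 1 := by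
  rw [← mul_pow, neg_mul_neg, ← sq, hε, one_pow]

theorem sgn_mul_self (hε : ε ^ 2 = 1) (w : List (Fin N)) : sgn ε w * sgn ε w = 1 := by
  induction w with
  | nil => simp [sgn]
  | cons i w ih => rw [sgn, mul_mul_mul_comm, ih, neg_pow_mul_self hε, one_mul]

theorem sgn_cons_cons (hε : ε ^ 2 = 1) {i j : Fin N} (h : i ≠ j) (w : List (Fin N)) :
    sgn ε (j :: i :: w) = -ε * sgn ε (i :: j :: w) := by
  simp only [sgn, List.countP_cons, decide_eq_true_eq]
  have h2 : -ε * -ε = 1 := by rw [neg_mul_neg, ← sq, hε]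
  rcases lt_or_gt_of_ne h with h | h
  · rw [if_neg h.not_gt, if_pos h, add_zero, pow_succ]
    linear_combination (-((-ε) ^ (w.countP fun x => i < x) * (-ε) ^ (w.countP fun x => j < x)) *
      sgn ε w) * h2
  · rw [if_neg h.not_gt, if_pos h, add_zero, pow_succ]
    ring

theorem sgn_cons_of_perm {i : Fin N} {w w' : List (Fin N)} (h : w.Perm w') (c : ℂ)
    (hs : sgn ε w = c * sgn ε w') : sgn ε (i :: w) = c * sgn ε (i :: w') := by
  rw [sgn, sgn, hs, h.countP_eq]
  ring

theorem sgn_swap (hε : ε ^ 2 = 1) (α : List (Fin N)) {i j : Fin N} (h : i ≠ j)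
    (β : List (Fin N)) : sgn ε (α ++ j :: i :: β) = -ε * sgn ε (α ++ i :: j :: β) := by
  induction α with
  | nil => exact sgn_cons_cons hε h β
  | cons k α ih => exact sgn_cons_of_perm ((List.Perm.swap i j β).append_left α) _ ih

theorem Antisym.cons {v : Vertex N L} {F : List (Fin N) → M} (hF : Antisym ε v F) {i : Fin N}
    (hi : Ok v i) : Antisym ε (act v i) (fun w => F (i :: w)) where
  swap α k j β hkj h h' := hF.swap (i :: α) k j β hkj ⟨hi, h⟩ ⟨hi, h'⟩
  same α k β h := hF.same (i :: α) k β ⟨hi, h⟩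

/-- A letter that is possible at the beginning can be moved to the front. -/
theorem Antisym.move (hN : 2 ≤ N) (hε : ε ^ 2 = 1) {v : Vertex N L} {F : List (Fin N) → M}
    (hF : Antisym ε v F) {i : Fin N} {α β : List (Fin N)} (h : Valid v (α ++ i :: β))
    (hi : Ok v i) (hα : i ∉ α) : Valid v (i :: (α ++ β)) ∧
    sgn ε (i :: (α ++ β)) • F (i :: (α ++ β)) = sgn ε (α ++ i :: β) • F (α ++ i :: β) := by
  induction α generalizing v F with
  | nil => exact ⟨h, rfl⟩
  | cons j α ih =>
    have hij : i ≠ j := fun h => hα (h ▸ List.mem_cons_self)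
    have hj : Ok v j := h.1
    -- The letter `i` is still possible after `j`, so induction brings it directly behind `j`; one
    -- exchange with `j` remains, and it is legitimate because `i` is possible at `v`.
    obtain ⟨h1, h2⟩ := ih (hF.cons hj) h.2 (ok_act_of_ok hN hi hj hij)
      (fun h => hα (List.mem_cons_of_mem _ h))
    have h3 : Valid v [i, j] := valid_swap hN ⟨hj, ok_act_of_ok hN hi hj hij, trivial⟩ hij.symm
      (not_dvd_sub_one_of_ok hi hij.symm)
    have h4 : Valid v (j :: i :: (α ++ β)) := ⟨hj, h1⟩
    have h5 : Valid v (i :: j :: (α ++ β)) := valid_cons_cons_swap h4 h3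
    refine ⟨h5, ?_⟩
    have h6 := hF.swap [] j i (α ++ β) hij.symm h4 h5
    have h7 : sgn ε (i :: j :: (α ++ β)) = -ε * sgn ε (j :: i :: (α ++ β)) :=
      sgn_swap hε [] hij.symm (α ++ β)
    have hp : (i :: (α ++ β)).Perm (α ++ i :: β) := List.perm_middle.symm
    simp only [List.nil_append] at h6
    have h8 : sgn ε (j :: i :: (α ++ β)) =
        (-ε) ^ ((α ++ i :: β).countP fun x => j < x) * sgn ε (i :: (α ++ β)) := by
      rw [sgn, hp.countP_eq]
    have h9 : sgn ε (j :: (α ++ i :: β)) =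
        (-ε) ^ ((α ++ i :: β).countP fun x => j < x) * sgn ε (α ++ i :: β) := rfl
    rw [List.cons_append, List.cons_append, h6, h7, smul_smul, h8, h9, mul_smul _ (sgn ε _), ← h2,
      smul_smul]
    congr 1
    have h10 : -ε * -ε = 1 := by rw [neg_mul_neg, ← sq, hε]
    linear_combination ((-ε) ^ ((α ++ i :: β).countP fun x => j < x) *
      sgn ε (i :: (α ++ β))) * h10

/-- An antisymmetric function is determined up to sign on the orderings of a set of letters. -/
theorem Antisym.perm (hN : 2 ≤ N) (hε : ε ^ 2 = 1) {v : Vertex N L} {F : List (Fin N) → M}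
    (hF : Antisym ε v F) {w w' : List (Fin N)} (h : Valid v w) (h' : Valid v w')
    (hw : w.Nodup) (hp : w.Perm w') : sgn ε w • F w = sgn ε w' • F w' := by
  induction w generalizing v F w' with
  | nil => rw [hp.nil_eq]
  | cons i w ih =>
    -- The first letter of `w` is possible at `v`, so `Antisym.move` brings it to the front of `w'`
    -- as well, and the tails are compared by induction.
    obtain ⟨α, β, rfl⟩ := List.append_of_mem (hp.subset List.mem_cons_self)
    have hw' := hp.nodup_iff.mp hw
    have hα : i ∉ α := by
      rw [List.nodup_middle, List.nodup_cons] at hw'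
      exact fun h => hw'.1 (List.mem_append_left _ h)
    obtain ⟨h1, h2⟩ := hF.move hN hε h' h.1 hα
    have hp' : w.Perm (α ++ β) := (hp.trans List.perm_middle).cons_inv
    have h3 := ih (hF.cons h.1) h.2 h1.2 (List.nodup_cons.mp hw).2 hp'
    rw [← h2, sgn, sgn, hp'.countP_eq, mul_smul, mul_smul, h3]

/-- If no letter of a path other than `j` is possible at its source, then the letters of the path
form a chain that is blocked by `j`. -/
theorem exists_dvd_of_blocked (hN : 2 ≤ N) {v : Vertex N L} {j : Fin N} {w : List (Fin N)}
    (h : Valid v w) (hw : w.Nodup) (hb : ∀ l ∈ w, l ≠ j → ¬ Ok v l) :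
    ∀ l ∈ w, ∃ r : ℕ, r < w.length ∧ ((N + L : ℕ) : ℤ) ∣ dist v j l - r := by
  induction w using List.reverseRecOn with
  | nil => simp
  | append_singleton u l ih =>
    obtain ⟨h1, h2, -⟩ := valid_append.mp h
    rw [List.nodup_append] at hw
    have hlu : l ∉ u := fun h => hw.2.2 l h l (List.mem_singleton_self l) rfl
    have hu := ih h1 hw.1 fun k hk => hb k (List.mem_append_left _ hk)
    intro k hk
    rw [List.length_append, List.length_singleton]
    rcases List.mem_append.mp hk with hk | hk
    · obtain ⟨r, hr, hd⟩ := hu k hk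
      exact ⟨r, by omega, hd⟩
    · obtain rfl := List.mem_singleton.mp hk
      by_cases hkj : k = j
      · refine ⟨0, by omega, ?_⟩
        rw [hkj]
        simp [dist]
      · have := hb k (List.mem_append_right _ hk) hkj
        rw [ok_iff hN] at this
        push Not at this
        obtain ⟨a, hak, hd⟩ := this
        -- The obstruction between `k` and `a` must have been removed by the steps in `u`. Since `k`
        -- does not occur in `u`, this requires `a` to occur.
        have hau : a ∈ u := by
          by_contra hau
          have := not_dvd_of_ok h2 hak
          rw [dist_run h1, List.count_eq_zero_of_not_mem hlu,
            List.count_eq_zero_of_not_mem hau] at this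
          exact this (by simpa using hd)
        obtain ⟨r, hr, hd'⟩ := hu a hau
        -- From d(k,a) ≡ -1 and d(j,a) ≡ r one gets d(j,k) ≡ r + 1, so the chain grows by one link.
        refine ⟨r + 1, by omega, ?_⟩
        have := dist_add v j k a
        rw [show dist v j k - ((r + 1 : ℕ) : ℤ) = (dist v j a - r) - (dist v k a + 1) by
          push_cast; linarith]
        exact dvd_sub hd' hd

/-- An antisymmetric function vanishes if a letter is repeated. -/
theorem Antisym.eq_zero_of_repeat (hN : 2 ≤ N) (hL : 2 ≤ L) (hε : ε ^ 2 = 1) {v : Vertex N L}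
    {F : List (Fin N) → M} (hF : Antisym ε v F) {i : Fin N} {α β : List (Fin N)}
    (h : Valid v (i :: (α ++ i :: β))) (hα : α.Nodup) (hi : i ∉ α) :
    F (i :: (α ++ i :: β)) = 0 := by
  induction hn : α.length generalizing v F α with
  | zero =>
    obtain rfl := List.length_eq_zero_iff.mp hn
    exact hF.same [] i β h
  | succ n ih =>
    have hvi := h.1
    have hF' := hF.cons hvi
    -- If `i` can be repeated at once, the second `i` is moved next to the first and the value is
    -- zero.
    by_cases hii : Ok (act v i) i
    · obtain ⟨h1, h2⟩ := hF'.move hN hε h.2 hii hi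
      have h3 : F (i :: i :: (α ++ β)) = 0 := hF.same [] i (α ++ β) ⟨hvi, h1⟩
      rw [h3, smul_zero] at h2
      exact (smul_eq_zero.mp h2.symm).resolve_left (sgn_ne_zero hε _)
    -- A letter `l` between the two occurrences of `i` that can be moved behind the first `i` and
    -- then exchanged with it leaves a shorter gap, to which the induction hypothesis applies.
    have key : ∀ l ∈ α, Ok (act v i) l → ¬ ((N + L : ℕ) : ℤ) ∣ dist v i l - 1 →
        F (i :: (α ++ i :: β)) = 0 := by
      intro l hl hok hd
      obtain ⟨γ, δ, rfl⟩ := List.append_of_mem hl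
      rw [List.nodup_middle, List.nodup_cons] at hα
      have hil : i ≠ l := fun h => hi (h ▸ hl)
      have hv' := h.2
      rw [List.append_assoc, List.cons_append] at hv'
      obtain ⟨h1, h2⟩ := hF'.move hN hε hv' hok fun h => hα.1 (List.mem_append_left _ h)
      have h3 : Valid v (i :: l :: (γ ++ (δ ++ i :: β))) := ⟨hvi, h1⟩
      have h4 := valid_cons_cons_swap h3 (valid_swap hN ⟨hvi, hok, trivial⟩ hil hd)
      have h5 := hF.swap [] l i _ hil.symm h4 h3
      have h6 := ih (hF.cons h4.1) (α := γ ++ δ) (by simpa using h4.2) hα.2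
        (fun h => hi (by simp only [List.mem_append, List.mem_cons] at h ⊢; tauto))
        (by simp at hn ⊢; omega)
      rw [List.append_assoc] at h6
      simp only [List.nil_append] at h5
      rw [h6, smul_zero] at h5
      rw [h5, smul_zero] at h2
      rw [List.append_assoc, List.cons_append]
      exact (smul_eq_zero.mp h2.symm).resolve_left (sgn_ne_zero hε _)
    obtain ⟨j, α', rfl⟩ : ∃ j α', α = j :: α' := List.exists_cons_of_length_eq_add_one hn
    have hok : Ok (act v i) j := h.2.1
    -- The first letter `j` of the gap is possible behind `i`, so only the exchange with `i` can
    -- fail.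
    by_cases hd : ((N + L : ℕ) : ℤ) ∣ dist v i j - 1
    swap
    · exact key j List.mem_cons_self hok hd
    have hij : i ≠ j := fun h => hi (h ▸ List.mem_cons_self)
    -- Another available letter `l` can be exchanged with `i`: otherwise d(i,l) and d(i,j) would
    -- both be 1 modulo N + L, and d(l,j) would be divisible.
    by_cases hex : ∃ l ∈ j :: α', l ≠ j ∧ Ok (act v i) l
    · obtain ⟨l, hl, hlj, hlo⟩ := hex
      refine key l hl hlo fun hd' => not_dvd_dist v hlj ?_
      have := dvd_sub hd hd'
      have h1 := dist_add v i l j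
      rwa [show dist v i j - 1 - (dist v i l - 1) = dist v l j by linarith] at this
    -- In the remaining case nothing in the gap but `j` is possible after `i`, so
    -- `exists_dvd_of_blocked` determines the distances from `j` to the letters of the gap.
    exfalso
    push Not at hex
    have hval := (valid_append.mp h.2).1
    have hchain := exists_dvd_of_blocked hN hval hα hex
    rw [ok_iff hN] at hii
    push Not at hii
    obtain ⟨k, hki, hk⟩ := hii
    -- The second `i` is possible after the gap, so the letter `k` that blocks it before the gap has
    -- to occur in the gap.
    have hkα : k ∈ j :: α' := by
      by_contra hkα
      have h1 := (valid_append.mp h.2).2.1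
      have h2 := not_dvd_of_ok h1 hki
      rw [dist_run hval, List.count_eq_zero_of_not_mem hi,
        List.count_eq_zero_of_not_mem hkα] at h2
      exact h2 (by simpa using hk)
    obtain ⟨r, hr, hdr⟩ := hchain k hkα
    have hlen : (i :: j :: α').length ≤ N := by
      simpa using (List.nodup_cons.mpr ⟨hi, hα⟩).length_le_card
    have h1 := dist_add (act v i) j i k
    have h2 : dist (act v i) i j = dist v i j + 1 := by
      rw [dist_act hvi, if_pos rfl, if_neg hij.symm, sub_zero]
    have h3 := dist_swap (act v i) i j
    -- After the step `i` one has d(i,j) ≡ 2, d(j,k) ≡ r and d(i,k) ≡ -1. Since the gap together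
    -- with `i` has at most N letters, r + 3 ≤ N + 1, which is less than N + L because L ≥ 2.
    have h4 : ((N + L : ℕ) : ℤ) ∣ r + 3 := by
      have := dvd_sub (dvd_sub hk hd) hdr
      rwa [show dist (act v i) i k + 1 - (dist v i j - 1) - (dist (act v i) j k - r) = r + 3 by
        linarith] at this
    have := Int.le_of_dvd (by omega) h4
    simp only [List.length_cons] at hlen hr
    push_cast at this
    omega

/-- An antisymmetric function vanishes on words with repeated letters. -/
theorem Antisym.eq_zero (hN : 2 ≤ N) (hL : 2 ≤ L) (hε : ε ^ 2 = 1) {v : Vertex N L}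
    {F : List (Fin N) → M} (hF : Antisym ε v F) {w : List (Fin N)} (h : Valid v w)
    (hw : ¬ w.Nodup) : F w = 0 := by
  induction w generalizing v F with
  | nil => exact absurd List.nodup_nil hw
  | cons i u ih =>
    -- If the tail has no repetition, the gap between the two occurrences of the first letter has
    -- none either; otherwise the repetition lies in the tail and the first letter is stripped.
    by_cases hu : u.Nodup
    · have hiu : i ∈ u := by
        by_contra hiu
        exact hw (List.nodup_cons.mpr ⟨hiu, hu⟩)
      obtain ⟨α, β, rfl⟩ := List.append_of_mem hiu
      rw [List.nodup_middle, List.nodup_cons] at hu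
      exact hF.eq_zero_of_repeat hN hL hε h (List.nodup_append.mp hu.2).1
        fun h => hu.1 (List.mem_append_left _ h)
    · exact ih (hF.cons h.1) h.2 hu

end Words

/-! ### Sums over words -/

/-- The sum of `F` over all words of length `m`. -/
def wsum {N : ℕ} {M : Type*} [AddCommMonoid M] : ℕ → (List (Fin N) → M) → M
  | 0, F => F []
  | m + 1, F => ∑ i, wsum m fun w => F (i :: w)

section WordSums

variable {N : ℕ} {M M' : Type*} [AddCommMonoid M] [AddCommMonoid M']

theorem wsum_congr {m : ℕ} {F G : List (Fin N) → M} (h : ∀ w, w.length = m → F w = G w) :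
    wsum m F = wsum m G := by
  induction m generalizing F G with
  | zero => exact h [] rfl
  | succ m ih =>
    exact Finset.sum_congr rfl fun i _ => ih fun w hw => h (i :: w) (by rw [List.length_cons, hw])

theorem wsum_zero (m : ℕ) : wsum m (fun _ : List (Fin N) => (0 : M)) = 0 := by
  induction m with
  | zero => rfl
  | succ m ih => simp [wsum, ih]

theorem wsum_eq_zero {m : ℕ} {F : List (Fin N) → M} (h : ∀ w, w.length = m → F w = 0) :
    wsum m F = 0 := (wsum_congr h).trans (wsum_zero m)

theorem wsum_append (a b : ℕ) (F : List (Fin N) → M) :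
    wsum (a + b) F = wsum a fun α => wsum b fun β => F (α ++ β) := by
  induction a generalizing F with
  | zero => simp [wsum]
  | succ a ih =>
    rw [show a + 1 + b = a + b + 1 by ring]
    simp only [wsum, ih, List.cons_append]

theorem map_wsum {G : Type*} [FunLike G M M'] [AddMonoidHomClass G M M'] (g : G) (m : ℕ)
    (F : List (Fin N) → M) : g (wsum m F) = wsum m fun w => g (F w) := by
  induction m generalizing F with
  | zero => rfl
  | succ m ih => simp only [wsum, map_sum, ih]

theorem wsum_finset_sum {ι : Type*} (s : Finset ι) (m : ℕ) (F : ι → List (Fin N) → M) :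
    wsum m (fun w => ∑ i ∈ s, F i w) = ∑ i ∈ s, wsum m (F i) := by
  induction m generalizing F with
  | zero => rfl
  | succ m ih =>
    simp only [wsum, ih]
    exact Finset.sum_comm

theorem wsum_comm (m m' : ℕ) (F : List (Fin N) → List (Fin N) → M) :
    wsum m (fun w => wsum m' fun w' => F w w') = wsum m' fun w' => wsum m fun w => F w w' := by
  induction m generalizing F with
  | zero => rfl
  | succ m ih => simp only [wsum, ih, wsum_finset_sum]

theorem wsum_succ_last (m : ℕ) (F : List (Fin N) → M) :
    wsum (m + 1) F = ∑ i, wsum m fun w => F (w ++ [i]) := by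
  rw [wsum_append]
  simp only [wsum, wsum_finset_sum]

theorem mul_wsum {A : Type*} [NonUnitalNonAssocSemiring A] (a : A) (m : ℕ)
    (F : List (Fin N) → A) : a * wsum m F = wsum m fun w => a * F w :=
  map_wsum (AddMonoidHom.mulLeft a) m F

theorem wsum_mul {A : Type*} [NonUnitalNonAssocSemiring A] (a : A) (m : ℕ)
    (F : List (Fin N) → A) : wsum m F * a = wsum m fun w => F w * a :=
  map_wsum (AddMonoidHom.mulRight a) m F

theorem smul_wsum [Module ℂ M] (c : ℂ) (m : ℕ) (F : List (Fin N) → M) :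
    c • wsum m F = wsum m fun w => c • F w :=
  map_wsum (DistribSMul.toAddMonoidHom M c) m F

theorem wsum_eq_single {m : ℕ} {F : List (Fin N) → M} (w₀ : List (Fin N)) (h₀ : w₀.length = m)
    (h : ∀ w, w.length = m → w ≠ w₀ → F w = 0) : wsum m F = F w₀ := by
  induction m generalizing F w₀ with
  | zero => rw [List.length_eq_zero_iff.mp h₀]; rfl
  | succ m ih =>
    obtain ⟨i, u, rfl⟩ := List.exists_cons_of_length_eq_add_one h₀
    rw [wsum, Finset.sum_eq_single i]
    · exact ih u (by simpa using h₀) fun w hw hne =>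
        h _ (by rw [List.length_cons, hw]) fun he => hne (List.cons.inj he).2
    · intro j _ hj
      exact wsum_eq_zero fun w hw =>
        h _ (by rw [List.length_cons, hw]) fun he => hj (List.cons.inj he).1
    · intro h
      exact absurd (Finset.mem_univ i) h

end WordSums

/-! ### Quantum integers and Boltzmann weights -/

/-- The standing assumptions on the parameters. -/
structure SOSParams (N L : ℕ) (t ε : ℂ) : Prop where
  two_le_N : 2 ≤ N
  two_le_L : 2 ≤ L
  root : IsPrimitiveRoot t (2 * (N + L))
  sq : ε ^ 2 = 1

/-- The diagonal coefficient of the weight, without the factor `ζ⁻¹`. -/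
def wDiag {N L : ℕ} (t : ℂ) (v : Vertex N L) (i j : Fin N) : ℂ :=
  if i = j then t else -t ^ (-dist v i j) * (1 / qInt t (dist v i j))

/-- The off-diagonal coefficient of the weight, without the factor `ζ⁻¹`. -/
def wOff {N L : ℕ} (t ε : ℂ) (v : Vertex N L) (i j : Fin N) : ℂ :=
  if i = j then 0 else ε * (qInt t (dist v i j - 1) / qInt t (dist v i j))

namespace SOSParams

variable {N L : ℕ} {t ε : ℂ}

theorem t_ne_zero (h : SOSParams N L t ε) : t ≠ 0 :=
  h.root.ne_zero (by have := h.two_le_N; omega)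

theorem t_sub_ne_zero (h : SOSParams N L t ε) : t - t⁻¹ ≠ 0 := by
  intro h0
  have h1 : t ^ 2 = 1 := by
    have := h.t_ne_zero
    field_simp at h0
    linear_combination h0
  have h2 := (h.root.pow_eq_one_iff_dvd 2).mp h1
  have h3 := Nat.le_of_dvd two_pos h2
  have := h.two_le_N
  have := h.two_le_L
  omega

/-- Vanishing would give t⁴ = 1. This sum is the difference of the eigenvalues t and -t⁻¹ of the
weight without ζ⁻¹; it is cancelled in columns with a double letter. -/
theorem t_add_ne_zero (h : SOSParams N L t ε) : t + t⁻¹ ≠ 0 := by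
  intro h0
  have h1 : t ^ 4 = 1 := by
    have := h.t_ne_zero
    field_simp at h0
    linear_combination (t ^ 2 - 1) * h0
  have h2 := (h.root.pow_eq_one_iff_dvd 4).mp h1
  have h3 := Nat.le_of_dvd (by norm_num) h2
  have := h.two_le_N
  have := h.two_le_L
  omega

/-- Vanishing means t^(2n) = 1. The zeros of quantum integers thus match the divisibility conditions
that describe the graph. -/
theorem qInt_eq_zero_iff (h : SOSParams N L t ε) (n : ℤ) :
    qInt t n = 0 ↔ ((N + L : ℕ) : ℤ) ∣ n := by
  rw [qInt, div_eq_zero_iff, or_iff_left h.t_sub_ne_zero, zpow_neg,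
    sub_eq_zero, ← mul_eq_one_iff_eq_inv₀ (zpow_ne_zero _ h.t_ne_zero), ← zpow_add₀ h.t_ne_zero,
    h.root.zpow_eq_one_iff_dvd, ← two_mul]
  push_cast
  exact mul_dvd_mul_iff_left two_ne_zero

theorem qInt_dist_ne_zero (h : SOSParams N L t ε) (v : Vertex N L) {i j : Fin N} (hij : i ≠ j) :
    qInt t (dist v i j) ≠ 0 := fun h0 => not_dvd_dist v hij ((h.qInt_eq_zero_iff _).mp h0)

theorem _root_.FaceAlgebra.qInt_neg (t : ℂ) (n : ℤ) : qInt t (-n) = -qInt t n := by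
  rw [qInt, qInt, neg_neg]
  ring

theorem zpow_neg_eq (h : SOSParams N L t ε) (d : ℤ) :
    t ^ (-d) = t⁻¹ * qInt t d - qInt t (d - 1) := by
  have h1 := h.t_ne_zero
  have h2 := h.t_sub_ne_zero
  have h3 : t ^ 2 - 1 ≠ 0 := fun h0 => h2 (by field_simp; linear_combination h0)
  rw [qInt, qInt, neg_sub, sub_eq_add_neg 1 d, zpow_add₀ h1, zpow_sub₀ h1, zpow_one]
  field_simp
  ring

/-- The left side is the factor by which the weight acts on a functional g with g(j,i) = -ε g(i,j),
so such functionals are eigenvectors. It amounts to t^(-d) = t⁻¹[d] - [d-1] together with ε² = 1. -/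
theorem wDiag_sub (h : SOSParams N L t ε) (v : Vertex N L) {i j : Fin N} (hij : i ≠ j) :
    wDiag t v i j - ε * wOff t ε v i j = -t⁻¹ := by
  have h1 := h.qInt_dist_ne_zero v hij
  rw [wDiag, wOff, if_neg hij, if_neg hij, h.zpow_neg_eq]
  have h2 := h.sq
  have h3 := h.t_ne_zero
  field_simp
  linear_combination (-t * qInt t (dist v i j - 1)) * h2

/-- The divisibility on the right implies that `j` is not possible at `v`. This link between
coefficients and missing paths lets terms with nonexistent paths be written without case
distinctions. -/
theorem wOff_eq_zero_iff (h : SOSParams N L t ε) (v : Vertex N L) {i j : Fin N} (hij : i ≠ j) :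
    wOff t ε v i j = 0 ↔ ((N + L : ℕ) : ℤ) ∣ dist v i j - 1 := by
  have h1 := h.qInt_dist_ne_zero v hij
  have h2 : ε ≠ 0 := by
    intro h0
    have := h.sq
    rw [h0] at this
    norm_num at this
  rw [wOff, if_neg hij, mul_eq_zero, or_iff_right h2, div_eq_zero_iff, or_iff_left h1,
    h.qInt_eq_zero_iff]

theorem wOff_ne_zero (h : SOSParams N L t ε) {v : Vertex N L} {i j : Fin N} (hij : i ≠ j)
    (hj : Ok v j) : wOff t ε v i j ≠ 0 := fun h0 =>
  not_dvd_sub_one_of_ok hj hij ((h.wOff_eq_zero_iff v hij).mp h0)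

/-- The off-diagonal coefficient vanishes if only one of the two paths exists. -/
theorem wOff_eq_zero (h : SOSParams N L t ε) {v : Vertex N L} {i j : Fin N} (hij : i ≠ j)
    (hv : Valid v [i, j]) (hv' : ¬ Valid v [j, i]) : wOff t ε v i j = 0 := by
  rw [h.wOff_eq_zero_iff v hij]
  by_contra hd
  exact hv' (valid_swap h.two_le_N hv hij hd)

end SOSParams

/-! ### Representations of the path algebra -/

/-- Images of the vertex symbols and of the sums of the edge symbols with given indices under a
homomorphism from the path algebra to `A`, which need not preserve the unit. -/
structure FaceRep (N L : ℕ) (A : Type*) [Ring A] where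
  ev : Vertex N L → Vertex N L → A
  x : Fin N → Fin N → A
  ev_mul_self : ∀ v v', ev v v' * ev v v' = ev v v'
  ev_mul_ne : ∀ v v' u u', ¬ (v = u ∧ v' = u') → ev v v' * ev u u' = 0
  ev_mul_x : ∀ v v' i k, Ok v i → Ok v' k → ev v v' * x i k = x i k * ev (act v i) (act v' k)
  ev_mul_x_eq_zero : ∀ v v' i k, ¬ (Ok v i ∧ Ok v' k) → ev v v' * x i k = 0

namespace FaceRep

variable {N L : ℕ} {A : Type*} [Ring A] (R : FaceRep N L A)

/-- The product of the edge symbols along two words. -/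
def X : List (Fin N) → List (Fin N) → A
  | [], [] => 1
  | i :: w, k :: w' => R.x i k * X w w'
  | _, _ => 0

/-- The image of the symbol of the paths `(v | w)` and `(v' | w')`. -/
def E (v : Vertex N L) (w : List (Fin N)) (v' : Vertex N L) (w' : List (Fin N)) : A :=
  R.ev v v' * R.X w w'

theorem X_nil : R.X [] [] = 1 := rfl

theorem X_cons (i k : Fin N) (w w' : List (Fin N)) :
    R.X (i :: w) (k :: w') = R.x i k * R.X w w' := rfl

theorem X_singleton (i k : Fin N) : R.X [i] [k] = R.x i k := by
  rw [X_cons, X_nil, mul_one]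

theorem X_eq_zero {w w' : List (Fin N)} (h : w.length ≠ w'.length) : R.X w w' = 0 := by
  induction w generalizing w' with
  | nil =>
    cases w' with
    | nil => exact absurd rfl h
    | cons k w' => rfl
  | cons i w ih =>
    cases w' with
    | nil => rfl
    | cons k w' => rw [X_cons, ih (by simpa using h), mul_zero]

theorem X_append {α α' : List (Fin N)} (h : α.length = α'.length) (β β' : List (Fin N)) :
    R.X (α ++ β) (α' ++ β') = R.X α α' * R.X β β' := by
  induction α generalizing α' with
  | nil =>
    rw [List.length_eq_zero_iff.mp h.symm, X_nil, one_mul]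
    rfl
  | cons i α ih =>
    obtain ⟨k, α', rfl⟩ := List.exists_cons_of_length_eq_add_one h.symm
    rw [List.cons_append, List.cons_append, X_cons, X_cons, ih (by simpa using h), mul_assoc]

theorem E_nil (v v' : Vertex N L) : R.E v [] v' [] = R.ev v v' := by rw [E, X_nil, mul_one]

theorem E_eq_zero_of_length {w w' : List (Fin N)} (h : w.length ≠ w'.length)
    (v v' : Vertex N L) : R.E v w v' w' = 0 := by rw [E, X_eq_zero R h, mul_zero]

/-- Vertex idempotents travel along the word and annihilate the first impossible step. This allows
sums over all words in place of sums over paths. -/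
theorem E_eq_zero {v v' : Vertex N L} {w w' : List (Fin N)} (h : ¬ (Valid v w ∧ Valid v' w')) :
    R.E v w v' w' = 0 := by
  induction w generalizing v v' w' with
  | nil =>
    cases w' with
    | nil => exact absurd ⟨trivial, trivial⟩ h
    | cons k w' => exact mul_zero _
  | cons i w ih =>
    cases w' with
    | nil => exact mul_zero _
    | cons k w' =>
      rw [E, X_cons, ← mul_assoc]
      by_cases h' : Ok v i ∧ Ok v' k
      · rw [R.ev_mul_x _ _ _ _ h'.1 h'.2, mul_assoc]
        have : R.E (act v i) w (act v' k) w' = 0 := ih fun h1 => h ⟨⟨h'.1, h1.1⟩, h'.2, h1.2⟩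
        rw [E] at this
        rw [this, mul_zero]
      · rw [R.ev_mul_x_eq_zero _ _ _ _ h', zero_mul]

theorem E_eq {v v' : Vertex N L} {w w' : List (Fin N)} (h : Valid v w) (h' : Valid v' w') :
    R.E v w v' w' = R.X w w' * R.ev (run v w) (run v' w') := by
  induction w generalizing v v' w' with
  | nil =>
    cases w' with
    | nil => rw [E, X_nil, mul_one, one_mul]; rfl
    | cons k w' => rw [E, X_eq_zero R (by simp), mul_zero, zero_mul]
  | cons i w ih =>
    cases w' with
    | nil => rw [E, X_eq_zero R (by simp), mul_zero, zero_mul]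
    | cons k w' =>
      have := ih h.2 h'.2
      rw [E] at this
      rw [E, X_cons, ← mul_assoc, R.ev_mul_x _ _ _ _ h.1 h'.1, mul_assoc, this, mul_assoc]
      rfl

theorem ev_mul_E_self (v v' : Vertex N L) (w w' : List (Fin N)) :
    R.ev v v' * R.E v w v' w' = R.E v w v' w' := by rw [E, ← mul_assoc, ev_mul_self]

theorem ev_mul_E_ne {v v' u u' : Vertex N L} (h : ¬ (v = u ∧ v' = u')) (w w' : List (Fin N)) :
    R.ev v v' * R.E u w u' w' = 0 := by rw [E, ← mul_assoc, R.ev_mul_ne _ _ _ _ h, zero_mul]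

theorem E_mul_ev_self {v v' : Vertex N L} {w w' : List (Fin N)} (h : Valid v w)
    (h' : Valid v' w') : R.E v w v' w' * R.ev (run v w) (run v' w') = R.E v w v' w' := by
  rw [R.E_eq h h', mul_assoc, ev_mul_self]

theorem E_mul_ev_ne {v v' u u' : Vertex N L} {w w' : List (Fin N)}
    (h : ¬ (run v w = u ∧ run v' w' = u')) : R.E v w v' w' * R.ev u u' = 0 := by
  by_cases h' : Valid v w ∧ Valid v' w'
  · rw [R.E_eq h'.1 h'.2, mul_assoc, R.ev_mul_ne _ _ _ _ h, mul_zero]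
  · rw [R.E_eq_zero h', zero_mul]

theorem E_append {v v' : Vertex N L} {α α' : List (Fin N)} (h : α.length = α'.length)
    (β β' : List (Fin N)) : R.E v (α ++ β) v' (α' ++ β') =
      R.E v α v' α' * R.E (run v α) β (run v' α') β' := by
  rw [E, R.X_append h, ← mul_assoc]
  change R.E v α v' α' * _ = _
  by_cases h' : Valid v α ∧ Valid v' α'
  · rw [show R.E (run v α) β (run v' α') β' = R.ev (run v α) (run v' α') * R.X β β' from rfl,
      ← mul_assoc, R.E_mul_ev_self h'.1 h'.2]
  · rw [R.E_eq_zero h', zero_mul, zero_mul]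

theorem E_cons (v v' : Vertex N L) (i k : Fin N) (w w' : List (Fin N)) :
    R.E v (i :: w) v' (k :: w') = R.E v [i] v' [k] * R.E (act v i) w (act v' k) w' :=
  R.E_append (α := [i]) (α' := [k]) rfl w w'

/-- The relations of the algebra `A(w)`. -/
def Rel [Algebra ℂ A] (t ε : ℂ) : Prop :=
  ∀ (v v' : Vertex N L) (i j k l : Fin N), Valid v' [k, l] →
    wDiag t v' k l • R.E v [i, j] v' [k, l] + wOff t ε v' k l • R.E v [i, j] v' [l, k] =
      wDiag t v i j • R.E v [i, j] v' [k, l] + wOff t ε v j i • R.E v [j, i] v' [k, l]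

end FaceRep

/-- A function on words that is antisymmetric with respect to all transpositions. -/
structure Alternating {N : ℕ} (ε : ℂ) (f : List (Fin N) → ℂ) : Prop where
  swap : ∀ (α : List (Fin N)) (i j : Fin N) (β : List (Fin N)), i ≠ j →
    f (α ++ j :: i :: β) = -ε * f (α ++ i :: j :: β)
  same : ∀ (α : List (Fin N)) (k : Fin N) (β : List (Fin N)), f (α ++ k :: k :: β) = 0

/-! ### Antisymmetrised symbols as functions of their column. -/

namespace FaceRep

variable {N L : ℕ} {A : Type*} [Ring A] [Algebra ℂ A] {R : FaceRep N L A} {t ε : ℂ}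

/-- Summing the relation against g turns the row side into multiplication by -t⁻¹, by `wDiag_sub`.
What remains is an equation between the columns (k, l) and (l, k). -/
theorem Rel.sum_eq (hR : R.Rel t ε) (hP : SOSParams N L t ε) {g : Fin N → Fin N → ℂ}
    (hg : ∀ i j, i ≠ j → g j i = -ε * g i j) (hg' : ∀ i, g i i = 0) (v : Vertex N L)
    {v' : Vertex N L} {k l : Fin N} (h : Valid v' [k, l]) :
    (wDiag t v' k l + t⁻¹) • (∑ i, ∑ j, g i j • R.E v [i, j] v' [k, l]) +
      wOff t ε v' k l • (∑ i, ∑ j, g i j • R.E v [i, j] v' [l, k]) = 0 := by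
  have h1 : ∑ i, ∑ j, g i j • (wDiag t v i j • R.E v [i, j] v' [k, l] +
      wOff t ε v j i • R.E v [j, i] v' [k, l]) =
      ∑ i, ∑ j, (-t⁻¹ * g i j) • R.E v [i, j] v' [k, l] := by
    simp only [smul_add, Finset.sum_add_distrib, smul_smul]
    -- Renaming the off-diagonal terms collects each symbol with row (i, j) under the coefficient
    -- g(i,j) `wDiag` + g(j,i) `wOff`.
    rw [Finset.sum_comm (f := fun i j => (g i j * wOff t ε v j i) • R.E v [j, i] v' [k, l])]
    simp only [← Finset.sum_add_distrib, ← add_smul]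
    refine Finset.sum_congr rfl fun i _ => Finset.sum_congr rfl fun j _ => ?_
    congr 1
    by_cases hij : i = j
    · subst hij
      rw [hg']
      ring
    · rw [hg i j hij, ← hP.wDiag_sub v hij]
      ring
  have h2 : ∑ i, ∑ j, g i j • (wDiag t v i j • R.E v [i, j] v' [k, l] +
      wOff t ε v j i • R.E v [j, i] v' [k, l]) =
      ∑ i, ∑ j, g i j • (wDiag t v' k l • R.E v [i, j] v' [k, l] +
        wOff t ε v' k l • R.E v [i, j] v' [l, k]) :=
    Finset.sum_congr rfl fun i _ => Finset.sum_congr rfl fun j _ => by rw [hR v v' i j k l h]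
  rw [h1] at h2
  rw [add_smul, add_assoc, add_comm (t⁻¹ • _), ← add_assoc, Finset.smul_sum, Finset.smul_sum,
    Finset.smul_sum, ← Finset.sum_add_distrib, add_comm, ← neg_eq_iff_add_eq_zero,
    ← Finset.sum_neg_distrib]
  simp only [Finset.smul_sum, ← Finset.sum_neg_distrib, ← Finset.sum_add_distrib]
  convert h2 using 4
  · rw [smul_smul, ← neg_smul, neg_mul]
  · rw [smul_add, smul_comm, smul_comm (wOff t ε v' k l)]

/-- For k ≠ l the coefficient `wDiag` + t⁻¹ equals ε `wOff`, and `wOff` is nonzero because `l` is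
possible at the source; it can be cancelled. -/
theorem Rel.sum_swap (hR : R.Rel t ε) (hP : SOSParams N L t ε) {g : Fin N → Fin N → ℂ}
    (hg : ∀ i j, i ≠ j → g j i = -ε * g i j) (hg' : ∀ i, g i i = 0) (v : Vertex N L)
    {v' : Vertex N L} {k l : Fin N} (h : Valid v' [k, l]) (h' : Valid v' [l, k]) (hkl : k ≠ l) :
    ∑ i, ∑ j, g i j • R.E v [i, j] v' [l, k] =
      (-ε) • ∑ i, ∑ j, g i j • R.E v [i, j] v' [k, l] := by
  have h1 := hR.sum_eq hP hg hg' v h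
  have h2 := hP.wDiag_sub v' hkl
  have h3 : wDiag t v' k l + t⁻¹ = wOff t ε v' k l * ε := by linear_combination h2
  rw [h3, mul_smul, ← smul_add] at h1
  have h4 := (smul_eq_zero.mp h1).resolve_left (hP.wOff_ne_zero hkl h'.1)
  rw [neg_smul]
  exact (neg_eq_of_add_eq_zero_right h4).symm

/-- For equal letters the off-diagonal term is absent and the coefficient is t + t⁻¹, which is
invertible. -/
theorem Rel.sum_same (hR : R.Rel t ε) (hP : SOSParams N L t ε) {g : Fin N → Fin N → ℂ}
    (hg : ∀ i j, i ≠ j → g j i = -ε * g i j) (hg' : ∀ i, g i i = 0) (v : Vertex N L)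
    {v' : Vertex N L} {k : Fin N} (h : Valid v' [k, k]) :
    ∑ i, ∑ j, g i j • R.E v [i, j] v' [k, k] = 0 := by
  have h1 := hR.sum_eq hP hg hg' v h
  rw [wOff, if_pos rfl, zero_smul, add_zero, wDiag, if_pos rfl] at h1
  exact (smul_eq_zero.mp h1).resolve_left hP.t_add_ne_zero

/-- The sum `∑_w f(w) e(v|w; v'|w')` over all words `w` of length `m`. -/
def Phi (R : FaceRep N L A) (m : ℕ) (f : List (Fin N) → ℂ) (v v' : Vertex N L)
    (w' : List (Fin N)) : A :=
  wsum m fun w => f w • R.E v w v' w'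

/-- Two adjacent letters are isolated from the rest of the word so that the quadratic relations can
be applied to them. -/
theorem Phi_split (R : FaceRep N L A) (f : List (Fin N) → ℂ) (v v' : Vertex N L)
    (a b : ℕ) (α' β' : List (Fin N)) (hα : α'.length = a) (k l : Fin N) :
    R.Phi (a + (2 + b)) f v v' (α' ++ k :: l :: β') = wsum a fun α => wsum b fun β =>
      R.E v α v' α' * (∑ i, ∑ j, f (α ++ i :: j :: β) • R.E (run v α) [i, j] (run v' α') [k, l]) *
        R.X β β' := by
  rw [Phi, wsum_append]
  refine wsum_congr fun α h => ?_
  rw [wsum_append, wsum_comm]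
  refine wsum_congr fun β _ => ?_
  simp only [wsum, Finset.mul_sum, Finset.sum_mul]
  refine Finset.sum_congr rfl fun i _ => Finset.sum_congr rfl fun j _ => ?_
  rw [R.E_append (h.trans hα.symm), mul_smul_comm, smul_mul_assoc]
  congr 1
  rw [mul_assoc]
  congr 1
  simp only [E, List.cons_append, List.nil_append, X_cons, X_nil, mul_one, mul_assoc]

/-- Column operations: `w' ↦ ∑_w f(w) e(v|w; v'|w')` is antisymmetric if `f` is. -/
theorem Rel.antisym (hR : R.Rel t ε) (hP : SOSParams N L t ε) {f : List (Fin N) → ℂ}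
    (hf : Alternating ε f) (m : ℕ) (v v' : Vertex N L) : Antisym ε v' (R.Phi m f v v') where
  swap α' k l β' hkl h h' := by
    by_cases hm : m = α'.length + (2 + β'.length)
    · subst hm
      rw [Phi_split _ _ _ _ _ _ _ _ rfl, Phi_split _ _ _ _ _ _ _ _ rfl, smul_wsum]
      refine wsum_congr fun α _ => ?_
      rw [smul_wsum]
      refine wsum_congr fun β _ => ?_
      obtain ⟨-, h1, h2, -⟩ := valid_append.mp h
      obtain ⟨-, h1', h2', -⟩ := valid_append.mp h'
      rw [hR.sum_swap hP (g := fun i j => f (α ++ i :: j :: β)) (fun i j => hf.swap α i j β)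
        (fun i => hf.same α i β) _ ⟨h1, h2, trivial⟩ ⟨h1', h2', trivial⟩ hkl, mul_smul_comm,
        smul_mul_assoc]
    -- Columns of the wrong length give zero on both sides.
    · have h0 : ∀ w : List (Fin N), w.length = α'.length + (2 + β'.length) →
          R.Phi m f v v' w = 0 := fun w hw => wsum_eq_zero fun u hu => by
        rw [E_eq_zero_of_length R (by omega), smul_zero]
      rw [h0 _ (by simp; omega), h0 _ (by simp; omega), smul_zero]
  same α' k β' h := by
    by_cases hm : m = α'.length + (2 + β'.length)
    · subst hm
      rw [Phi_split _ _ _ _ _ _ _ _ rfl]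
      refine wsum_eq_zero fun α _ => wsum_eq_zero fun β _ => ?_
      obtain ⟨-, h1, h2, -⟩ := valid_append.mp h
      rw [hR.sum_same hP (g := fun i j => f (α ++ i :: j :: β)) (fun i j => hf.swap α i j β)
        (fun i => hf.same α i β) _ ⟨h1, h2, trivial⟩, mul_zero, zero_mul]
    · exact wsum_eq_zero fun u hu => by
        rw [E_eq_zero_of_length R (by simp; omega), smul_zero]

end FaceRep

/-! ### Laplace expansions of the quantum determinant -/

/-- The sign of a word if it is an ordering of `J`, and `0` otherwise. -/
def altSign {N : ℕ} (ε : ℂ) (J : Finset (Fin N)) (w : List (Fin N)) : ℂ :=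
  if w.Nodup ∧ w.toFinset = J then sgn ε w else 0

section AltSign

variable {N : ℕ} {ε : ℂ}

theorem altSign_alternating (hε : ε ^ 2 = 1) (J : Finset (Fin N)) :
    Alternating ε (altSign ε J) where
  swap α i j β hij := by
    have hp : (α ++ j :: i :: β).Perm (α ++ i :: j :: β) := (List.Perm.swap i j β).append_left α
    simp only [altSign, hp.nodup_iff, List.toFinset_eq_of_perm _ _ hp, sgn_swap hε α hij]
    split_ifs
    · rfl
    · rw [mul_zero]
  same α k β := by
    rw [altSign, if_neg]
    simp [List.nodup_append]

theorem sgn_append_singleton (w : List (Fin N)) (y : Fin N) :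
    sgn ε (w ++ [y]) = sgn ε w * (-ε) ^ (w.countP fun j => j < y) := by
  induction w with
  | nil => simp [sgn]
  | cons i w ih =>
    simp only [List.cons_append, sgn, ih, List.countP_append, List.countP_cons, List.countP_nil,
      decide_eq_true_eq]
    ring

theorem countP_eq_card {w : List (Fin N)} (h : w.Nodup) (p : Fin N → Prop) [DecidablePred p] :
    w.countP (fun j => p j) = (w.toFinset.filter p).card := by
  rw [List.countP_eq_length_filter, ← List.toFinset_card_of_nodup (h.filter _),
    List.toFinset_filter]
  simp

/-- In an ordering of all letters the last letter y comes after every other one, and with indices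
from 0 exactly y of these are smaller. This is the sign in the expansion along the last letter. -/
theorem altSign_append_singleton (w : List (Fin N)) (y : Fin N) :
    altSign ε Finset.univ (w ++ [y]) = altSign ε (Finset.univ.erase y) w * (-ε) ^ (y : ℕ) := by
  have h : ((w ++ [y]).Nodup ∧ (w ++ [y]).toFinset = Finset.univ) ↔
      (w.Nodup ∧ w.toFinset = Finset.univ.erase y) := by
    rw [List.nodup_append, List.toFinset_append]
    constructor
    · rintro ⟨⟨h1, -, h2⟩, h3⟩
      refine ⟨h1, ?_⟩
      have hy : y ∉ w := fun hy => h2 y hy y (List.mem_singleton_self y) rfl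
      ext a
      have := Finset.ext_iff.mp h3 a
      by_cases ha : a = y
      · simp [ha, hy]
      · simpa [ha] using this
    · rintro ⟨h1, h2⟩
      have hy : y ∉ w := by
        rw [← List.mem_toFinset, h2]
        simp
      refine ⟨⟨h1, by simp, ?_⟩, ?_⟩
      · rintro a ha b hb rfl
        exact hy (List.mem_singleton.mp hb ▸ ha)
      · ext a
        by_cases ha : a = y <;> simp [h2, ha]
  rw [altSign, altSign]
  by_cases h' : w.Nodup ∧ w.toFinset = Finset.univ.erase y
  · rw [if_pos (h.mpr h'), if_pos h', sgn_append_singleton, countP_eq_card h'.1, h'.2]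
    congr 2
    rw [← Fin.card_Iio]
    congr 1
    ext a
    simp only [Finset.mem_filter, Finset.mem_erase, Finset.mem_univ, and_true, Finset.mem_Iio]
    exact ⟨fun h => h.2, fun h => ⟨h.ne, h⟩⟩
  · rw [if_neg (h.not.mpr h'), if_neg h', zero_mul]

theorem nodup_cons_and_toFinset (w : List (Fin N)) (y : Fin N) (J : Finset (Fin N)) (hy : y ∈ J) :
    ((y :: w).Nodup ∧ (y :: w).toFinset = J) ↔ (w.Nodup ∧ w.toFinset = J.erase y) := by
  rw [List.nodup_cons, List.toFinset_cons]
  constructor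
  · rintro ⟨⟨h1, h2⟩, rfl⟩
    refine ⟨h2, ?_⟩
    rw [Finset.erase_insert (by simpa using h1)]
  · rintro ⟨h1, h2⟩
    have : y ∉ w := by
      rw [← List.mem_toFinset, h2]
      simp
    exact ⟨⟨this, h1⟩, by rw [h2, Finset.insert_erase hy]⟩

theorem sgn_cons_of_toFinset {w : List (Fin N)} {y : Fin N} (h : w.Nodup)
    (h' : w.toFinset = Finset.univ.erase y) :
    sgn ε (y :: w) = (-ε) ^ (N - 1 - (y : ℕ)) * sgn ε w := by
  rw [sgn, countP_eq_card h, h']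
  congr 2
  rw [← Fin.card_Ioi]
  congr 1
  ext a
  simp only [Finset.mem_filter, Finset.mem_erase, Finset.mem_univ, and_true, Finset.mem_Ioi]
  exact ⟨fun h => h.2, fun h => ⟨h.ne', h⟩⟩

/-- A first letter y is followed by all letters larger than y, and there are N - 1 - y of them. -/
theorem altSign_cons (w : List (Fin N)) (y : Fin N) :
    altSign ε Finset.univ (y :: w) =
      (-ε) ^ (N - 1 - (y : ℕ)) * altSign ε (Finset.univ.erase y) w := by
  have h := nodup_cons_and_toFinset w y Finset.univ (Finset.mem_univ y)
  rw [altSign, altSign]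
  by_cases h' : w.Nodup ∧ w.toFinset = Finset.univ.erase y
  · rw [if_pos (h.mpr h'), if_pos h', sgn_cons_of_toFinset h'.1 h'.2]
  · rw [if_neg (h.not.mpr h'), if_neg h', mul_zero]

theorem toFinset_eq_univ {w : List (Fin N)} (h : w.Nodup) (hl : w.length = N) :
    w.toFinset = Finset.univ := by
  apply Finset.eq_univ_of_card
  rw [List.toFinset_card_of_nodup h, hl, Fintype.card_fin]

end AltSign

/-! ### Returning paths -/

section Return

variable {N L : ℕ}

theorem count_eq_ite {w : List (Fin N)} (h : w.Nodup) (a : Fin N) :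
    (w.count a : ℤ) = if a ∈ w.toFinset then 1 else 0 := by
  rw [h.count]
  simp only [List.mem_toFinset]
  split_ifs <;> rfl

/-- All N letters together shift every coordinate by one, which is no movement at all; so using each
letter but k once is a step backwards along k. -/
theorem isStep_run {v : Vertex N L} {k : Fin N} {w : List (Fin N)} (h : Valid v w) (hw : w.Nodup)
    (hk : w.toFinset = Finset.univ.erase k) : IsStep (run v w) k v := by
  rw [isStep_iff_dist]
  intro a b
  rw [dist_run h, count_eq_ite hw, count_eq_ite hw, hk]
  simp only [Finset.mem_erase, Finset.mem_univ, and_true]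
  split_ifs <;> omega

theorem run_return {u : Vertex N L} {i : Fin N} (hi : Ok u i) {w : List (Fin N)}
    (h : Valid (act u i) w) (hw : w.Nodup) (hk : w.toFinset = Finset.univ.erase i) :
    run (act u i) w = u := by
  have h1 := isStep_iff.mp (isStep_run h hw hk)
  exact act_injective h1.1 hi h1.2

/-- Chosen loops of length `N` at every vertex, and chosen paths of length `N - 1` that run
against every edge. -/
structure Loops (N L : ℕ) where
  q : Vertex N L → List (Fin N)
  q_valid : ∀ v, Valid v (q v)
  q_nodup : ∀ v, (q v).Nodup
  q_toFinset : ∀ v, (q v).toFinset = Finset.univ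
  b : Vertex N L → Fin N → List (Fin N)
  b_valid : ∀ v i, Ok v i → Valid (act v i) (b v i)
  b_nodup : ∀ v i, Ok v i → (b v i).Nodup
  b_toFinset : ∀ v i, Ok v i → (b v i).toFinset = Finset.univ.erase i

theorem Loops.b_length (Q : Loops N L) {v : Vertex N L} {i : Fin N} (h : Ok v i) :
    (Q.b v i).length + 1 = N := by
  rw [← List.toFinset_card_of_nodup (Q.b_nodup v i h), Q.b_toFinset v i h,
    Finset.card_erase_of_mem (Finset.mem_univ i), Finset.card_univ, Fintype.card_fin]
  have := i.2
  omega

theorem Loops.q_length (Q : Loops N L) (v : Vertex N L) : (Q.q v).length = N := by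
  rw [← List.toFinset_card_of_nodup (Q.q_nodup v), Q.q_toFinset v, Finset.card_univ,
    Fintype.card_fin]

/-- Steps with a fixed letter are injective, so a sum over the sources of the k-edges may be indexed
by their ranges. Vanishing outside the domain and outside the image makes both sums run over all
vertices. -/
theorem sum_act {M : Type*} [AddCommMonoid M] (k : Fin N) (F G : Vertex N L → M)
    (hF : ∀ u, ¬ Ok u k → F u = 0) (hFG : ∀ u, Ok u k → F u = G (act u k))
    (hG : ∀ v, (∀ u, ¬ IsStep u k v) → G v = 0) : ∑ u, F u = ∑ v, G v := by
  classical
  refine Finset.sum_bij_ne_zero (fun u _ _ => act u k) (fun _ _ _ => Finset.mem_univ _) ?_ ?_ ?_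
  · intro u _ hu v _ hv h
    exact act_injective (by_contra fun h => hu (hF u h)) (by_contra fun h => hv (hF v h)) h
  · intro v _ hv
    by_cases hex : ∃ u, IsStep u k v
    · obtain ⟨u, hu⟩ := hex
      obtain ⟨h1, h2⟩ := isStep_iff.mp hu
      exact ⟨u, Finset.mem_univ _, by rwa [hFG u h1, h2], h2⟩
    · exact absurd (hG v (not_exists.mp hex)) hv
  · intro u _ hu
    exact hFG u (by_contra fun h => hu (hF u h))

theorem SOSParams.qDim_ne_zero {t ε : ℂ} (hP : SOSParams N L t ε) (v : Vertex N L) :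
    qDim t v ≠ 0 :=
  Finset.prod_ne_zero_iff.mpr fun x hx => by
    have := (Finset.mem_filter.mp hx).2.ne
    exact div_ne_zero (hP.qInt_dist_ne_zero v this) (hP.qInt_dist_ne_zero _ this)

end Return

/-! ### The quantum determinant, its cofactors and their inverse relations. -/

namespace FaceRep

variable {N L : ℕ} {A : Type*} [Ring A] [Algebra ℂ A] {R : FaceRep N L A} {t ε : ℂ}

/-- The image of the quantum determinant. -/
def det (R : FaceRep N L A) (t ε : ℂ) (Q : Loops N L) : A :=
  ∑ l, ∑ m, ((qDim t m / qDim t l) * sgn ε (Q.q m)) •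
    R.Phi N (altSign ε Finset.univ) l m (Q.q m)

/-- `R` comes from a homomorphism from the `SU(N)_L`-SOS algebra to `A`. -/
structure IsSOS (R : FaceRep N L A) (t ε : ℂ) (Q : Loops N L) : Prop where
  rel : R.Rel t ε
  sum_ev : ∑ l, ∑ m, R.ev l m = 1
  det_eq : R.det t ε Q = 1

theorem ev_mul_Phi_self (m : ℕ) (f : List (Fin N) → ℂ) (v v' : Vertex N L) (w' : List (Fin N)) :
    R.ev v v' * R.Phi m f v v' w' = R.Phi m f v v' w' := by
  rw [Phi, mul_wsum]
  exact wsum_congr fun w _ => by rw [mul_smul_comm, ev_mul_E_self]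

theorem ev_mul_Phi_ne {v v' u u' : Vertex N L} (h : ¬ (v = u ∧ v' = u')) (m : ℕ)
    (f : List (Fin N) → ℂ) (w' : List (Fin N)) : R.ev v v' * R.Phi m f u u' w' = 0 := by
  rw [Phi, mul_wsum]
  exact wsum_eq_zero fun w _ => by rw [mul_smul_comm, ev_mul_E_ne R h, smul_zero]

theorem Phi_eq_zero_of_not_valid {v' : Vertex N L} {w' : List (Fin N)} (h : ¬ Valid v' w')
    (m : ℕ) (f : List (Fin N) → ℂ) (v : Vertex N L) : R.Phi m f v v' w' = 0 :=
  wsum_eq_zero fun w _ => by rw [E_eq_zero R fun h' => h h'.2, smul_zero]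

theorem Rel.Phi_eq_zero (hR : R.Rel t ε) (hP : SOSParams N L t ε) {w' : List (Fin N)}
    (h : ¬ w'.Nodup) (m : ℕ) (J : Finset (Fin N)) (v v' : Vertex N L) :
    R.Phi m (altSign ε J) v v' w' = 0 := by
  by_cases h' : Valid v' w'
  · exact (hR.antisym hP (altSign_alternating hP.sq J) m v v').eq_zero hP.two_le_N hP.two_le_L
      hP.sq h' h
  · exact Phi_eq_zero_of_not_valid h' _ _ _

/-- Up to sign only the letters of the column matter. This is the independence of the loops and
return paths chosen in `Loops`. -/
theorem Rel.Phi_perm (hR : R.Rel t ε) (hP : SOSParams N L t ε) {v' : Vertex N L}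
    {w w' : List (Fin N)} (h : Valid v' w) (h' : Valid v' w') (hw : w.Nodup) (hw' : w'.Nodup)
    (hww' : w.toFinset = w'.toFinset) (m : ℕ) (J : Finset (Fin N)) (v : Vertex N L) :
    sgn ε w • R.Phi m (altSign ε J) v v' w = sgn ε w' • R.Phi m (altSign ε J) v v' w' :=
  (hR.antisym hP (altSign_alternating hP.sq J) m v v').perm hP.two_le_N hP.sq h h' hw
    (List.perm_of_nodup_nodup_toFinset_eq hw hw' hww')

theorem ev_mul_det (Q : Loops N L) (v v' : Vertex N L) : R.ev v v' * R.det t ε Q =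
    ((qDim t v' / qDim t v) * sgn ε (Q.q v')) •
      R.Phi N (altSign ε Finset.univ) v v' (Q.q v') := by
  rw [det, Finset.mul_sum, Finset.sum_eq_single v, Finset.mul_sum, Finset.sum_eq_single v',
    mul_smul_comm, ev_mul_Phi_self]
  · intro m _ hm
    rw [mul_smul_comm, ev_mul_Phi_ne (fun h => hm h.2.symm), smul_zero]
  · exact fun h => absurd (Finset.mem_univ _) h
  · intro l _ hl
    rw [Finset.mul_sum]
    exact Finset.sum_eq_zero fun m _ => by
      rw [mul_smul_comm, ev_mul_Phi_ne (fun h => hl h.1.symm), smul_zero]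
  · exact fun h => absurd (Finset.mem_univ _) h

/-- Multiplying det = 1 by a vertex symbol leaves a single summand of the determinant, and
`Rel.Phi_perm` replaces the chosen loop by an arbitrary one. -/
theorem IsSOS.Phi_univ {Q : Loops N L} (hR : R.IsSOS t ε Q) (hP : SOSParams N L t ε)
    (v : Vertex N L) {v' : Vertex N L} {w : List (Fin N)} (h : Valid v' w) (hw : w.Nodup)
    (hl : w.length = N) : R.Phi N (altSign ε Finset.univ) v v' w =
      (sgn ε w * (qDim t v / qDim t v')) • R.ev v v' := by
  have h1 := ev_mul_det (R := R) (t := t) (ε := ε) Q v v'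
  rw [hR.det_eq, mul_one, mul_smul] at h1
  have h2 := hR.rel.Phi_perm hP h (Q.q_valid v') hw (Q.q_nodup v')
    (by rw [toFinset_eq_univ hw hl, Q.q_toFinset]) N Finset.univ v
  rw [h1, ← h2, smul_smul, smul_smul]
  have h3 := hP.qDim_ne_zero v
  have h4 := hP.qDim_ne_zero v'
  have h5 := sgn_mul_self hP.sq w
  rw [show sgn ε w * (qDim t v / qDim t v') * (qDim t v' / qDim t v) * sgn ε w =
    (sgn ε w * sgn ε w) * (qDim t v / qDim t v' * (qDim t v' / qDim t v)) by ring, h5,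
    div_mul_div_cancel₀ h4, div_self h3, one_mul, one_smul]

/-- Expansion along the last letter. -/
theorem Phi_append_singleton {n : ℕ} (hn : n + 1 = N) (v v' : Vertex N L) {w : List (Fin N)}
    (hw : w.length = n) (z : Fin N) : R.Phi N (altSign ε Finset.univ) v v' (w ++ [z]) =
      ∑ k : Fin N, (-ε) ^ (k : ℕ) •
        (R.Phi n (altSign ε (Finset.univ.erase k)) v v' w * R.x k z) := by
  have : R.Phi N (altSign ε Finset.univ) v v' (w ++ [z]) =
      R.Phi (n + 1) (altSign ε Finset.univ) v v' (w ++ [z]) := by rw [hn]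
  rw [this, Phi, wsum_succ_last]
  refine Finset.sum_congr rfl fun k _ => ?_
  rw [Phi, wsum_mul, smul_wsum]
  refine wsum_congr fun a ha => ?_
  rw [altSign_append_singleton, E, X_append R (ha.trans hw.symm), X_singleton, smul_mul_assoc,
    smul_smul, mul_comm, E, mul_assoc]

/-- Expansion along the first letter. -/
theorem Phi_cons {n : ℕ} (hn : n + 1 = N) (v v' : Vertex N L) (w : List (Fin N)) (z : Fin N) :
    R.Phi N (altSign ε Finset.univ) v v' (z :: w) =
      ∑ k : Fin N, (-ε) ^ (N - 1 - (k : ℕ)) • (R.E v [k] v' [z] *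
        R.Phi n (altSign ε (Finset.univ.erase k)) (act v k) (act v' z) w) := by
  have : R.Phi N (altSign ε Finset.univ) v v' (z :: w) =
      R.Phi (n + 1) (altSign ε Finset.univ) v v' (z :: w) := by rw [hn]
  rw [this, Phi, wsum]
  refine Finset.sum_congr rfl fun k _ => ?_
  rw [Phi, mul_wsum, smul_wsum]
  refine wsum_congr fun a _ => ?_
  rw [altSign_cons, E_cons, mul_smul_comm, mul_smul]

/-- Rows with a nonzero coefficient are orderings of all letters but k; from the end of a k-edge
they lead back to its source. -/
theorem Phi_mul_ev_self (n : ℕ) {u : Vertex N L} {k : Fin N} (hk : Ok u k) {u' v' : Vertex N L}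
    {w : List (Fin N)} (hw : Valid v' w) (hu' : run v' w = u') :
    R.Phi n (altSign ε (Finset.univ.erase k)) (act u k) v' w * R.ev u u' =
      R.Phi n (altSign ε (Finset.univ.erase k)) (act u k) v' w := by
  rw [Phi, wsum_mul]
  refine wsum_congr fun a _ => ?_
  rw [altSign]
  split_ifs with h
  · by_cases ha : Valid (act u k) a
    · have := run_return hk ha h.1 h.2
      have h1 := R.E_mul_ev_self ha hw
      rw [this, hu'] at h1
      rw [smul_mul_assoc, h1]
    · rw [E_eq_zero R fun h => ha h.1, smul_zero, zero_mul]
  · rw [zero_smul, zero_mul]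

/-- A row with a nonzero coefficient would exhibit `v` as the end of a k-edge, by `isStep_run`. -/
theorem Phi_eq_zero_of_not_isStep (n : ℕ) {k : Fin N} {v : Vertex N L}
    (h : ∀ u, ¬ IsStep u k v) (v' : Vertex N L) (w : List (Fin N)) :
    R.Phi n (altSign ε (Finset.univ.erase k)) v v' w = 0 := by
  refine wsum_eq_zero fun a _ => ?_
  rw [altSign]
  split_ifs with h'
  · by_cases ha : Valid v a
    · exact absurd (isStep_run ha h'.1 h'.2) (h _)
    · rw [E_eq_zero R fun h => ha h.1, smul_zero]
  · rw [zero_smul]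

/-- The image of the symbol of the edges `(u | i)` and `(u' | k)` under the antipode. -/
def cof (R : FaceRep N L A) (t ε : ℂ) (Q : Loops N L) (u : Vertex N L) (i : Fin N)
    (u' : Vertex N L) (k : Fin N) : A :=
  open scoped Classical in
  if Ok u i ∧ Ok u' k then
    ((-ε) ^ ((i : ℕ) + k) * (qDim t (act u i) / qDim t (act u' k)) * sgn ε (Q.b u i)) •
      R.Phi (N - 1) (altSign ε (Finset.univ.erase k)) (act u' k) (act u i) (Q.b u i)
  else 0

variable {Q : Loops N L}

theorem cof_eq_zero {u u' : Vertex N L} {i k : Fin N} (h : ¬ (Ok u i ∧ Ok u' k)) :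
    R.cof t ε Q u i u' k = 0 := if_neg h

theorem ev_mul_cof {u u' : Vertex N L} {i k : Fin N} :
    R.ev (act u' k) (act u i) * R.cof t ε Q u i u' k = R.cof t ε Q u i u' k := by
  rw [cof]
  split_ifs
  · rw [mul_smul_comm, ev_mul_Phi_self]
  · rw [mul_zero]

theorem cof_mul_ev {u u' : Vertex N L} {i k : Fin N} :
    R.cof t ε Q u i u' k * R.ev u' u = R.cof t ε Q u i u' k := by
  rw [cof]
  split_ifs with h
  · rw [smul_mul_assoc, Phi_mul_ev_self _ h.2 (Q.b_valid u i h.1)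
      (run_return h.1 (Q.b_valid u i h.1) (Q.b_nodup u i h.1) (Q.b_toFinset u i h.1))]
  · rw [zero_mul]

theorem mem_b {u : Vertex N L} {i z : Fin N} (h : Ok u i) : z ∈ Q.b u i ↔ z ≠ i := by
  rw [← List.mem_toFinset, Q.b_toFinset u i h]
  simp

/-- The cofactors form a left inverse of the matrix of edge symbols. -/
theorem IsSOS.cof_mul (hR : R.IsSOS t ε Q) (hP : SOSParams N L t ε) {u v : Vertex N L}
    {i z : Fin N} (hu : Ok u i) (hv : Ok v z) :
    ∑ k, ∑ u', R.cof t ε Q u i u' k * R.E u' [k] v [z] =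
      open scoped Classical in if u = v ∧ i = z then ∑ l, R.ev l (act u i) else 0 := by
  by_cases huv : u = v
  swap
  · rw [if_neg fun h => huv h.1]
    refine Finset.sum_eq_zero fun k _ => Finset.sum_eq_zero fun u' _ => ?_
    rw [← cof_mul_ev, mul_assoc, ev_mul_E_ne R fun h => huv h.2, mul_zero]
  subst huv
  have hN := hP.two_le_N
  have hb := Q.b_length hu
  have hbv := Q.b_valid u i hu
  have hrun := run_return hu hbv (Q.b_nodup u i hu) (Q.b_toFinset u i hu)
  -- Cofactors depend on u' through u' + k̂, so the sum is indexed by l = u' + k̂. The factor D in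
  -- the denominator then depends on l alone and leaves the sum over k.
  have h1 : ∀ k, ∑ u', R.cof t ε Q u i u' k * R.E u' [k] u [z] =
      ∑ l, ((-ε) ^ (i : ℕ) * (qDim t (act u i) / qDim t l) * sgn ε (Q.b u i)) •
        (-ε) ^ (k : ℕ) • (R.Phi (N - 1) (altSign ε (Finset.univ.erase k)) l (act u i)
          (Q.b u i) * R.x k z) := by
    intro k
    refine sum_act k _ _ ?_ ?_ ?_
    · intro u' hu'
      rw [cof_eq_zero fun h => hu' h.2, zero_mul]
    · intro u' hu'
      rw [E, X_singleton, ← mul_assoc, cof_mul_ev, cof, if_pos ⟨hu, hu'⟩, smul_mul_assoc,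
        smul_smul, pow_add]
      congr 1
      ring
    · intro l hl
      rw [Phi_eq_zero_of_not_isStep _ hl, zero_mul, smul_zero, smul_zero]
  simp only [h1]
  rw [Finset.sum_comm]
  simp only [← Finset.smul_sum]
  -- For fixed l the sum over k is the expansion of a full minor along its last letter; the column
  -- is the return path followed by z.
  have h2 : ∀ l, ∑ k : Fin N, (-ε) ^ (k : ℕ) • (R.Phi (N - 1)
      (altSign ε (Finset.univ.erase k)) l (act u i) (Q.b u i) * R.x k z) =
      R.Phi N (altSign ε Finset.univ) l (act u i) (Q.b u i ++ [z]) := fun l =>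
    (Phi_append_singleton (by omega) l (act u i) (by omega) z).symm
  simp only [h2]
  -- For z = i the column is a loop and the minor is evaluated by det = 1; otherwise z already
  -- occurs in the return path and the minor vanishes.
  by_cases hz : i = z
  · subst hz
    rw [if_pos (by simp)]
    refine Finset.sum_congr rfl fun l _ => ?_
    have hnd : (Q.b u i ++ [i]).Nodup := by
      rw [List.nodup_append]
      refine ⟨Q.b_nodup u i hu, by simp, ?_⟩
      intro a ha b hb' hab
      rw [List.mem_singleton] at hb'
      exact (mem_b hu).mp ha (hab.trans hb')
    rw [hR.Phi_univ hP l (valid_append.mpr ⟨hbv, by rw [hrun]; exact ⟨hu, trivial⟩⟩) hnd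
      (by simp; omega), smul_smul]
    have h3 := altSign_append_singleton (ε := ε) (Q.b u i) i
    rw [altSign, altSign, if_pos ⟨hnd, toFinset_eq_univ hnd (by simp; omega)⟩,
      if_pos ⟨Q.b_nodup u i hu, Q.b_toFinset u i hu⟩] at h3
    rw [h3]
    have h4 := hP.qDim_ne_zero l
    have h5 := hP.qDim_ne_zero (act u i)
    have h6 := sgn_mul_self hP.sq (Q.b u i)
    have h7 := neg_pow_mul_self hP.sq (i : ℕ)
    have h8 : qDim t (act u i) / qDim t l * (qDim t l / qDim t (act u i)) = 1 := by
      rw [div_mul_div_cancel₀ h4, div_self h5]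
    rw [show (-ε) ^ (i : ℕ) * (qDim t (act u i) / qDim t l) * sgn ε (Q.b u i) *
      (sgn ε (Q.b u i) * (-ε) ^ (i : ℕ) * (qDim t l / qDim t (act u i))) =
      (sgn ε (Q.b u i) * sgn ε (Q.b u i)) * ((-ε) ^ (i : ℕ) * (-ε) ^ (i : ℕ)) *
      (qDim t (act u i) / qDim t l * (qDim t l / qDim t (act u i))) by ring, h6, h7, h8,
      one_mul, one_mul, one_smul]
  · rw [if_neg fun h => hz h.2]
    refine Finset.sum_eq_zero fun l _ => ?_
    rw [hR.rel.Phi_eq_zero hP, smul_zero]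
    rw [List.nodup_append]
    exact fun h => h.2.2 z ((mem_b hu).mpr (Ne.symm hz)) z (List.mem_singleton_self z) rfl

/-- The quantum dimension ratio of an edge. -/
def qRatio (t : ℂ) (u : Vertex N L) (i : Fin N) : ℂ := qDim t (act u i) / qDim t u

/-- The twisted inverse relation in the opposite order. -/
theorem IsSOS.mul_cof (hR : R.IsSOS t ε Q) (hP : SOSParams N L t ε) {u v : Vertex N L}
    {i z : Fin N} (hu : Ok u i) (hv : Ok v z) (l : Vertex N L) :
    ∑ k, qRatio t l k • (R.E l [k] v [z] * R.cof t ε Q u i l k) =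
      open scoped Classical in if u = v ∧ i = z then qRatio t u i • R.ev l u else 0 := by
  by_cases huv : act u i = act v z
  swap
  · rw [if_neg (by rintro ⟨rfl, rfl⟩; exact huv rfl)]
    refine Finset.sum_eq_zero fun k _ => ?_
    rw [← ev_mul_cof, ← mul_assoc, E_mul_ev_ne R fun h => huv h.2.symm, zero_mul, smul_zero]
  have hN := hP.two_le_N
  have hb := Q.b_length hu
  have hbv := Q.b_valid u i hu
  -- The weight `qRatio t l k` cancels the factor D(l + k̂) in the denominator of the cofactor. The
  -- sum over k, with l fixed, is then an expansion along the first letter.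
  have h1 : ∀ k, qRatio t l k • (R.E l [k] v [z] * R.cof t ε Q u i l k) =
      ((-ε) ^ (i : ℕ) * (-ε) ^ (N - 1) * (qDim t (act u i) / qDim t l) * sgn ε (Q.b u i)) •
        (-ε) ^ (N - 1 - (k : ℕ)) • (R.E l [k] v [z] *
          R.Phi (N - 1) (altSign ε (Finset.univ.erase k)) (act l k) (act v z) (Q.b u i)) := by
    intro k
    by_cases hk : Ok l k
    · rw [cof, if_pos ⟨hu, hk⟩, mul_smul_comm, smul_smul, smul_smul, huv, qRatio]
      congr 1
      have h3 := hP.qDim_ne_zero (act l k)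
      -- The cofactor carries the sign of an expansion along the last letter; the sign for the first
      -- letter differs by a power independent of k.
      have h4 : (-ε) ^ (N - 1) = (-ε) ^ (k : ℕ) * (-ε) ^ (N - 1 - (k : ℕ)) := by
        rw [← pow_add]
        congr 1
        have := k.2
        omega
      have h5 := neg_pow_mul_self hP.sq (N - 1 - (k : ℕ))
      have h6 : qDim t (act l k) / qDim t l * (qDim t (act v z) / qDim t (act l k)) =
          qDim t (act v z) / qDim t l := by
        rw [mul_comm, div_mul_div_cancel₀ h3]
      rw [h4, pow_add, ← h6]
      linear_combination (-((-ε) ^ (i : ℕ) * (-ε) ^ (k : ℕ) * sgn ε (Q.b u i)) *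
        (qDim t (act l k) / qDim t l * (qDim t (act v z) / qDim t (act l k)))) * h5
    · have h3 : R.E l [k] v [z] = 0 := R.E_eq_zero fun h => hk h.1.1
      rw [h3, zero_mul, zero_mul, smul_zero, smul_zero, smul_zero]
  simp only [h1]
  rw [← Finset.smul_sum, ← Phi_cons (by omega)]
  by_cases hz : i = z
  · subst hz
    obtain rfl := act_injective hu hv huv
    rw [if_pos ⟨rfl, rfl⟩]
    have hnd : (i :: Q.b u i).Nodup :=
      List.nodup_cons.mpr ⟨fun h => (mem_b hu).mp h rfl, Q.b_nodup u i hu⟩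
    rw [hR.Phi_univ hP l (show Valid u (i :: Q.b u i) from ⟨hu, hbv⟩) hnd (by simp; omega), smul_smul,
      sgn_cons_of_toFinset (Q.b_nodup u i hu) (Q.b_toFinset u i hu), qRatio]
    congr 1
    have h3 := hP.qDim_ne_zero l
    have h4 : (-ε) ^ (N - 1) = (-ε) ^ (i : ℕ) * (-ε) ^ (N - 1 - (i : ℕ)) := by
      rw [← pow_add]
      congr 1
      have := i.2
      omega
    have h5 := neg_pow_mul_self hP.sq (N - 1 - (i : ℕ))
    have h6 := sgn_mul_self hP.sq (Q.b u i)
    have h7 := neg_pow_mul_self hP.sq (i : ℕ)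
    have h8 : qDim t (act u i) / qDim t l * (qDim t l / qDim t u) =
        qDim t (act u i) / qDim t u := by
      rw [div_mul_div_cancel₀ h3]
    rw [h4, show (-ε) ^ (i : ℕ) * ((-ε) ^ (i : ℕ) * (-ε) ^ (N - 1 - (i : ℕ))) *
      (qDim t (act u i) / qDim t l) * sgn ε (Q.b u i) *
      ((-ε) ^ (N - 1 - (i : ℕ)) * sgn ε (Q.b u i) * (qDim t l / qDim t u)) =
      ((-ε) ^ (i : ℕ) * (-ε) ^ (i : ℕ)) *
      ((-ε) ^ (N - 1 - (i : ℕ)) * (-ε) ^ (N - 1 - (i : ℕ))) *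
      (sgn ε (Q.b u i) * sgn ε (Q.b u i)) *
      (qDim t (act u i) / qDim t l * (qDim t l / qDim t u)) by ring, h5, h6, h7, h8,
      one_mul, one_mul, one_mul]
  · rw [if_neg fun h => hz h.2, hR.rel.Phi_eq_zero hP, smul_zero]
    rw [List.nodup_cons]
    exact fun h => h.1 ((mem_b hu).mpr (Ne.symm hz))

end FaceRep

/-! ### An identity for quantum integers -/

section Lagrange

variable {ι : Type*} [DecidableEq ι]

/-- The polynomial ∏(cX - u_j) - ∏(X - u_j) has no constant term, so its quotient by X is determined
by its values at the points u_i. Comparing leading coefficients in Lagrange's formula for the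
quotient gives the identity. -/
theorem sum_prod_mul_sub_div (s : Finset ι) (u : ι → ℂ) (hu : Set.InjOn u s)
    (hu0 : ∀ i ∈ s, u i ≠ 0) (c : ℂ) :
    ∑ i ∈ s, (c - 1) * ∏ j ∈ s.erase i, (c * u i - u j) / (u i - u j) = c ^ s.card - 1 := by
  classical
  open Polynomial in
  rcases s.eq_empty_or_nonempty with rfl | hs
  · simp
  have hcard := hs.card_pos
  let D : ℂ[X] := ∏ j ∈ s, (C c * X - C (u j)) - ∏ j ∈ s, (X - C (u j))
  have hdeg1 : ∀ j ∈ s, (C c * X - C (u j)).natDegree ≤ 1 := fun j _ => by compute_degree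
  have hdeg2 : ∀ j ∈ s, (X - C (u j)).natDegree ≤ 1 := fun j _ => by compute_degree
  have hD : D.natDegree ≤ s.card := by
    refine (natDegree_sub_le _ _).trans (max_le ?_ ?_)
    · refine (natDegree_prod_le _ _).trans ((Finset.sum_le_sum hdeg1).trans ?_)
      simp
    · refine (natDegree_prod_le _ _).trans ((Finset.sum_le_sum hdeg2).trans ?_)
      simp
  have hcoeff : D.coeff s.card = c ^ s.card - 1 := by
    have h1 := coeff_prod_of_natDegree_le s _ 1 hdeg1
    have h2 := coeff_prod_of_natDegree_le s _ 1 hdeg2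
    rw [mul_one] at h1 h2
    rw [coeff_sub, h1, h2]
    simp [coeff_X, coeff_C]
  have hD0 : D.coeff 0 = 0 := by
    rw [coeff_zero_eq_eval_zero]
    simp [D, eval_prod]
  have hlt : D.divX.degree < s.card := by
    rw [degree_lt_iff_coeff_zero]
    intro k hk
    rw [coeff_divX]
    exact coeff_eq_zero_of_natDegree_lt (by omega)
  have hsum := Lagrange.coeff_eq_sum hu hlt
  rw [coeff_divX, Nat.sub_add_cancel hcard, hcoeff] at hsum
  rw [hsum]
  refine Finset.sum_congr rfl fun i hi => ?_
  have h1 : D.divX.eval (u i) * u i = D.eval (u i) := by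
    conv_rhs => rw [← divX_mul_X_add D, hD0]
    simp
  -- The second product vanishes at u_i, and the factor with j = i of the first one is (c - 1) u_i.
  have h2 : D.eval (u i) = (c - 1) * u i * ∏ j ∈ s.erase i, (c * u i - u j) := by
    simp only [D, eval_sub, eval_prod, eval_mul, eval_C, eval_X]
    rw [← Finset.mul_prod_erase s _ hi, ← Finset.mul_prod_erase s (fun j => u i - u j) hi]
    ring
  have h3 : D.divX.eval (u i) = (c - 1) * ∏ j ∈ s.erase i, (c * u i - u j) := by
    apply mul_right_cancel₀ (hu0 i hi)
    rw [h1, h2]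
    ring
  rw [h3, Finset.prod_div_distrib, mul_div_assoc]

/-- The case c = t², u_i = t^(2 y_i) of `sum_prod_mul_sub_div`, in which each quotient of quantum
integers equals t⁻¹ times the corresponding quotient of linear expressions. -/
theorem SOSParams.sum_prod_qInt {N L : ℕ} {t ε : ℂ} (hP : SOSParams N L t ε) (s : Finset ι)
    (y : ι → ℤ) (hy : ∀ i ∈ s, ∀ j ∈ s, i ≠ j → qInt t (y i - y j) ≠ 0) :
    ∑ i ∈ s, ∏ j ∈ s.erase i, qInt t (y i - y j + 1) / qInt t (y i - y j) = qInt t s.card := by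
  have ht := hP.t_ne_zero
  have h1 := hP.t_sub_ne_zero
  have h2 : t ^ 2 - 1 ≠ 0 := fun h0 => h1 (by field_simp; linear_combination h0)
  let u : ι → ℂ := fun i => t ^ (2 * y i)
  have hu0 : ∀ i, u i ≠ 0 := fun i => zpow_ne_zero _ ht
  have hq : ∀ i j, qInt t (y i - y j) * (t - t⁻¹) * t ^ (y i + y j) = u i - u j := by
    intro i j
    rw [qInt, div_mul_cancel₀ _ h1, sub_mul, ← zpow_add₀ ht, ← zpow_add₀ ht]
    congr 2 <;> ring
  have hq' : ∀ i j, qInt t (y i - y j + 1) * (t - t⁻¹) * t ^ (y i + y j) =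
      t⁻¹ * (t ^ 2 * u i - u j) := by
    intro i j
    rw [qInt, div_mul_cancel₀ _ h1, sub_mul, ← zpow_add₀ ht, ← zpow_add₀ ht,
      show y i - y j + 1 + (y i + y j) = 2 * y i + 1 by ring,
      show -(y i - y j + 1) + (y i + y j) = 2 * y j - 1 by ring, zpow_add₀ ht, zpow_sub₀ ht,
      zpow_one]
    simp only [u]
    field_simp
  have hfac : ∀ i ∈ s, ∀ j ∈ s.erase i, qInt t (y i - y j + 1) / qInt t (y i - y j) =
      t⁻¹ * ((t ^ 2 * u i - u j) / (u i - u j)) := by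
    intro i hi j hj
    have h3 := hy i hi j (Finset.mem_of_mem_erase hj) (Finset.ne_of_mem_erase hj).symm
    rw [← mul_div_assoc, ← hq, ← hq', mul_div_mul_right _ _ (zpow_ne_zero _ ht),
      mul_div_mul_right _ _ h1]
  have hinj : Set.InjOn u s := by
    intro i hi j hj hij
    by_contra hne
    have h3 := hq i j
    rw [hij, sub_self, mul_eq_zero, mul_eq_zero] at h3
    rcases h3 with (h3 | h3) | h3
    · exact hy i hi j hj hne h3
    · exact h1 h3
    · exact zpow_ne_zero _ ht h3
  have hmain := sum_prod_mul_sub_div s u hinj (fun i _ => hu0 i) (t ^ 2)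
  rw [← Finset.mul_sum] at hmain
  rcases s.eq_empty_or_nonempty with rfl | hs
  · simp [qInt]
  have hcard := hs.card_pos
  have h4 : ∑ i ∈ s, ∏ j ∈ s.erase i, qInt t (y i - y j + 1) / qInt t (y i - y j) =
      (t⁻¹) ^ (s.card - 1) *
        ∑ i ∈ s, ∏ j ∈ s.erase i, (t ^ 2 * u i - u j) / (u i - u j) := by
    rw [Finset.mul_sum]
    refine Finset.sum_congr rfl fun i hi => ?_
    rw [Finset.prod_congr rfl (hfac i hi), Finset.prod_mul_distrib, Finset.prod_const,
      Finset.card_erase_of_mem hi]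
  rw [h4, qInt, eq_div_iff h1, zpow_neg, zpow_natCast]
  obtain ⟨m, hm⟩ : ∃ m, s.card = m + 1 := ⟨s.card - 1, by omega⟩
  rw [hm] at hmain ⊢
  rw [Nat.add_sub_cancel]
  generalize ∑ i ∈ s, ∏ j ∈ s.erase i, (t ^ 2 * u i - u j) / (u i - u j) = S at hmain
  have h5 : S * (t - t⁻¹) = t⁻¹ * ((t ^ 2) ^ (m + 1) - 1) := by
    rw [← hmain]
    field_simp
  rw [mul_assoc, h5, ← pow_mul, two_mul, pow_add, inv_pow]
  have h6 : t ^ m ≠ 0 := pow_ne_zero _ ht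
  rw [pow_succ]
  field_simp

end Lagrange

/-! ### The gauge factors -/

/-- `∏_{k ≠ i} [d(v | i, k)]`. -/
def gauge {N L : ℕ} (t : ℂ) (v : Vertex N L) (i : Fin N) : ℂ :=
  ∏ k ∈ Finset.univ.erase i, qInt t (dist v i k)

/-- The product of the gauge factors of the edges of a path. -/
def gaugeWord {N L : ℕ} (t : ℂ) : Vertex N L → List (Fin N) → ℂ
  | _, [] => 1
  | v, i :: w => gauge t v i * gaugeWord t (act v i) w

open scoped Classical in
/-- The sum of the gauge factors of all paths from `v` whose indices are an ordering of `J`. -/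
def gaugeSum {N L : ℕ} (t : ℂ) (v : Vertex N L) (m : ℕ) (J : Finset (Fin N)) : ℂ :=
  wsum m fun w => if Valid v w ∧ w.Nodup ∧ w.toFinset = J then gaugeWord t v w else 0

section Gauge

variable {N L : ℕ} {t ε : ℂ}

theorem SOSParams.gauge_ne_zero (hP : SOSParams N L t ε) (v : Vertex N L) (i : Fin N) :
    gauge t v i ≠ 0 :=
  Finset.prod_ne_zero_iff.mpr fun _ hk => hP.qInt_dist_ne_zero v (Finset.ne_of_mem_erase hk).symm

theorem SOSParams.gaugeWord_ne_zero (hP : SOSParams N L t ε) (v : Vertex N L)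
    (w : List (Fin N)) : gaugeWord t v w ≠ 0 := by
  induction w generalizing v with
  | nil => exact one_ne_zero
  | cons i w ih => exact mul_ne_zero (hP.gauge_ne_zero v i) (ih _)

/-- Only the factor with k = i changes, from [d(v|j,i)] to [d(v|j,i) - 1]; the two minus signs
cancel in the quotient. -/
theorem SOSParams.gauge_act (hP : SOSParams N L t ε) {v : Vertex N L} {i j : Fin N} (hi : Ok v i)
    (hij : i ≠ j) : gauge t (act v i) j =
      gauge t v j * (qInt t (dist v i j + 1) / qInt t (dist v i j)) := by
  have hmem : i ∈ Finset.univ.erase j := Finset.mem_erase.mpr ⟨hij, Finset.mem_univ _⟩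
  have h1 := hP.qInt_dist_ne_zero v hij
  rw [gauge, gauge, ← Finset.mul_prod_erase _ _ hmem, ← Finset.mul_prod_erase _ _ hmem,
    dist_act hi, if_neg hij.symm, if_pos rfl, dist_swap v i j, add_zero,
    show -dist v i j - 1 = -(dist v i j + 1) by ring, qInt_neg, qInt_neg]
  have h2 : ∏ x ∈ (Finset.univ.erase j).erase i, qInt t (dist (act v i) j x) =
      ∏ x ∈ (Finset.univ.erase j).erase i, qInt t (dist v j x) := by
    refine Finset.prod_congr rfl fun x hx => ?_
    rw [dist_act hi, if_neg hij.symm, if_neg (Finset.ne_of_mem_erase hx), add_zero, sub_zero]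
  rw [h2]
  field_simp

/-- Splitting off the first letter i multiplies every later gauge factor by [d(i,j) + 1]/[d(i,j)],
by `gauge_act`. Summed over i, these products give the quantum integer of |J|, so a quantum
factorial builds up. The hypothesis `hv` says that letters of J are never blocked from outside J,
and it is inherited by the induction. -/
theorem SOSParams.gaugeSum_eq (hP : SOSParams N L t ε) (m : ℕ) (v : Vertex N L)
    (J : Finset (Fin N)) (hJ : J.card = m)
    (hv : ∀ i ∈ J, ∀ k, k ∉ J → ¬ ((N + L : ℕ) : ℤ) ∣ dist v i k + 1) :
    gaugeSum t v m J = (∏ r ∈ Finset.range m, qInt t (r + 1 : ℕ)) * ∏ i ∈ J, gauge t v i := by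
  induction m generalizing v J with
  | zero =>
    rw [Finset.card_eq_zero.mp hJ]
    simp [gaugeSum, wsum, Valid, gaugeWord]
  | succ m ih =>
    have h1 : ∀ i, (wsum m fun w => open scoped Classical in
        if Valid v (i :: w) ∧ (i :: w).Nodup ∧ (i :: w).toFinset = J then
          gaugeWord t v (i :: w) else 0) =
        if i ∈ J then ((∏ r ∈ Finset.range m, qInt t (r + 1 : ℕ)) * ∏ i ∈ J, gauge t v i) *
          ∏ j ∈ J.erase i, qInt t (dist v i j + 1) / qInt t (dist v i j) else 0 := by
      intro i
      by_cases hi : i ∈ J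
      swap
      · rw [if_neg hi]
        refine wsum_eq_zero fun w _ => if_neg ?_
        rintro ⟨-, -, rfl⟩
        simp at hi
      rw [if_pos hi]
      by_cases hok : Ok v i
      · have h2 : ∀ w : List (Fin N), (open scoped Classical in
            if Valid v (i :: w) ∧ (i :: w).Nodup ∧ (i :: w).toFinset = J then
              gaugeWord t v (i :: w) else 0) = gauge t v i * (open scoped Classical in
            if Valid (act v i) w ∧ w.Nodup ∧ w.toFinset = J.erase i then
              gaugeWord t (act v i) w else 0) := by
          intro w
          have hJw := nodup_cons_and_toFinset w i J hi
          rw [mul_ite, mul_zero]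
          by_cases h : Valid (act v i) w ∧ w.Nodup ∧ w.toFinset = J.erase i
          · rw [if_pos h, if_pos ⟨⟨hok, h.1⟩, hJw.mpr h.2⟩]
            rfl
          · rw [if_neg h, if_neg fun h' => h ⟨h'.1.2, hJw.mp h'.2⟩]
        simp only [h2]
        rw [← mul_wsum]
        change gauge t v i * gaugeSum t (act v i) m (J.erase i) = _
        rw [ih (act v i) (J.erase i) (by rw [Finset.card_erase_of_mem hi, hJ]; rfl)]
        · rw [← Finset.mul_prod_erase J _ hi,
            Finset.prod_congr rfl fun j hj =>
              hP.gauge_act hok (Finset.ne_of_mem_erase hj).symm, Finset.prod_mul_distrib]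
          ring
        · intro j hj k hk
          have hji := Finset.ne_of_mem_erase hj
          rw [dist_act hok, if_neg hji]
          by_cases hki : k = i
          · rw [if_pos hki, hki]
            simpa using not_dvd_dist v hji
          · rw [if_neg hki]
            simpa using hv j (Finset.mem_of_mem_erase hj) k
              fun h => hk (Finset.mem_erase.mpr ⟨hki, h⟩)
      -- If i is blocked there are no paths, and the closed formula agrees: the blocking letter lies
      -- in J and contributes a zero factor [d(i,k) + 1]. The identity may therefore be summed over
      -- all of J.
      · rw [wsum_eq_zero fun w _ => if_neg fun h => hok h.1.1]
        rw [ok_iff hP.two_le_N] at hok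
        push Not at hok
        obtain ⟨k, hki, hk⟩ := hok
        have hkJ : k ∈ J := by
          by_contra hkJ
          exact hv i hi k hkJ hk
        rw [Finset.prod_eq_zero (i := k) (Finset.mem_erase.mpr ⟨hki, hkJ⟩), mul_zero]
        rw [(hP.qInt_eq_zero_iff _).mpr hk, zero_div]
    rw [gaugeSum, wsum]
    simp only [h1]
    rw [← Finset.sum_filter, Finset.filter_mem_eq_inter, Finset.univ_inter, ← Finset.mul_sum]
    -- The distance is a difference of the shifted coordinates λ_i - i, as the identity requires.
    have h2 := hP.sum_prod_qInt J (fun i => v.coord i - i) fun i _ j _ hij => by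
      have := hP.qInt_dist_ne_zero v hij
      rwa [dist, show v.coord i - v.coord j + (j : ℤ) - i = v.coord i - i - (v.coord j - j) by
        ring] at this
    have h3 : ∀ i j, dist v i j = v.coord i - i - (v.coord j - j) := fun i j => by
      rw [dist]; ring
    simp only [h3]
    rw [h2, hJ, Finset.prod_range_succ]
    ring

/-- Only the quantum integers of 1, …, N enter the factorial, and N < N + L. -/
theorem SOSParams.gaugeSum_ne_zero (hP : SOSParams N L t ε) (v : Vertex N L) :
    gaugeSum t v N Finset.univ ≠ 0 := by
  rw [hP.gaugeSum_eq N v Finset.univ (by simp) (by simp)]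
  refine mul_ne_zero (Finset.prod_ne_zero_iff.mpr fun r hr => ?_)
    (Finset.prod_ne_zero_iff.mpr fun i _ => hP.gauge_ne_zero v i)
  rw [Ne, hP.qInt_eq_zero_iff, Int.natCast_dvd_natCast]
  intro h
  have := Nat.le_of_dvd (Nat.succ_pos r) h
  have := Finset.mem_range.mp hr
  have := hP.two_le_L
  omega

/-- The factors of (i, k) and (k, i) are combined; they are negatives of each other. -/
theorem prod_gauge (v : Vertex N L) : ∏ i, gauge t v i =
    ∏ x ∈ Finset.univ.filter (fun x : Fin N × Fin N => x.1 < x.2),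
      -(qInt t (dist v x.1 x.2) ^ 2) := by
  have h1 : ∏ i, gauge t v i =
      ∏ x ∈ Finset.univ.filter (fun x : Fin N × Fin N => x.1 ≠ x.2), qInt t (dist v x.1 x.2) := by
    rw [Finset.prod_filter, ← Finset.univ_product_univ, Finset.prod_product]
    refine Finset.prod_congr rfl fun i _ => ?_
    rw [gauge, ← Finset.prod_filter]
    refine Finset.prod_congr ?_ fun _ _ => rfl
    ext k
    simp [eq_comm]
  have h2 : Finset.univ.filter (fun x : Fin N × Fin N => x.1 ≠ x.2) =
      Finset.univ.filter (fun x : Fin N × Fin N => x.1 < x.2) ∪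
      Finset.univ.filter (fun x : Fin N × Fin N => x.2 < x.1) := by
    ext x
    simp [lt_or_lt_iff_ne]
  have h3 : ∏ x ∈ Finset.univ.filter (fun x : Fin N × Fin N => x.2 < x.1),
      qInt t (dist v x.1 x.2) = ∏ x ∈ Finset.univ.filter (fun x : Fin N × Fin N => x.1 < x.2),
      qInt t (dist v x.2 x.1) :=
    Finset.prod_nbij' Prod.swap Prod.swap (by simp) (by simp) (by simp) (by simp) (by simp)
  rw [h1, h2, Finset.prod_union, h3, ← Finset.prod_mul_distrib]
  · refine Finset.prod_congr rfl fun x _ => ?_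
    rw [dist_swap v x.1 x.2, qInt_neg]
    ring
  · rw [Finset.disjoint_filter]
    exact fun x _ h h' => absurd h h'.not_gt

/-- Both the product of the gauge factors and D² are products of [d]² over pairs, up to constants;
so the gauge sum divided by D² is the same at all vertices. -/
theorem SOSParams.gaugeSum_mul (hP : SOSParams N L t ε) (u v : Vertex N L) :
    gaugeSum t u N Finset.univ * qDim t v ^ 2 = gaugeSum t v N Finset.univ * qDim t u ^ 2 := by
  rw [hP.gaugeSum_eq N u Finset.univ (by simp) (by simp),
    hP.gaugeSum_eq N v Finset.univ (by simp) (by simp), prod_gauge, prod_gauge, qDim, qDim,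
    ← Finset.prod_pow, ← Finset.prod_pow, mul_assoc, mul_assoc, ← Finset.prod_mul_distrib,
    ← Finset.prod_mul_distrib]
  congr 1
  refine Finset.prod_congr rfl fun x _ => ?_
  ring

/-- The weight is symmetric up to the gauge factors. -/
theorem SOSParams.wOff_mul_gaugeWord (hP : SOSParams N L t ε) {v : Vertex N L} {i j : Fin N}
    (hij : i ≠ j) (h : Valid v [i, j]) (h' : Valid v [j, i]) :
    wOff t ε v i j * gaugeWord t v [i, j] = wOff t ε v j i * gaugeWord t v [j, i] := by
  have h1 := hP.qInt_dist_ne_zero v hij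
  simp only [gaugeWord, mul_one, wOff, if_neg hij, if_neg hij.symm]
  rw [hP.gauge_act h.1 hij, hP.gauge_act h'.1 hij.symm, dist_swap v i j,
    show -dist v i j - 1 = -(dist v i j + 1) by ring,
    show -dist v i j + 1 = -(dist v i j - 1) by ring, qInt_neg, qInt_neg, qInt_neg]
  field_simp

end Gauge

/-! ### Representations from edge symbols, and the transposed representation -/

theorem sum_comm_four {ι κ ι' κ' M : Type*} [Fintype ι] [Fintype κ] [Fintype ι'] [Fintype κ']
    [AddCommMonoid M] (f : ι → κ → ι' → κ' → M) :
    ∑ k, ∑ l, ∑ a, ∑ b, f k l a b = ∑ a, ∑ b, ∑ k, ∑ l, f k l a b := by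
  calc _ = ∑ k, ∑ a, ∑ l, ∑ b, f k l a b := Finset.sum_congr rfl fun _ _ => Finset.sum_comm
    _ = ∑ a, ∑ k, ∑ l, ∑ b, f k l a b := Finset.sum_comm
    _ = ∑ a, ∑ k, ∑ b, ∑ l, f k l a b :=
      Finset.sum_congr rfl fun _ _ => Finset.sum_congr rfl fun _ _ => Finset.sum_comm
    _ = ∑ a, ∑ b, ∑ k, ∑ l, f k l a b := Finset.sum_congr rfl fun _ _ => Finset.sum_comm

namespace FaceRep

variable {N L : ℕ} {A : Type*} [Ring A]

/-- A representation with given images of the edge symbols. -/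
def ofEdges (ev : Vertex N L → Vertex N L → A) (c : Vertex N L → Fin N → Vertex N L → Fin N → A)
    (ev_mul_self : ∀ v v', ev v v' * ev v v' = ev v v')
    (ev_mul_ne : ∀ v v' u u', ¬ (v = u ∧ v' = u') → ev v v' * ev u u' = 0)
    (ev_mul : ∀ v i v' k, ev v v' * c v i v' k = c v i v' k)
    (mul_ev : ∀ v i v' k, c v i v' k * ev (act v i) (act v' k) = c v i v' k)
    (eq_zero : ∀ v i v' k, ¬ (Ok v i ∧ Ok v' k) → c v i v' k = 0) : FaceRep N L A where
  ev := ev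
  x i k := ∑ v, ∑ v', c v i v' k
  ev_mul_self := ev_mul_self
  ev_mul_ne := ev_mul_ne
  ev_mul_x v v' i k h h' := by
    have h1 : ∀ u u', ¬ (v = u ∧ v' = u') → ev v v' * c u i u' k = 0 := fun u u' hne => by
      rw [← ev_mul, ← mul_assoc, ev_mul_ne _ _ _ _ hne, zero_mul]
    have h2 : ∀ u u', ¬ (v = u ∧ v' = u') → c u i u' k * ev (act v i) (act v' k) = 0 := by
      intro u u' hne
      by_cases hok : Ok u i ∧ Ok u' k
      · rw [← mul_ev, mul_assoc, ev_mul_ne, mul_zero]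
        exact fun hact => hne ⟨act_injective h hok.1 hact.1.symm, act_injective h' hok.2 hact.2.symm⟩
      · rw [eq_zero _ _ _ _ hok, zero_mul]
    have h3 : ev v v' * ∑ u, ∑ u', c u i u' k = c v i v' k := by
      rw [Finset.mul_sum, Finset.sum_eq_single v, Finset.mul_sum, Finset.sum_eq_single v', ev_mul]
      · exact fun u' _ hu' => h1 _ _ fun hh => hu' hh.2.symm
      · exact fun hh => absurd (Finset.mem_univ _) hh
      · intro u _ hu
        rw [Finset.mul_sum]
        exact Finset.sum_eq_zero fun u' _ => h1 _ _ fun hh => hu hh.1.symm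
      · exact fun hh => absurd (Finset.mem_univ _) hh
    rw [h3, Finset.sum_mul, Finset.sum_eq_single v, Finset.sum_mul, Finset.sum_eq_single v', mul_ev]
    · exact fun u' _ hu' => h2 _ _ fun hh => hu' hh.2.symm
    · exact fun hh => absurd (Finset.mem_univ _) hh
    · intro u _ hu
      rw [Finset.sum_mul]
      exact Finset.sum_eq_zero fun u' _ => h2 _ _ fun hh => hu hh.1.symm
    · exact fun hh => absurd (Finset.mem_univ _) hh
  ev_mul_x_eq_zero v v' i k h := by
    rw [Finset.mul_sum]
    refine Finset.sum_eq_zero fun u _ => ?_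
    rw [Finset.mul_sum]
    refine Finset.sum_eq_zero fun u' _ => ?_
    by_cases hne : v = u ∧ v' = u'
    · rw [eq_zero, mul_zero]
      rwa [← hne.1, ← hne.2]
    · rw [← ev_mul, ← mul_assoc, ev_mul_ne _ _ _ _ hne, zero_mul]

theorem ofEdges_E_singleton (ev : Vertex N L → Vertex N L → A)
    (c : Vertex N L → Fin N → Vertex N L → Fin N → A) (h1 h2 h3 h4 h5) (v v' : Vertex N L)
    (i k : Fin N) : (ofEdges ev c h1 h2 h3 h4 h5).E v [i] v' [k] = c v i v' k := by
  rw [E, X_singleton]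
  change ev v v' * (∑ u, ∑ u', c u i u' k) = _
  have h : ∀ u u', ¬ (v = u ∧ v' = u') → ev v v' * c u i u' k = 0 := fun u u' hne => by
    rw [← h3, ← mul_assoc, h2 _ _ _ _ hne, zero_mul]
  rw [Finset.mul_sum, Finset.sum_eq_single v, Finset.mul_sum, Finset.sum_eq_single v', h3]
  · exact fun u' _ hu' => h _ _ fun hh => hu' hh.2.symm
  · exact fun hh => absurd (Finset.mem_univ _) hh
  · intro u _ hu
    rw [Finset.mul_sum]
    exact Finset.sum_eq_zero fun u' _ => h _ _ fun hh => hu hh.1.symm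
  · exact fun hh => absurd (Finset.mem_univ _) hh

theorem ev_mul_E_singleton (R : FaceRep N L A) (v v' : Vertex N L) (i k : Fin N) :
    R.ev v v' * R.E v [i] v' [k] = R.E v [i] v' [k] := R.ev_mul_E_self _ _ _ _

theorem E_singleton_eq_zero (R : FaceRep N L A) {v v' : Vertex N L} {i k : Fin N}
    (h : ¬ (Ok v i ∧ Ok v' k)) : R.E v [i] v' [k] = 0 :=
  R.E_eq_zero (w := [i]) (w' := [k]) fun h' => h ⟨h'.1.1, h'.2.1⟩

theorem E_singleton_mul_ev (R : FaceRep N L A) (v v' : Vertex N L) (i k : Fin N) :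
    R.E v [i] v' [k] * R.ev (act v i) (act v' k) = R.E v [i] v' [k] := by
  by_cases h : Ok v i ∧ Ok v' k
  · exact R.E_mul_ev_self (w := [i]) (w' := [k]) ⟨h.1, trivial⟩ ⟨h.2, trivial⟩
  · rw [R.E_singleton_eq_zero h, zero_mul]

theorem ev_mul_sum_left (R : FaceRep N L A) (v v' : Vertex N L) : R.ev v v' * ∑ m, R.ev v m = R.ev v v' := by
  rw [Finset.mul_sum, Finset.sum_eq_single v', ev_mul_self]
  · exact fun m _ hm => R.ev_mul_ne _ _ _ _ fun h => hm h.2.symm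
  · exact fun h => absurd (Finset.mem_univ _) h

theorem sum_right_mul_ev (R : FaceRep N L A) (v v' : Vertex N L) : (∑ l, R.ev l v') * R.ev v v' = R.ev v v' := by
  rw [Finset.sum_mul, Finset.sum_eq_single v, ev_mul_self]
  · exact fun m _ hm => R.ev_mul_ne _ _ _ _ fun h => hm h.1
  · exact fun h => absurd (Finset.mem_univ _) h

variable [Algebra ℂ A]

/-- The transposed representation `e(p;q) ↦ g(p) / g(q) e(q;p)`. -/
def transpose (R : FaceRep N L A) (t : ℂ) : FaceRep N L A :=
  ofEdges (fun v v' => R.ev v' v)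
    (fun v i v' k => (gauge t v i / gauge t v' k) • R.E v' [k] v [i])
    (fun v v' => R.ev_mul_self v' v)
    (fun v v' u u' h => R.ev_mul_ne _ _ _ _ fun hh => h hh.symm)
    (fun v i v' k => by rw [mul_smul_comm, ev_mul_E_singleton])
    (fun v i v' k => by rw [smul_mul_assoc, E_singleton_mul_ev])
    (fun v i v' k h => by rw [E_singleton_eq_zero R fun hh => h hh.symm, smul_zero])

variable {R : FaceRep N L A} {t ε : ℂ} {Q : Loops N L}

theorem transpose_E (v v' : Vertex N L) (w w' : List (Fin N)) :
    (R.transpose t).E v w v' w' = (gaugeWord t v w / gaugeWord t v' w') • R.E v' w' v w := by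
  by_cases hl : w.length = w'.length
  swap
  · rw [E_eq_zero_of_length _ hl, E_eq_zero_of_length _ (Ne.symm hl), smul_zero]
  induction w generalizing v v' w' with
  | nil =>
    rw [List.length_eq_zero_iff.mp hl.symm, E_nil, E_nil, gaugeWord, gaugeWord, div_one, one_smul]
    rfl
  | cons i w ih =>
    obtain ⟨k, w', rfl⟩ := List.exists_cons_of_length_eq_add_one hl.symm
    rw [E_cons, ih _ _ _ (by simpa using hl), R.E_cons, transpose, ofEdges_E_singleton, gaugeWord,
      gaugeWord, smul_mul_smul_comm, div_mul_div_comm]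

/-- By `wOff_mul_gaugeWord` the gauge factors make the weight symmetric, so exchanging rows and
columns exchanges the two sides of the relation. Reversed words that are no paths contribute zero,
through the symbol or through the weight. -/
theorem transpose_rel (hR : R.Rel t ε) (hP : SOSParams N L t ε) : (R.transpose t).Rel t ε := by
  intro v v' i j k l h
  simp only [transpose_E, smul_smul]
  have hk := hP.gaugeWord_ne_zero v' [k, l]
  have hk' := hP.gaugeWord_ne_zero v' [l, k]
  by_cases hij : Valid v [i, j]
  · have h1 : (wOff t ε v' k l * (gaugeWord t v [i, j] / gaugeWord t v' [l, k])) •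
        R.E v' [l, k] v [i, j] = (gaugeWord t v [i, j] / gaugeWord t v' [k, l]) •
        wOff t ε v' l k • R.E v' [l, k] v [i, j] := by
      rw [smul_smul]
      by_cases hlk : Valid v' [l, k]
      · congr 1
        by_cases hne : k = l
        · simp [wOff, hne]
        · have := hP.wOff_mul_gaugeWord hne h hlk
          field_simp
          linear_combination gaugeWord t v [i, j] * this
      · rw [R.E_eq_zero fun h => hlk h.1, smul_zero, smul_zero]
    have h2 : (wOff t ε v j i * (gaugeWord t v [j, i] / gaugeWord t v' [k, l])) •
        R.E v' [k, l] v [j, i] = (gaugeWord t v [i, j] / gaugeWord t v' [k, l]) •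
        wOff t ε v i j • R.E v' [k, l] v [j, i] := by
      rw [smul_smul]
      by_cases hji : Valid v [j, i]
      · congr 1
        by_cases hne : i = j
        · simp [wOff, hne]
        · have := hP.wOff_mul_gaugeWord hne hij hji
          field_simp
          linear_combination -this
      · rw [R.E_eq_zero fun h => hji h.2, smul_zero, smul_zero]
    rw [h1, h2, mul_comm, mul_smul, ← smul_add, mul_comm (wDiag t v i j), mul_smul, ← smul_add,
      hR v' v k l i j hij]
  · have h3 : (wOff t ε v j i * (gaugeWord t v [j, i] / gaugeWord t v' [k, l])) •
        R.E v' [k, l] v [j, i] = 0 := by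
      by_cases hji : Valid v [j, i]
      · have hne : j ≠ i := by
          rintro rfl
          exact hij hji
        rw [hP.wOff_eq_zero hne hji hij, zero_mul, zero_smul]
      · rw [R.E_eq_zero fun h => hji h.2, smul_zero]
    rw [h3, R.E_eq_zero fun h => hij h.2, R.E_eq_zero fun h => hij h.2]
    simp

/-- The double sum of sgn(q) sgn(w) g(w) e(q;w) over loops q at m and w at l is computed in two
ways. Taking the inner sum over w gives the determinant entry of the transpose times the gauge sum
at m; taking it over q gives a multiple of a vertex symbol with the gauge sum at l. By
`gaugeSum_mul` the scalars match. -/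
theorem IsSOS.transpose (hR : R.IsSOS t ε Q) (hP : SOSParams N L t ε) :
    (R.transpose t).IsSOS t ε Q where
  rel := transpose_rel hR.rel hP
  sum_ev := Finset.sum_comm.trans hR.sum_ev
  det_eq := by
    have hT := transpose_rel hR.rel hP
    rw [← hR.sum_ev, Finset.sum_comm, det]
    refine Finset.sum_congr rfl fun l _ => Finset.sum_congr rfl fun m _ => ?_
    have h1 : wsum N (fun q => (altSign ε Finset.univ q * gaugeWord t m q) •
        (R.transpose t).Phi N (altSign ε Finset.univ) l m q) =
        wsum N (fun w => (altSign ε Finset.univ w * gaugeWord t l w) •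
        R.Phi N (altSign ε Finset.univ) m l w) := by
      simp only [Phi, smul_wsum]
      rw [wsum_comm]
      refine wsum_congr fun w _ => wsum_congr fun q _ => ?_
      rw [transpose_E, smul_smul, smul_smul, smul_smul]
      congr 1
      have := hP.gaugeWord_ne_zero m q
      field_simp
    have h2 : wsum N (fun q => (altSign ε Finset.univ q * gaugeWord t m q) •
        (R.transpose t).Phi N (altSign ε Finset.univ) l m q) =
        gaugeSum t m N Finset.univ • sgn ε (Q.q m) •
          (R.transpose t).Phi N (altSign ε Finset.univ) l m (Q.q m) := by
      let g : ℂ →ₗ[ℂ] A := LinearMap.toSpanSingleton ℂ A (sgn ε (Q.q m) •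
          (R.transpose t).Phi N (altSign ε Finset.univ) l m (Q.q m))
      change _ = g (gaugeSum t m N Finset.univ)
      rw [gaugeSum, map_wsum]
      refine wsum_congr fun q _ => ?_
      simp only [g, LinearMap.toSpanSingleton_apply]
      by_cases h : Valid m q ∧ q.Nodup ∧ q.toFinset = Finset.univ
      · rw [if_pos h, altSign, if_pos h.2, mul_comm, mul_smul,
          hT.Phi_perm hP h.1 (Q.q_valid m) h.2.1 (Q.q_nodup m) (by rw [h.2.2, Q.q_toFinset])]
      · rw [if_neg h, zero_smul]
        by_cases h' : Valid m q
        · rw [altSign, if_neg fun hh => h ⟨h', hh⟩, zero_mul, zero_smul]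
        · rw [Phi_eq_zero_of_not_valid h', smul_zero]
    -- Here `Phi_univ` evaluates the original representation, and the square of the sign is 1.
    have h3 : wsum N (fun w => (altSign ε Finset.univ w * gaugeWord t l w) •
        R.Phi N (altSign ε Finset.univ) m l w) =
        gaugeSum t l N Finset.univ • (qDim t m / qDim t l) • R.ev m l := by
      let g : ℂ →ₗ[ℂ] A := LinearMap.toSpanSingleton ℂ A ((qDim t m / qDim t l) • R.ev m l)
      change _ = g (gaugeSum t l N Finset.univ)
      rw [gaugeSum, map_wsum]
      refine wsum_congr fun w hw => ?_
      simp only [g, LinearMap.toSpanSingleton_apply]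
      by_cases h : Valid l w ∧ w.Nodup ∧ w.toFinset = Finset.univ
      · rw [if_pos h, altSign, if_pos h.2, hR.Phi_univ hP m h.1 h.2.1 hw, smul_smul,
          smul_smul]
        congr 1
        linear_combination (gaugeWord t l w * (qDim t m / qDim t l)) * sgn_mul_self hP.sq w
      · rw [if_neg h, zero_smul]
        by_cases h' : Valid l w
        · rw [altSign, if_neg fun hh => h ⟨h', hh⟩, zero_mul, zero_smul]
        · rw [Phi_eq_zero_of_not_valid h', smul_zero]
    have h4 := h2.symm.trans (h1.trans h3)
    have hZ := hP.gaugeSum_ne_zero m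
    have h5 := hP.qDim_ne_zero m
    have h6 := hP.qDim_ne_zero l
    have h7 := hP.gaugeSum_mul l m
    apply smul_right_injective A hZ
    simp only
    rw [mul_smul, smul_comm, h4, smul_smul, smul_smul]
    congr 1
    field_simp
    linear_combination h7

/-- A right inverse of the matrix of edge symbols. -/
def cofRight (R : FaceRep N L A) (t ε : ℂ) (Q : Loops N L) (l : Vertex N L) (k : Fin N)
    (u : Vertex N L) (i : Fin N) : A :=
  (gauge t l k * qRatio t l k / (gauge t u i * qRatio t u i)) • (R.transpose t).cof t ε Q u i l k

theorem SOSParams.qRatio_ne_zero (hP : SOSParams N L t ε) (u : Vertex N L) (i : Fin N) :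
    qRatio t u i ≠ 0 := div_ne_zero (hP.qDim_ne_zero _) (hP.qDim_ne_zero _)

/-- The relation `mul_cof` for the transpose contracts the index that is wanted here, and the ratios
of D are absorbed, with the gauge factors, into the scalar of `cofRight`. -/
theorem IsSOS.mul_cofRight (hR : R.IsSOS t ε Q) (hP : SOSParams N L t ε) {u v : Vertex N L}
    {i z : Fin N} (hu : Ok u i) (hv : Ok v z) :
    ∑ k, ∑ l, R.E v [z] l [k] * R.cofRight t ε Q l k u i =
      open scoped Classical in if u = v ∧ i = z then ∑ l, R.ev v l else 0 := by
  have hg := hP.gauge_ne_zero v z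
  have hr := SOSParams.qRatio_ne_zero hP u i
  have hg' := hP.gauge_ne_zero u i
  have h1 : ∀ l, ∑ k, R.E v [z] l [k] * R.cofRight t ε Q l k u i =
      open scoped Classical in if u = v ∧ i = z then R.ev v l else 0 := by
    intro l
    have h2 := (hR.transpose hP).mul_cof hP hu hv l
    have h3 : ∑ k, R.E v [z] l [k] * R.cofRight t ε Q l k u i =
        (gauge t v z / (gauge t u i * qRatio t u i)) • ∑ k, qRatio t l k •
          ((R.transpose t).E l [k] v [z] * (R.transpose t).cof t ε Q u i l k) := by
      rw [Finset.smul_sum]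
      refine Finset.sum_congr rfl fun k _ => ?_
      rw [transpose_E, cofRight, mul_smul_comm, smul_mul_assoc, smul_smul, smul_smul]
      congr 1
      simp only [gaugeWord, mul_one]
      field_simp
    rw [h3, h2]
    split_ifs with h
    · obtain ⟨rfl, rfl⟩ := h
      rw [smul_smul, show gauge t u i / (gauge t u i * qRatio t u i) * qRatio t u i = 1 by
        field_simp, one_smul]
      rfl
    · rw [smul_zero]
  rw [Finset.sum_comm]
  simp only [h1]
  split_ifs <;> simp

/-- The usual argument that a left and a right inverse agree: the triple product is evaluated with
both bracketings, the partial units acting as identities on the factors next to them. -/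
theorem IsSOS.cof_eq_cofRight (hR : R.IsSOS t ε Q) (hP : SOSParams N L t ε) {u v : Vertex N L}
    {i z : Fin N} (hu : Ok u i) (hv : Ok v z) :
    R.cof t ε Q u i v z = R.cofRight t ε Q u i v z := by
  classical
  have h1 : ∑ k, ∑ l, R.cof t ε Q u i l k * ∑ a, ∑ b, R.E l [k] b [a] * R.cofRight t ε Q b a v z =
      R.cof t ε Q u i v z := by
    rw [Finset.sum_eq_single z, Finset.sum_eq_single v, hR.mul_cofRight hP hv hv,
      if_pos ⟨rfl, rfl⟩, ← cof_mul_ev, mul_assoc, ev_mul_sum_left]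
    · intro l _ hl
      by_cases hlz : Ok l z
      · rw [hR.mul_cofRight hP hv hlz, if_neg fun h => hl h.1.symm, mul_zero]
      · rw [cof_eq_zero fun h => hlz h.2, zero_mul]
    · exact fun h => absurd (Finset.mem_univ _) h
    · intro k _ hk
      refine Finset.sum_eq_zero fun l _ => ?_
      by_cases hlk : Ok l k
      · rw [hR.mul_cofRight hP hv hlk, if_neg fun h => hk h.2.symm, mul_zero]
      · rw [cof_eq_zero fun h => hlk h.2, zero_mul]
    · exact fun h => absurd (Finset.mem_univ _) h
  have h2 : ∑ a, ∑ b, (∑ k, ∑ l, R.cof t ε Q u i l k * R.E l [k] b [a]) *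
      R.cofRight t ε Q b a v z = R.cofRight t ε Q u i v z := by
    rw [Finset.sum_eq_single i, Finset.sum_eq_single u, hR.cof_mul hP hu hu, if_pos ⟨rfl, rfl⟩,
      cofRight, ← ev_mul_cof, mul_smul_comm, ← mul_assoc]
    · congr 2
      exact R.sum_right_mul_ev _ _
    · intro b _ hb
      by_cases hbi : Ok b i
      · rw [hR.cof_mul hP hu hbi, if_neg fun h => hb h.1.symm, zero_mul]
      · rw [cofRight, cof_eq_zero fun h => hbi h.2, smul_zero, mul_zero]
    · exact fun h => absurd (Finset.mem_univ _) h
    · intro a _ ha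
      refine Finset.sum_eq_zero fun b _ => ?_
      by_cases hba : Ok b a
      · rw [hR.cof_mul hP hu hba, if_neg fun h => ha h.2.symm, zero_mul]
      · rw [cofRight, cof_eq_zero fun h => hba h.2, smul_zero, mul_zero]
    · exact fun h => absurd (Finset.mem_univ _) h
  rw [← h1, ← h2]
  simp only [Finset.mul_sum, Finset.sum_mul, mul_assoc]
  exact sum_comm_four _

/-- The cofactors form a right inverse of the matrix of edge symbols. -/
theorem IsSOS.mul_cof_right (hR : R.IsSOS t ε Q) (hP : SOSParams N L t ε) {u v : Vertex N L}
    {i z : Fin N} (hu : Ok u i) (hv : Ok v z) :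
    ∑ k, ∑ l, R.E v [z] l [k] * R.cof t ε Q l k u i =
      open scoped Classical in if u = v ∧ i = z then ∑ l, R.ev v l else 0 := by
  rw [← hR.mul_cofRight hP hu hv]
  refine Finset.sum_congr rfl fun k _ => Finset.sum_congr rfl fun l _ => ?_
  by_cases h : Ok l k
  · rw [hR.cof_eq_cofRight hP h hu]
  · rw [E_singleton_eq_zero R fun hh => h hh.2, zero_mul, zero_mul]

end FaceRep

/-! ### Paths and words -/

section Paths

variable {N L : ℕ}

/-- The sequence of indices of a walk. -/
def letters (p : (sosGraph N L).Walk) : List (Fin N) := p.edges.map Edge.index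

theorem letters_length (p : (sosGraph N L).Walk) : (letters p).length = p.length :=
  List.length_map _

theorem indices_length {m : ℕ} (p : (sosGraph N L).Path m) : (indices p).length = m :=
  (letters_length p.1).trans p.2

/-- The edge `(v | i)`. -/
def mkEdge (v : Vertex N L) (i : Fin N) (h : Ok v i) : Edge N L := ⟨(v, i, act v i), isStep_act h⟩

theorem edge_ok (a : Edge N L) : Ok ((sosGraph N L).s a) a.index := ⟨_, a.2⟩

theorem act_edge (a : Edge N L) : act ((sosGraph N L).s a) a.index = (sosGraph N L).r a :=
  (isStep_iff.mp a.2).2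

theorem edge_ext {a b : Edge N L} (h : (sosGraph N L).s a = (sosGraph N L).s b)
    (hi : a.index = b.index) : a = b := by
  have h1 := act_edge a
  rw [h, hi, act_edge] at h1
  exact Subtype.ext (Prod.ext h (Prod.ext hi h1.symm))

theorem valid_of_isWalk {v : Vertex N L} {l : List (Edge N L)} (h : (sosGraph N L).IsWalk v l) :
    Valid v (l.map Edge.index) ∧ run v (l.map Edge.index) = (sosGraph N L).endpoint v l := by
  induction l generalizing v with
  | nil => exact ⟨trivial, rfl⟩
  | cons a l ih =>
    obtain ⟨rfl, h⟩ := h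
    have := ih h
    rw [← act_edge a] at this
    exact ⟨⟨edge_ok a, this.1⟩, by
      rw [act_edge] at this
      rw [List.map_cons, run, act_edge]
      exact this.2⟩

theorem isWalk_unique {v : Vertex N L} {l l' : List (Edge N L)} (h : (sosGraph N L).IsWalk v l)
    (h' : (sosGraph N L).IsWalk v l') (hl : l.map Edge.index = l'.map Edge.index) : l = l' := by
  induction l generalizing v l' with
  | nil => rw [List.map_nil] at hl; exact (List.map_eq_nil_iff.mp hl.symm).symm
  | cons a l ih =>
    cases l' with
    | nil => simp at hl
    | cons a' l' =>
      rw [List.map_cons, List.map_cons, List.cons.injEq] at hl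
      obtain rfl := edge_ext (h.1.trans h'.1.symm) hl.1
      rw [ih h.2 h'.2 hl.2]

theorem exists_isWalk {v : Vertex N L} {w : List (Fin N)} (h : Valid v w) :
    ∃ l : List (Edge N L), (sosGraph N L).IsWalk v l ∧ l.map Edge.index = w := by
  induction w generalizing v with
  | nil => exact ⟨[], trivial, rfl⟩
  | cons i w ih =>
    obtain ⟨l, hl, rfl⟩ := ih h.2
    exact ⟨mkEdge v i h.1 :: l, ⟨rfl, hl⟩, rfl⟩

theorem walk_valid (p : (sosGraph N L).Walk) : Valid p.source (letters p) :=
  (valid_of_isWalk p.isWalk).1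

theorem run_letters (p : (sosGraph N L).Walk) : run p.source (letters p) = p.range :=
  (valid_of_isWalk p.isWalk).2

theorem walk_ext {p q : (sosGraph N L).Walk} (h : p.source = q.source)
    (h' : letters p = letters q) : p = q :=
  Walk.ext h (isWalk_unique p.isWalk (h ▸ q.isWalk) h')

theorem path_valid {m : ℕ} (p : (sosGraph N L).Path m) : Valid p.source (indices p) :=
  walk_valid p.1

theorem run_indices {m : ℕ} (p : (sosGraph N L).Path m) : run p.source (indices p) = p.range :=
  run_letters p.1

theorem path_ext {m : ℕ} {p q : (sosGraph N L).Path m} (h : p.source = q.source)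
    (h' : indices p = indices q) : p = q := Subtype.ext (walk_ext h h')

theorem exists_path {v : Vertex N L} {w : List (Fin N)} (h : Valid v w) {m : ℕ}
    (hm : w.length = m) : ∃ p : (sosGraph N L).Path m, p.source = v ∧ indices p = w := by
  obtain ⟨l, hl, rfl⟩ := exists_isWalk h
  exact ⟨⟨⟨v, l, hl⟩, (List.length_map _).symm.trans hm⟩, rfl, rfl⟩

theorem wsum_eq_sum {M : Type*} [AddCommMonoid M] (m : ℕ) (F : List (Fin N) → M) :
    wsum m F = ∑ w ∈ (List.finite_length_eq (Fin N) m).toFinset, F w := by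
  induction m generalizing F with
  | zero =>
    rw [Finset.sum_eq_single []]
    · rfl
    · intro w hw hne
      simp at hw
      exact absurd hw hne
    · simp
  | succ m ih =>
    rw [wsum]
    simp only [ih]
    rw [← Finset.sum_product']
    refine Finset.sum_bij (fun x _ => x.1 :: x.2) ?_ ?_ ?_ ?_
    · intro x hx
      simpa using hx
    · intro x _ y _ h
      exact Prod.ext (List.cons.inj h).1 (List.cons.inj h).2
    · intro w hw
      have hw' : w.length = m + 1 := by simpa using hw
      obtain ⟨i, u, rfl⟩ := List.exists_cons_of_length_eq_add_one hw'
      exact ⟨(i, u), by simpa using hw', rfl⟩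
    · exact fun _ _ => rfl

/-- Paths correspond to pairs of a vertex and a valid word, and invalid words contribute zero. -/
theorem sum_path {M : Type*} [AddCommMonoid M] (m : ℕ) (F : Vertex N L → List (Fin N) → M)
    (hF : ∀ v w, ¬ Valid v w → F v w = 0) :
    ∑ p : (sosGraph N L).Path m, F p.source (indices p) = ∑ v, wsum m (F v) := by
  classical
  simp only [wsum_eq_sum]
  rw [← Finset.sum_product']
  refine Finset.sum_bij_ne_zero (fun p _ _ => (p.source, indices p)) ?_ ?_ ?_ ?_
  · intro p _ _
    simpa using indices_length p
  · intro p _ _ q _ _ h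
    exact path_ext (congrArg Prod.fst h) (congrArg Prod.snd h)
  · rintro ⟨v, w⟩ hx hne
    have hw : w.length = m := by simpa using hx
    obtain ⟨p, rfl, rfl⟩ := exists_path (by_contra fun h => hne (hF v w h)) hw
    exact ⟨p, Finset.mem_univ _, hne, rfl⟩
  · exact fun _ _ _ => rfl

theorem countP_eq_sum {α : Type*} (p : α → Prop) [DecidablePred p] (w : List α) :
    w.countP (fun j => p j) = ∑ x : Fin w.length, if p w[x] then 1 else 0 := by
  induction w with
  | nil => rfl
  | cons i w ih =>
    simp only [List.length_cons]
    rw [Fin.sum_univ_succ, List.countP_cons, ih, add_comm]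
    simp
    rfl

theorem sgn_eq_pow (ε : ℂ) (w : List (Fin N)) : sgn ε w = (-ε) ^
    (Finset.univ.filter fun x : Fin w.length × Fin w.length =>
      x.1 < x.2 ∧ w.get x.1 < w.get x.2).card := by
  induction w with
  | nil => simp [sgn]
  | cons i w ih =>
    rw [sgn, ih, ← pow_add]
    congr 1
    rw [Finset.card_filter, Finset.card_filter, ← Finset.univ_product_univ,
      ← Finset.univ_product_univ, Finset.sum_product, Finset.sum_product]
    simp only [List.length_cons]
    rw [Fin.sum_univ_succ, Fin.sum_univ_succ]
    simp only [Fin.sum_univ_succ (n := w.length), List.get_eq_getElem, Fin.val_zero, Fin.val_succ,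
      List.getElem_cons_zero, List.getElem_cons_succ, lt_irrefl, false_and, if_false, zero_add,
      Fin.succ_pos, true_and, Fin.succ_lt_succ_iff, Fin.not_lt_zero, and_false]
    congr 1
    exact countP_eq_sum _ w

theorem sgn_indices (ε : ℂ) {m : ℕ} (p : (sosGraph N L).Path m) :
    sgn ε (indices p) = (-ε) ^ ell p := sgn_eq_pow ε _

/-- A path of length `N` is closed if and only if its indices are distinct. -/
theorem run_eq_iff_nodup {v : Vertex N L} {w : List (Fin N)} (h : Valid v w) (hw : w.length = N) :
    run v w = v ↔ w.Nodup := by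
  constructor
  · intro hr
    have hc : ∀ a b, w.count a = w.count b := fun a b => by
      have := dist_run h a b
      rw [hr] at this
      omega
    rw [List.nodup_iff_count_le_one]
    intro a
    -- On a closed path all letters occur equally often; if one occurred twice, the length would be
    -- at least 2N.
    by_contra ha
    have h1 : ∑ b : Fin N, w.count b = w.length := by
      rw [← List.sum_toFinset_count_eq_length]
      symm
      refine Finset.sum_subset (Finset.subset_univ _) fun b _ hb => ?_
      rw [List.count_eq_zero]
      simpa using hb
    have h2 : ∑ b : Fin N, w.count b = N * w.count a := by
      rw [Finset.sum_congr rfl fun b _ => hc b a]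
      simp
    have h3 : 0 < N := Fin.pos a
    rw [h1, hw] at h2
    nlinarith
  · intro hn
    refine Vertex.ext_dist fun a b => ?_
    rw [dist_run h, count_eq_ite hn, count_eq_ite hn, toFinset_eq_univ hn hw]
    simp

/-- Preceded by the edge itself, a return path becomes a loop of length N, to which
`run_eq_iff_nodup` applies. -/
theorem run_act_eq_iff {u : Vertex N L} {i : Fin N} (hi : Ok u i) {w : List (Fin N)}
    (h : Valid (act u i) w) (hw : w.length = N - 1) :
    run (act u i) w = u ↔ w.Nodup ∧ w.toFinset = Finset.univ.erase i := by
  have hi' := i.2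
  have hl : (i :: w).length = N := by rw [List.length_cons]; omega
  have h1 := run_eq_iff_nodup (v := u) (w := i :: w) ⟨hi, h⟩ hl
  rw [run] at h1
  rw [h1, ← nodup_cons_and_toFinset w i Finset.univ (Finset.mem_univ i)]
  exact ⟨fun hn => ⟨hn, toFinset_eq_univ hn hl⟩, fun hn => hn.1⟩

-- For k = l both conditions on `q` coincide; the convention that `wOff` is zero there prevents
-- double counting.
open scoped Classical in
theorem boltzmann_eq (t ε ζ : ℂ) (q p : (sosGraph N L).Path 2) (k l : Fin N)
    (h : indices p = [k, l]) : boltzmann t ε ζ q p = if q.source = p.source then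
      (if indices q = [k, l] then ζ⁻¹ * wDiag t p.source k l else 0) +
      (if indices q = [l, k] then ζ⁻¹ * wOff t ε p.source k l else 0) else 0 := by
  rw [boltzmann, Finset.sum_eq_single k, Finset.sum_eq_single l]
  · by_cases hs : q.source = p.source
    · rw [if_pos ⟨h, hs⟩, if_pos hs]
      by_cases hkl : k = l
      · simp [hkl, wDiag, wOff]
      · rw [if_neg hkl, wDiag, wOff, if_neg hkl, if_neg hkl]
        by_cases h1 : indices q = [k, l]
        · have h2 : ¬ indices q = [l, k] := fun h2 => hkl (by
            rw [h1] at h2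
            exact (List.cons.inj h2).1)
          rw [if_pos h1, if_pos h1, if_neg h2]
          ring
        · rw [if_neg h1, if_neg h1, zero_add]
          congr 1
          ring
    · rw [if_neg fun hh => hs hh.2, if_neg hs]
  · intro j _ hj
    rw [if_neg]
    rintro ⟨h1, -⟩
    rw [h] at h1
    simp only [List.cons.injEq] at h1
    exact hj h1.2.1.symm
  · exact fun h => absurd (Finset.mem_univ _) h
  · intro i _ hi
    refine Finset.sum_eq_zero fun j _ => if_neg ?_
    rintro ⟨h1, -⟩
    rw [h] at h1
    simp only [List.cons.injEq] at h1
    exact hi h1.1.symm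
  · exact fun h => absurd (Finset.mem_univ _) h

theorem wsum_two {M : Type*} [AddCommMonoid M] (F : List (Fin N) → M) :
    wsum 2 F = ∑ i, ∑ j, F [i, j] := rfl

theorem indices_eq (p : (sosGraph N L).Path 2) : ∃ k l, indices p = [k, l] :=
  List.length_eq_two.mp (indices_length p)

theorem sum_boltzmann_left {M : Type*} [AddCommGroup M] [Module ℂ M] (t ε ζ : ℂ)
    (F : Vertex N L → List (Fin N) → M) (hF : ∀ v w, ¬ Valid v w → F v w = 0)
    (p : (sosGraph N L).Path 2) (k l : Fin N) (h : indices p = [k, l]) :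
    ∑ r, boltzmann t ε ζ r p • F r.source (indices r) =
      ζ⁻¹ • (wDiag t p.source k l • F p.source [k, l] + wOff t ε p.source k l •
        F p.source [l, k]) := by
  classical
  simp only [boltzmann_eq t ε ζ _ p k l h]
  rw [sum_path 2 (fun v w => (if v = p.source then
      (if w = [k, l] then ζ⁻¹ * wDiag t p.source k l else 0) +
      (if w = [l, k] then ζ⁻¹ * wOff t ε p.source k l else 0) else 0) • F v w)
      (fun v w hvw => by rw [hF v w hvw, smul_zero]),
    Finset.sum_eq_single p.source]
  · simp only [if_true, add_smul, wsum_two, Finset.sum_add_distrib, ite_smul, zero_smul,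
      List.cons.injEq, and_true, ite_and, smul_add, mul_smul]
    simp [Finset.sum_ite_eq']
  · intro v _ hv
    simp only [if_neg hv, zero_smul, wsum_zero]
  · exact fun h => absurd (Finset.mem_univ _) h

theorem sum_boltzmann_right {M : Type*} [AddCommGroup M] [Module ℂ M] (t ε ζ : ℂ)
    (F : Vertex N L → List (Fin N) → M) (hF : ∀ v w, ¬ Valid v w → F v w = 0)
    (a : (sosGraph N L).Path 2) (i j : Fin N) (h : indices a = [i, j]) :
    ∑ c, boltzmann t ε ζ a c • F c.source (indices c) =
      ζ⁻¹ • (wDiag t a.source i j • F a.source [i, j] + wOff t ε a.source j i •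
        F a.source [j, i]) := by
  classical
  have h1 : ∀ c : (sosGraph N L).Path 2, boltzmann t ε ζ a c = if c.source = a.source then
      (if indices c = [i, j] then ζ⁻¹ * wDiag t a.source i j else 0) +
      (if indices c = [j, i] then ζ⁻¹ * wOff t ε a.source j i else 0) else 0 := by
    intro c
    obtain ⟨k, l, hc⟩ := indices_eq c
    rw [boltzmann_eq t ε ζ a c k l hc, hc, h]
    by_cases hs : c.source = a.source
    · rw [if_pos hs, if_pos hs.symm, hs]
      congr 1
      · by_cases hh : [i, j] = [k, l]
        · rw [if_pos hh, if_pos hh.symm]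
          simp only [List.cons.injEq, and_true] at hh
          rw [hh.1, hh.2]
        · rw [if_neg hh, if_neg (Ne.symm hh)]
      · by_cases hh : [i, j] = [l, k]
        · simp only [List.cons.injEq, and_true] at hh
          rw [if_pos (by rw [hh.1, hh.2]), if_pos (by rw [hh.1, hh.2]), hh.1, hh.2]
        · rw [if_neg hh, if_neg]
          simp only [List.cons.injEq, and_true] at hh ⊢
          exact fun h => hh ⟨h.2.symm, h.1.symm⟩
    · rw [if_neg hs, if_neg (Ne.symm hs)]
  simp only [h1]
  rw [sum_path 2 (fun v w => (if v = a.source then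
      (if w = [i, j] then ζ⁻¹ * wDiag t a.source i j else 0) +
      (if w = [j, i] then ζ⁻¹ * wOff t ε a.source j i else 0) else 0) • F v w)
      (fun v w hvw => by rw [hF v w hvw, smul_zero]),
    Finset.sum_eq_single a.source]
  · simp only [if_true, add_smul, wsum_two, Finset.sum_add_distrib, ite_smul, zero_smul,
      List.cons.injEq, and_true, ite_and, smul_add, mul_smul]
    simp [Finset.sum_ite_eq']
  · intro v _ hv
    simp only [if_neg hv, zero_smul, wsum_zero]
  · exact fun h => absurd (Finset.mem_univ _) h

end Paths

/-! ### Homomorphisms from the path algebra -/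

namespace FaceRep

variable {N L : ℕ} {A : Type*} [Ring A] [Algebra ℂ A]

/-- The linear map `e(p;q) ↦ E(p;q)`. It is multiplicative. -/
def hom (R : FaceRep N L A) : PathFaceAlgebra ℂ (sosGraph N L) →ₗ[ℂ] A :=
  PathFaceAlgebra.lift ℂ fun x => R.E x.1.1.source (letters x.1.1) x.1.2.source (letters x.1.2)

variable (R : FaceRep N L A)

theorem hom_basisElt (x : (sosGraph N L).PathPair) : R.hom (PathFaceAlgebra.basisElt ℂ x) =
    R.E x.1.1.source (letters x.1.1) x.1.2.source (letters x.1.2) :=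
  PathFaceAlgebra.lift_basisElt ℂ _ x

theorem hom_e {m : ℕ} (p q : (sosGraph N L).Path m) :
    R.hom (PathFaceAlgebra.e ℂ p q) = R.E p.source (indices p) q.source (indices q) :=
  R.hom_basisElt _

theorem hom_mulBasis (x y : (sosGraph N L).PathPair) :
    R.hom (PathFaceAlgebra.mulBasis ℂ x y) =
      R.hom (PathFaceAlgebra.basisElt ℂ x) * R.hom (PathFaceAlgebra.basisElt ℂ y) := by
  rw [PathFaceAlgebra.mulBasis, hom_basisElt, hom_basisElt]
  have h1 := run_letters x.1.1
  have h2 := run_letters x.1.2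
  by_cases h : x.Composable y
  · rw [dif_pos h, hom_basisElt]
    have h3 : letters (x.append y h).1.1 = letters x.1.1 ++ letters y.1.1 := List.map_append
    have h4 : letters (x.append y h).1.2 = letters x.1.2 ++ letters y.1.2 := List.map_append
    rw [h3, h4, R.E_append (by rw [letters_length, letters_length, x.2])]
    change R.E x.1.1.source _ x.1.2.source _ * _ = _
    congr 2
    · exact h1.trans h.1
    · exact h2.trans h.2
  · rw [dif_neg h, map_zero, E.eq_def R y.1.1.source, ← mul_assoc, E_mul_ev_ne, zero_mul]
    rw [h1, h2]
    exact h

theorem hom_mul (a b : PathFaceAlgebra ℂ (sosGraph N L)) :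
    R.hom (a * b) = R.hom a * R.hom b := by
  have h1 : ∀ x, R.hom ∘ₗ PathFaceAlgebra.mulLin ℂ _ (PathFaceAlgebra.basisElt ℂ x) =
      LinearMap.mulLeft ℂ (R.hom (PathFaceAlgebra.basisElt ℂ x)) ∘ₗ R.hom := fun x =>
    PathFaceAlgebra.hom_ext fun y => by
      rw [LinearMap.comp_apply, ← PathFaceAlgebra.mul_def, PathFaceAlgebra.basisElt_mul,
        hom_mulBasis]
      rfl
  have h2 : R.hom ∘ₗ (PathFaceAlgebra.mulLin ℂ _).flip b =
      LinearMap.mulRight ℂ (R.hom b) ∘ₗ R.hom :=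
    PathFaceAlgebra.hom_ext fun x => LinearMap.congr_fun (h1 x) b
  exact LinearMap.congr_fun h2 a

theorem hom_one : R.hom 1 = ∑ l, ∑ m, R.ev l m := by
  rw [PathFaceAlgebra.one_def, map_sum]
  refine Finset.sum_congr rfl fun l _ => ?_
  rw [map_sum]
  refine Finset.sum_congr rfl fun m _ => ?_
  rw [hom_basisElt]
  exact R.E_nil l m

/-- The generators of the ideal that defines `A(w)`. -/
def _root_.FaceAlgebra.frtGen (t ε ζ : ℂ) (p a : (sosGraph N L).Path 2) :
    PathFaceAlgebra ℂ (sosGraph N L) :=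
  ∑ r, boltzmann t ε ζ r p • PathFaceAlgebra.e ℂ a r -
    ∑ c, boltzmann t ε ζ a c • PathFaceAlgebra.e ℂ c p

theorem hom_frtGen (t ε ζ : ℂ) (p a : (sosGraph N L).Path 2) (i j k l : Fin N)
    (hp : indices p = [k, l]) (ha : indices a = [i, j]) : R.hom (frtGen t ε ζ p a) =
      ζ⁻¹ • (wDiag t p.source k l • R.E a.source [i, j] p.source [k, l] +
        wOff t ε p.source k l • R.E a.source [i, j] p.source [l, k]) -
      ζ⁻¹ • (wDiag t a.source i j • R.E a.source [i, j] p.source [k, l] +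
        wOff t ε a.source j i • R.E a.source [j, i] p.source [k, l]) := by
  rw [frtGen, map_sub, map_sum, map_sum]
  simp only [map_smul, hom_e]
  rw [sum_boltzmann_left t ε ζ (fun v w => R.E a.source (indices a) v w)
      (fun v w h => R.E_eq_zero fun h' => h h'.2) p k l hp,
    sum_boltzmann_right t ε ζ (fun v w => R.E v w p.source (indices p))
      (fun v w h => R.E_eq_zero fun h' => h h'.1) a i j ha, hp, ha]

variable {R}

theorem Rel.hom_frtGen_eq_zero {t ε : ℂ} (hR : R.Rel t ε) (ζ : ℂ)
    (p a : (sosGraph N L).Path 2) : R.hom (frtGen t ε ζ p a) = 0 := by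
  obtain ⟨k, l, hp⟩ := indices_eq p
  obtain ⟨i, j, ha⟩ := indices_eq a
  have hv := path_valid p
  rw [hp] at hv
  rw [hom_frtGen R t ε ζ p a i j k l hp ha, hR _ _ i j k l hv, sub_self]

/-- `Rel` also covers rows (i, j) that are no paths, where no generator is available; there both
sides vanish because the off-diagonal coefficient does. The common factor ζ⁻¹ is cancelled. -/
theorem rel_of_hom_frtGen {t ε ζ : ℂ} (hP : SOSParams N L t ε) (hζ : ζ ≠ 0)
    (h : ∀ p a, R.hom (frtGen t ε ζ p a) = 0) : R.Rel t ε := by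
  intro v v' i j k l hv'
  by_cases hv : Valid v [i, j]
  · obtain ⟨p, rfl, hp⟩ := exists_path hv' (m := 2) rfl
    obtain ⟨a, rfl, ha⟩ := exists_path hv (m := 2) rfl
    have h1 := h p a
    rw [hom_frtGen R t ε ζ p a i j k l hp ha, sub_eq_zero] at h1
    exact smul_right_injective A (inv_ne_zero hζ) h1
  · have h1 : wOff t ε v j i • R.E v [j, i] v' [k, l] = 0 := by
      by_cases hji : Valid v [j, i]
      · have hne : j ≠ i := by
          rintro rfl
          exact hv hji
        rw [hP.wOff_eq_zero hne hji hv, zero_smul]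
      · rw [R.E_eq_zero fun h => hji h.1, smul_zero]
    rw [h1, R.E_eq_zero fun h => hv h.1, R.E_eq_zero fun h => hv h.1]
    simp

end FaceRep

/-! ### The quantum determinant -/

section Det

variable {N L : ℕ}

open scoped Classical in
/-- The loops chosen in the definition of the determinant, and some returning paths. -/
def sosLoops (hN : 2 ≤ N) (hL : 2 ≤ L) : Loops N L where
  q v := indices (exists_loop (by omega) (by omega) v : (pathsBetween (sosGraph N L) N v v).Nonempty).choose
  q_valid v := by
    have h := (exists_loop (by omega) (by omega) v :
      (pathsBetween (sosGraph N L) N v v).Nonempty).choose_spec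
    have h1 := (mem_pathsBetween.mp h).1
    have := path_valid (exists_loop (by omega) (by omega) v :
      (pathsBetween (sosGraph N L) N v v).Nonempty).choose
    rwa [h1] at this
  q_nodup v := by
    have h := (exists_loop (by omega) (by omega) v :
      (pathsBetween (sosGraph N L) N v v).Nonempty).choose_spec
    have h1 := mem_pathsBetween.mp h
    rw [← run_eq_iff_nodup (path_valid _) (indices_length _), run_indices, h1.1, h1.2]
  q_toFinset v := by
    have h := (exists_loop (by omega) (by omega) v :
      (pathsBetween (sosGraph N L) N v v).Nonempty).choose_spec
    have h1 := mem_pathsBetween.mp h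
    refine toFinset_eq_univ ?_ (indices_length _)
    rw [← run_eq_iff_nodup (path_valid _) (indices_length _), run_indices, h1.1, h1.2]
  b v i := if h : Ok v i then indices (exists_return hN (mkEdge v i h)).choose else []
  b_valid v i h := by
    rw [dif_pos h]
    have h1 := (mem_pathsBetween.mp (exists_return hN (mkEdge v i h)).choose_spec).1
    have := path_valid (exists_return hN (mkEdge v i h)).choose
    rw [h1] at this
    exact this
  b_nodup v i h := by
    rw [dif_pos h]
    have h1 := mem_pathsBetween.mp (exists_return hN (mkEdge v i h)).choose_spec
    have h2 := path_valid (exists_return hN (mkEdge v i h)).choose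
    have h3 := run_indices (exists_return hN (mkEdge v i h)).choose
    rw [h1.2, h1.1] at h3
    rw [h1.1] at h2
    exact ((run_act_eq_iff h h2 (indices_length _)).mp h3).1
  b_toFinset v i h := by
    rw [dif_pos h]
    have h1 := mem_pathsBetween.mp (exists_return hN (mkEdge v i h)).choose_spec
    have h2 := path_valid (exists_return hN (mkEdge v i h)).choose
    have h3 := run_indices (exists_return hN (mkEdge v i h)).choose
    rw [h1.2, h1.1] at h3
    rw [h1.1] at h2
    exact ((run_act_eq_iff h h2 (indices_length _)).mp h3).2

/-- A lift of the quantum determinant to the path algebra. -/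
def detLift (hN : 2 ≤ N) (hL : 2 ≤ L) (t ε : ℂ) : PathFaceAlgebra ℂ (sosGraph N L) :=
  ∑ l, ∑ m, (qDim t m / qDim t l) • ∑ p ∈ pathsBetween (sosGraph N L) N l l,
    (-ε) ^ (ell p + ell (exists_loop (by omega) (by omega) m :
      (pathsBetween (sosGraph N L) N m m).Nonempty).choose) •
      PathFaceAlgebra.e ℂ p (exists_loop (by omega) (by omega) m :
        (pathsBetween (sosGraph N L) N m m).Nonempty).choose

theorem mk_detLift (hN : 2 ≤ N) (hL : 2 ≤ L) (t ε ζ : ℂ) :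
    Ideal.Quotient.mk (frtIdeal (sosGraph N L) (boltzmann t ε ζ)) (detLift hN hL t ε) =
      qDet N L t ε ζ := by
  rw [← Ideal.Quotient.mkₐ_eq_mk ℂ, detLift, qDet, map_sum]
  refine Finset.sum_congr rfl fun l _ => ?_
  rw [map_sum]
  refine Finset.sum_congr rfl fun m _ => ?_
  rw [detEntry, dif_pos (exists_loop (by omega) (by omega) m), map_smul, map_sum]
  rfl

/-- Closed paths of length N are the valid orderings of all letters, so the sum in the definition of
the determinant is an alternating sum over words. -/
theorem sum_pathsBetween {M : Type*} [AddCommMonoid M] [Module ℂ M] (ε : ℂ) (l : Vertex N L)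
    (F : Vertex N L → List (Fin N) → M) (hF : ∀ v w, ¬ Valid v w → F v w = 0) :
    ∑ p ∈ pathsBetween (sosGraph N L) N l l, (-ε) ^ ell p • F p.source (indices p) =
      wsum N fun w => altSign ε Finset.univ w • F l w := by
  classical
  rw [pathsBetween, Finset.sum_filter]
  have h1 : ∀ p : (sosGraph N L).Path N, (if p.source = l ∧ p.range = l then
      (-ε) ^ ell p • F p.source (indices p) else 0) =
      if p.source = l then altSign ε Finset.univ (indices p) • F p.source (indices p) else 0 := by
    intro p
    by_cases hs : p.source = l
    · have h2 := run_eq_iff_nodup (path_valid p) (indices_length p)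
      rw [run_indices, hs] at h2
      rw [if_pos hs, altSign, sgn_indices]
      by_cases hr : p.range = l
      · rw [if_pos ⟨hs, hr⟩, if_pos ⟨h2.mp hr, toFinset_eq_univ (h2.mp hr) (indices_length p)⟩]
      · rw [if_neg fun h => hr h.2, if_neg fun h => hr (h2.mpr h.1), zero_smul]
    · rw [if_neg hs, if_neg fun h => hs h.1]
  simp only [h1]
  rw [sum_path N (fun v w => if v = l then altSign ε Finset.univ w • F v w else 0)
    (fun v w h => by rw [hF v w h, smul_zero, ite_self]), Finset.sum_eq_single l]
  · simp
  · intro v _ hv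
    simp only [if_neg hv, wsum_zero]
  · exact fun h => absurd (Finset.mem_univ _) h

theorem sum_pathsBetween_return {M : Type*} [AddCommMonoid M] [Module ℂ M] (ε : ℂ)
    {u : Vertex N L} {i : Fin N} (hu : Ok u i)
    (F : Vertex N L → List (Fin N) → M) (hF : ∀ v w, ¬ Valid v w → F v w = 0) :
    ∑ p ∈ pathsBetween (sosGraph N L) (N - 1) (act u i) u, (-ε) ^ ell p • F p.source (indices p) =
      wsum (N - 1) fun w => altSign ε (Finset.univ.erase i) w • F (act u i) w := by
  classical
  rw [pathsBetween, Finset.sum_filter]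
  have h1 : ∀ p : (sosGraph N L).Path (N - 1), (if p.source = act u i ∧ p.range = u then
      (-ε) ^ ell p • F p.source (indices p) else 0) =
      if p.source = act u i then
        altSign ε (Finset.univ.erase i) (indices p) • F p.source (indices p) else 0 := by
    intro p
    by_cases hs : p.source = act u i
    · have h2 := path_valid p
      have h3 := run_indices p
      rw [hs] at h2 h3
      have h4 := run_act_eq_iff hu h2 (indices_length p)
      rw [h3] at h4
      rw [if_pos hs, altSign, sgn_indices]
      by_cases hr : p.range = u
      · rw [if_pos ⟨hs, hr⟩, if_pos (h4.mp hr)]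
      · rw [if_neg fun h => hr h.2, if_neg fun h => hr (h4.mpr h), zero_smul]
    · rw [if_neg hs, if_neg fun h => hs h.1]
  simp only [h1]
  rw [sum_path (N - 1)
    (fun v w => if v = act u i then altSign ε (Finset.univ.erase i) w • F v w else 0)
    (fun v w h => by rw [hF v w h, smul_zero, ite_self]), Finset.sum_eq_single (act u i)]
  · simp
  · intro v _ hv
    simp only [if_neg hv, wsum_zero]
  · exact fun h => absurd (Finset.mem_univ _) h

theorem FaceRep.hom_detLift {A : Type*} [Ring A] [Algebra ℂ A] (R : FaceRep N L A)
    (hN : 2 ≤ N) (hL : 2 ≤ L) (t ε : ℂ) :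
    R.hom (detLift hN hL t ε) = R.det t ε (sosLoops hN hL) := by
  rw [detLift, FaceRep.det, map_sum]
  refine Finset.sum_congr rfl fun l _ => ?_
  rw [map_sum]
  refine Finset.sum_congr rfl fun m _ => ?_
  rw [map_smul, map_sum, mul_smul]
  congr 1
  have hq := (exists_loop (by omega) (by omega) m :
    (pathsBetween (sosGraph N L) N m m).Nonempty).choose_spec
  have hs := (mem_pathsBetween.mp hq).1
  rw [Phi, ← sum_pathsBetween ε l (fun v w => R.E v w m ((sosLoops hN hL).q m))
    (fun v w h => R.E_eq_zero fun h' => h h'.1), Finset.smul_sum]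
  refine Finset.sum_congr rfl fun p _ => ?_
  rw [map_smul, hom_e, hs, smul_smul, pow_add, mul_comm, ← sgn_indices]
  rfl

end Det

/-! ### The canonical representation in the `SU(N)_L`-SOS algebra -/

section Canonical

variable {N L : ℕ}

/-- The projection from the path algebra to the `SU(N)_L`-SOS algebra. -/
def sosProj (N L : ℕ) (t ε ζ : ℂ) : PathFaceAlgebra ℂ (sosGraph N L) →ₐ[ℂ] SOSAlgebra N L t ε ζ :=
  (Ideal.Quotient.mkₐ ℂ (detIdeal N L t ε ζ)).comp
    (Ideal.Quotient.mkₐ ℂ (frtIdeal (sosGraph N L) (boltzmann t ε ζ)))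

theorem sosProj_e (t ε ζ : ℂ) {m : ℕ} (p q : (sosGraph N L).Path m) :
    sosProj N L t ε ζ (PathFaceAlgebra.e ℂ p q) = sosE t ε ζ p q := rfl

theorem sosProj_surjective (t ε ζ : ℂ) : Function.Surjective (sosProj N L t ε ζ) :=
  (Ideal.Quotient.mkₐ_surjective ℂ _).comp (Ideal.Quotient.mkₐ_surjective ℂ _)

theorem sosProj_frtGen (t ε ζ : ℂ) (p a : (sosGraph N L).Path 2) :
    sosProj N L t ε ζ (frtGen t ε ζ p a) = 0 := by
  have : Ideal.Quotient.mk (frtIdeal (sosGraph N L) (boltzmann t ε ζ)) (frtGen t ε ζ p a) = 0 := by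
    rw [Ideal.Quotient.eq_zero_iff_mem, frtIdeal, TwoSidedIdeal.mem_asIdeal]
    exact TwoSidedIdeal.subset_span ⟨p, a, rfl⟩
  rw [sosProj, AlgHom.comp_apply, Ideal.Quotient.mkₐ_eq_mk, Ideal.Quotient.mkₐ_eq_mk, this,
    map_zero]

theorem sosProj_detLift (hN : 2 ≤ N) (hL : 2 ≤ L) (t ε ζ : ℂ) :
    sosProj N L t ε ζ (detLift hN hL t ε) = 1 := by
  rw [sosProj, AlgHom.comp_apply, Ideal.Quotient.mkₐ_eq_mk, Ideal.Quotient.mkₐ_eq_mk, mk_detLift,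
    ← sub_eq_zero, ← map_one (Ideal.Quotient.mk (detIdeal N L t ε ζ)), ← map_sub,
    Ideal.Quotient.eq_zero_iff_mem, detIdeal, TwoSidedIdeal.mem_asIdeal]
  exact TwoSidedIdeal.subset_span rfl

/-- A multiplicative linear map that satisfies the relations vanishes on the kernel of the
projection. -/
theorem map_eq_zero_of_sosProj_eq_zero (hN : 2 ≤ N) (hL : 2 ≤ L) (t ε ζ : ℂ) {A : Type*} [Ring A]
    [Algebra ℂ A] (f : PathFaceAlgebra ℂ (sosGraph N L) →ₗ[ℂ] A)
    (hf : ∀ a b, f (a * b) = f a * f b) (h1 : ∀ p a, f (frtGen t ε ζ p a) = 0)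
    (h2 : f (detLift hN hL t ε) = f 1) {a : PathFaceAlgebra ℂ (sosGraph N L)}
    (ha : sosProj N L t ε ζ a = 0) : f a = 0 := by
  -- The kernel of a multiplicative linear map is a two-sided ideal even if the unit is not
  -- preserved.
  let I : TwoSidedIdeal (PathFaceAlgebra ℂ (sosGraph N L)) := TwoSidedIdeal.mk' {a | f a = 0}
    (map_zero f) (fun {x y} hx hy => by
      rw [Set.mem_ofPred_eq] at hx hy ⊢
      rw [map_add, hx, hy, add_zero])
    (fun {x} hx => by
      rw [Set.mem_ofPred_eq] at hx ⊢
      rw [map_neg, hx, neg_zero])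
    (fun {x y} hy => by
      rw [Set.mem_ofPred_eq] at hy ⊢
      rw [hf, hy, mul_zero])
    (fun {x y} hx => by
      rw [Set.mem_ofPred_eq] at hx ⊢
      rw [hf, hx, zero_mul])
  have hI : ∀ x, x ∈ I ↔ f x = 0 := fun x => TwoSidedIdeal.mem_mk' _ _ _ _ _ _ _
  have h3 : ∀ x, Ideal.Quotient.mk (frtIdeal (sosGraph N L) (boltzmann t ε ζ)) x = 0 →
      f x = 0 := by
    intro x hx
    rw [Ideal.Quotient.eq_zero_iff_mem, frtIdeal, TwoSidedIdeal.mem_asIdeal,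
      TwoSidedIdeal.mem_span_iff] at hx
    rw [← hI]
    apply hx
    rintro y ⟨p, b, rfl⟩
    exact (hI _).mpr (h1 p b)
  have h4 : ∀ x y, Ideal.Quotient.mk (frtIdeal (sosGraph N L) (boltzmann t ε ζ)) x =
      Ideal.Quotient.mk (frtIdeal (sosGraph N L) (boltzmann t ε ζ)) y → f x = f y := by
    intro x y hxy
    rw [← sub_eq_zero, ← map_sub]
    apply h3
    rw [map_sub, hxy, sub_self]
  have hs := Ideal.Quotient.mk_surjective (I := frtIdeal (sosGraph N L) (boltzmann t ε ζ))
  -- The image of the kernel in the first quotient, described by lifts; by `h4` the choice of the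
  -- lift is irrelevant.
  let J : TwoSidedIdeal (SOSBialgebra N L t ε ζ) := TwoSidedIdeal.mk'
    {b | ∀ a, Ideal.Quotient.mk (frtIdeal (sosGraph N L) (boltzmann t ε ζ)) a = b → f a = 0}
    (fun a ha => h3 a ha)
    (fun {x y} hx hy a ha => by
      obtain ⟨b, rfl⟩ := hs x
      have h5 := hx b rfl
      have h6 := hy (a - b) (by rw [map_sub, ha, add_sub_cancel_left])
      rwa [map_sub, h5, sub_zero] at h6)
    (fun {x} hx a ha => by
      have := hx (-a) (by rw [map_neg, ha, neg_neg])
      rwa [map_neg, neg_eq_zero] at this)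
    (fun {x y} hy a ha => by
      obtain ⟨b, rfl⟩ := hs x
      obtain ⟨c, rfl⟩ := hs y
      rw [← map_mul] at ha
      rw [h4 _ _ ha, hf, hy c rfl, mul_zero])
    (fun {x y} hx a ha => by
      obtain ⟨b, rfl⟩ := hs x
      obtain ⟨c, rfl⟩ := hs y
      rw [← map_mul] at ha
      rw [h4 _ _ ha, hf, hx b rfl, zero_mul])
  have hJ : ∀ x, x ∈ J ↔ ∀ a,
      Ideal.Quotient.mk (frtIdeal (sosGraph N L) (boltzmann t ε ζ)) a = x → f a = 0 :=
    fun x => TwoSidedIdeal.mem_mk' _ _ _ _ _ _ _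
  rw [sosProj, AlgHom.comp_apply, Ideal.Quotient.mkₐ_eq_mk, Ideal.Quotient.mkₐ_eq_mk,
    Ideal.Quotient.eq_zero_iff_mem, detIdeal, TwoSidedIdeal.mem_asIdeal,
    TwoSidedIdeal.mem_span_iff] at ha
  refine (hJ _).mp (ha J ?_) a rfl
  rintro x rfl
  refine (hJ _).mpr fun b hb => ?_
  -- The generator det - 1 lifts to `detLift` - 1, which f annihilates since f takes the same value
  -- on both terms.
  rw [← mk_detLift hN hL, ← map_one (Ideal.Quotient.mk (frtIdeal _ _)), ← map_sub] at hb
  rw [h4 _ _ hb, map_sub, h2, sub_self]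

theorem exists_comp_of_surjective {M M' M'' : Type*} [AddCommGroup M] [AddCommGroup M']
    [AddCommGroup M''] [Module ℂ M] [Module ℂ M'] [Module ℂ M''] (f : M →ₗ[ℂ] M')
    (hf : Function.Surjective f) (g : M →ₗ[ℂ] M'') (h : ∀ a, f a = 0 → g a = 0) :
    ∃ k : M' →ₗ[ℂ] M'', ∀ a, k (f a) = g a := by
  obtain ⟨s, hs⟩ := f.exists_rightInverse_of_surjective (LinearMap.range_eq_top.mpr hf)
  refine ⟨g ∘ₗ s, fun a => ?_⟩
  rw [LinearMap.comp_apply, ← sub_eq_zero, ← map_sub]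
  apply h
  rw [map_sub, sub_eq_zero]
  exact LinearMap.congr_fun hs (f a)

theorem basisElt_mul_of_composable {V E : Type*} {G : OrientedGraph V E} (x y : G.PathPair)
    (h : x.Composable y) : PathFaceAlgebra.basisElt ℂ x * PathFaceAlgebra.basisElt ℂ y =
      PathFaceAlgebra.basisElt ℂ (x.append y h) :=
  (PathFaceAlgebra.basisElt_mul ℂ x y).trans (dif_pos h)

theorem basisElt_mul_of_not_composable {V E : Type*} {G : OrientedGraph V E} (x y : G.PathPair)
    (h : ¬ x.Composable y) :
    PathFaceAlgebra.basisElt ℂ x * PathFaceAlgebra.basisElt ℂ y = 0 :=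
  (PathFaceAlgebra.basisElt_mul ℂ x y).trans (dif_neg h)

/-- The pair of paths of length `1` given by two edges. -/
def edgePair (a b : Edge N L) : (sosGraph N L).PathPair :=
  ⟨((Path.ofEdge _ a).1, (Path.ofEdge _ b).1), rfl⟩

open scoped Classical in
/-- The representation in the path algebra that corresponds to the identity. -/
def pathRep (N L : ℕ) : FaceRep N L (PathFaceAlgebra ℂ (sosGraph N L)) :=
  FaceRep.ofEdges (fun v v' => PathFaceAlgebra.e ℂ (Path.vertex _ v) (Path.vertex _ v'))
    (fun v i v' k => if h : Ok v i ∧ Ok v' k then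
      PathFaceAlgebra.e ℂ (Path.ofEdge _ (mkEdge v i h.1)) (Path.ofEdge _ (mkEdge v' k h.2)) else 0)
    (fun v v' => basisElt_mul_of_composable (PathFaceAlgebra.vertexPair _ v v')
      (PathFaceAlgebra.vertexPair _ v v') ⟨rfl, rfl⟩)
    (fun v v' u u' h => basisElt_mul_of_not_composable (PathFaceAlgebra.vertexPair _ v v')
      (PathFaceAlgebra.vertexPair _ u u') h)
    (fun v i v' k => by
      split_ifs with h
      · exact basisElt_mul_of_composable (PathFaceAlgebra.vertexPair _ v v')
          (edgePair (mkEdge v i h.1) (mkEdge v' k h.2)) ⟨rfl, rfl⟩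
      · rw [mul_zero])
    (fun v i v' k => by
      split_ifs with h
      · exact basisElt_mul_of_composable (edgePair (mkEdge v i h.1) (mkEdge v' k h.2))
          (PathFaceAlgebra.vertexPair _ _ _) ⟨rfl, rfl⟩
      · rw [zero_mul])
    (fun v i v' k h => dif_neg h)

theorem pathRep_E_singleton {a b : Edge N L} : (pathRep N L).E ((sosGraph N L).s a) [a.index]
    ((sosGraph N L).s b) [b.index] =
    PathFaceAlgebra.e ℂ (Path.ofEdge _ a) (Path.ofEdge _ b) := by
  have h : Ok ((sosGraph N L).s a) a.index ∧ Ok ((sosGraph N L).s b) b.index :=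
    ⟨edge_ok a, edge_ok b⟩
  refine (FaceRep.ofEdges_E_singleton _ _ _ _ _ _ _ _ _ _ _).trans ((dif_pos h).trans ?_)
  rw [show mkEdge _ _ h.1 = a from edge_ext rfl rfl, show mkEdge _ _ h.2 = b from edge_ext rfl rfl]

theorem pathRep_E (v v' : Vertex N L) (l l' : List (Edge N L))
    (h : (sosGraph N L).IsWalk v l) (h' : (sosGraph N L).IsWalk v' l')
    (hl : l.length = l'.length) :
    (pathRep N L).E v (l.map Edge.index) v' (l'.map Edge.index) =
      PathFaceAlgebra.basisElt ℂ ⟨(⟨v, l, h⟩, ⟨v', l', h'⟩), hl⟩ := by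
  induction l generalizing v v' l' with
  | nil =>
    obtain rfl := List.length_eq_zero_iff.mp hl.symm
    exact FaceRep.E_nil _ _ _
  | cons a l ih =>
    obtain ⟨b, l', rfl⟩ := List.exists_cons_of_length_eq_add_one hl.symm
    obtain ⟨rfl, h⟩ := h
    obtain ⟨rfl, h'⟩ := h'
    rw [List.map_cons, List.map_cons, FaceRep.E_cons, pathRep_E_singleton, act_edge, act_edge,
      ih _ _ _ h h' (by simpa using hl)]
    exact basisElt_mul_of_composable (edgePair a b)
      ⟨(⟨_, l, h⟩, ⟨_, l', h'⟩), Nat.succ_injective hl⟩ ⟨rfl, rfl⟩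

theorem pathRep_hom : (pathRep N L).hom = LinearMap.id :=
  PathFaceAlgebra.hom_ext fun x => by
    rw [FaceRep.hom_basisElt]
    exact pathRep_E _ _ _ _ x.1.1.isWalk x.1.2.isWalk x.2

/-- The image of a representation under an algebra homomorphism. -/
def FaceRep.map {A B : Type*} [Ring A] [Ring B] [Algebra ℂ A] [Algebra ℂ B] (R : FaceRep N L A)
    (f : A →ₐ[ℂ] B) : FaceRep N L B where
  ev v v' := f (R.ev v v')
  x i k := f (R.x i k)
  ev_mul_self v v' := by rw [← map_mul, R.ev_mul_self]
  ev_mul_ne v v' u u' h := by rw [← map_mul, R.ev_mul_ne _ _ _ _ h, map_zero]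
  ev_mul_x v v' i k h h' := by rw [← map_mul, R.ev_mul_x _ _ _ _ h h', map_mul]
  ev_mul_x_eq_zero v v' i k h := by rw [← map_mul, R.ev_mul_x_eq_zero _ _ _ _ h, map_zero]

theorem FaceRep.map_E {A B : Type*} [Ring A] [Ring B] [Algebra ℂ A] [Algebra ℂ B]
    (R : FaceRep N L A) (f : A →ₐ[ℂ] B) (v v' : Vertex N L) (w w' : List (Fin N)) :
    (R.map f).E v w v' w' = f (R.E v w v' w') := by
  have : ∀ w w', (R.map f).X w w' = f (R.X w w') := by
    intro w
    induction w with
    | nil =>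
      intro w'
      cases w' with
      | nil => exact (map_one f).symm
      | cons k w' => exact (map_zero f).symm
    | cons i w ih =>
      intro w'
      cases w' with
      | nil => exact (map_zero f).symm
      | cons k w' => rw [X_cons, X_cons, ih, map_mul]; rfl
  rw [E, E, this, map_mul]
  rfl

/-- The canonical representation in the `SU(N)_L`-SOS algebra. -/
def sosRep (N L : ℕ) (t ε ζ : ℂ) : FaceRep N L (SOSAlgebra N L t ε ζ) :=
  (pathRep N L).map (sosProj N L t ε ζ)

theorem sosRep_hom (t ε ζ : ℂ) (a : PathFaceAlgebra ℂ (sosGraph N L)) :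
    (sosRep N L t ε ζ).hom a = sosProj N L t ε ζ a := by
  have : (sosRep N L t ε ζ).hom = (sosProj N L t ε ζ).toLinearMap ∘ₗ (pathRep N L).hom :=
    PathFaceAlgebra.hom_ext fun x => by
      rw [FaceRep.hom_basisElt, LinearMap.comp_apply, FaceRep.hom_basisElt]
      exact FaceRep.map_E _ _ _ _ _ _
  rw [this, pathRep_hom]
  rfl

theorem sosRep_E (t ε ζ : ℂ) {m : ℕ} (p q : (sosGraph N L).Path m) :
    (sosRep N L t ε ζ).E p.source (indices p) q.source (indices q) = sosE t ε ζ p q := by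
  rw [← FaceRep.hom_e, sosRep_hom, sosProj_e]

/-- The map attached to `sosRep` is the quotient projection, so the three conditions are the
defining relations of the quotient. -/
theorem sosRep_isSOS {t ε ζ : ℂ} (hP : SOSParams N L t ε) (hζ : ζ ≠ 0) :
    (sosRep N L t ε ζ).IsSOS t ε (sosLoops hP.two_le_N hP.two_le_L) where
  rel := FaceRep.rel_of_hom_frtGen hP hζ fun p a => by rw [sosRep_hom, sosProj_frtGen]
  sum_ev := by rw [← FaceRep.hom_one, sosRep_hom, map_one]
  det_eq := by rw [← FaceRep.hom_detLift, sosRep_hom, sosProj_detLift]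

/-- Representations of the `SU(N)_L`-SOS algebra. -/
theorem FaceRep.exists_hom {t ε : ℂ} (hP : SOSParams N L t ε) (ζ : ℂ) {A : Type*} [Ring A]
    [Algebra ℂ A] (R : FaceRep N L A) (hR : R.Rel t ε)
    (hdet : R.det t ε (sosLoops hP.two_le_N hP.two_le_L) = ∑ l, ∑ m, R.ev l m) :
    ∃ f : SOSAlgebra N L t ε ζ →ₗ[ℂ] A, (∀ a b, f (a * b) = f a * f b) ∧
      ∀ a, f (sosProj N L t ε ζ a) = R.hom a := by
  obtain ⟨f, hf⟩ := exists_comp_of_surjective (sosProj N L t ε ζ).toLinearMap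
    (sosProj_surjective t ε ζ) R.hom fun a ha =>
      map_eq_zero_of_sosProj_eq_zero hP.two_le_N hP.two_le_L t ε ζ R.hom R.hom_mul
        (fun p a => hR.hom_frtGen_eq_zero ζ p a) (by rw [hom_detLift, hdet, hom_one]) ha
  refine ⟨f, fun a b => ?_, hf⟩
  obtain ⟨a, rfl⟩ := sosProj_surjective t ε ζ a
  obtain ⟨b, rfl⟩ := sosProj_surjective t ε ζ b
  rw [← map_mul]
  exact (hf _).trans ((R.hom_mul a b).trans (congrArg₂ _ (hf a).symm (hf b).symm))

end Canonical

/-! ### The coproduct -/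

namespace FaceRep

variable {N L : ℕ} {A : Type*} [Ring A] [Algebra ℂ A]

/-- The image of the symbol of two words under the coproduct. -/
def coprodE (R : FaceRep N L A) (v : Vertex N L) (w : List (Fin N)) (v' : Vertex N L)
    (w' : List (Fin N)) : A ⊗[ℂ] A :=
  ∑ u, wsum w.length fun r => R.E v w u r ⊗ₜ[ℂ] R.E u r v' w'

variable (R : FaceRep N L A)

omit [Algebra ℂ A] in
theorem E_mul_E_ne {v v' u u' : Vertex N L} {w w' : List (Fin N)}
    (h : ¬ (run v w = u ∧ run v' w' = u')) (a a' : List (Fin N)) :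
    R.E v w v' w' * R.E u a u' a' = 0 := by
  rw [E.eq_def R u, ← mul_assoc, E_mul_ev_ne R h, zero_mul]

theorem coprodE_mul_ne {v v' u u' : Vertex N L} {w w' : List (Fin N)}
    (h : ¬ (run v w = u ∧ run v' w' = u')) (a a' : List (Fin N)) :
    R.coprodE v w v' w' * R.coprodE u a u' a' = 0 := by
  rw [coprodE, coprodE, Finset.sum_mul]
  refine Finset.sum_eq_zero fun y _ => ?_
  rw [Finset.mul_sum]
  refine Finset.sum_eq_zero fun z _ => ?_
  rw [wsum_mul]
  refine wsum_eq_zero fun r _ => ?_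
  rw [mul_wsum]
  refine wsum_eq_zero fun s _ => ?_
  rw [Algebra.TensorProduct.tmul_mul_tmul]
  by_cases h1 : run v w = u
  · rw [R.E_mul_E_ne (fun h2 => h ⟨h1, h2.2⟩) s a', TensorProduct.tmul_zero]
  · rw [R.E_mul_E_ne (fun h2 => h1 h2.1) a s, TensorProduct.zero_tmul]

/-- The middle word is cut at the length of α; the vertex idempotents force the second middle path
to start where the first one ends. -/
theorem coprodE_append {v v' : Vertex N L} {α α' : List (Fin N)} (h : α.length = α'.length)
    (β β' : List (Fin N)) : R.coprodE v (α ++ β) v' (α' ++ β') =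
      R.coprodE v α v' α' * R.coprodE (run v α) β (run v' α') β' := by
  rw [coprodE, coprodE, coprodE, Finset.sum_mul]
  refine Finset.sum_congr rfl fun u _ => ?_
  rw [List.length_append, wsum_append, wsum_mul]
  refine wsum_congr fun r hr => ?_
  rw [Finset.mul_sum, Finset.sum_eq_single (run u r), mul_wsum]
  · refine wsum_congr fun s _ => ?_
    rw [Algebra.TensorProduct.tmul_mul_tmul, ← R.E_append hr.symm, ← R.E_append (hr.trans h)]
  · intro z _ hz
    rw [mul_wsum]
    refine wsum_eq_zero fun s _ => ?_
    rw [Algebra.TensorProduct.tmul_mul_tmul, R.E_mul_E_ne (fun h2 => hz h2.2.symm) β s,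
      TensorProduct.zero_tmul]
  · exact fun h => absurd (Finset.mem_univ _) h

theorem coprodE_eq_zero {v v' : Vertex N L} {w w' : List (Fin N)}
    (h : ¬ (Valid v w ∧ Valid v' w')) : R.coprodE v w v' w' = 0 := by
  refine Finset.sum_eq_zero fun u _ => wsum_eq_zero fun r _ => ?_
  by_cases h1 : Valid v w
  · rw [R.E_eq_zero (v := u) (fun h2 => h ⟨h1, h2.2⟩), TensorProduct.tmul_zero]
  · rw [R.E_eq_zero (v := v) (fun h2 => h1 h2.1), TensorProduct.zero_tmul]

/-- The representation in `A ⊗ A` that is given by the coproduct. -/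
def coprod : FaceRep N L (A ⊗[ℂ] A) :=
  ofEdges (fun v v' => R.coprodE v [] v' []) (fun v i v' k => R.coprodE v [i] v' [k])
    (fun _ _ => (R.coprodE_append (α := []) (α' := []) rfl [] []).symm)
    (fun _ _ _ _ h => R.coprodE_mul_ne (w := []) (w' := []) h [] [])
    (fun _ i _ k => (R.coprodE_append (α := []) (α' := []) rfl [i] [k]).symm)
    (fun _ i _ k => (R.coprodE_append (α := [i]) (α' := [k]) rfl [] []).symm)
    (fun _ _ _ _ h => R.coprodE_eq_zero fun h' => h ⟨h'.1.1, h'.2.1⟩)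

theorem coprod_E_singleton (v v' : Vertex N L) (i k : Fin N) :
    R.coprod.E v [i] v' [k] = R.coprodE v [i] v' [k] :=
  ofEdges_E_singleton _ _ _ _ _ _ _ _ _ _ _

theorem coprod_E (v v' : Vertex N L) {w w' : List (Fin N)} (h : w.length = w'.length) :
    R.coprod.E v w v' w' = R.coprodE v w v' w' := by
  induction w generalizing v v' w' with
  | nil =>
    obtain rfl := List.length_eq_zero_iff.mp h.symm
    exact E_nil _ _ _
  | cons i w ih =>
    obtain ⟨k, w', rfl⟩ := List.exists_cons_of_length_eq_add_one h.symm
    rw [E_cons, ih _ _ (Nat.succ_injective h), coprod_E_singleton]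
    exact (R.coprodE_append (α := [i]) (α' := [k]) rfl w w').symm

variable {R} {t ε : ℂ}

/-- A product of two matrices that commute with the weight commutes with it. The relation for the
second factor moves the weight to the middle word, and the relation for the first factor moves it on
to the row. -/
theorem coprod_rel (hR : R.Rel t ε) : R.coprod.Rel t ε := by
  intro v v' i j k l h
  have h2 : ∀ a b c d, R.coprod.E v [a, b] v' [c, d] = R.coprodE v [a, b] v' [c, d] :=
    fun _ _ _ _ => R.coprod_E _ _ rfl
  simp only [h2]
  simp only [coprodE, List.length_cons, List.length_nil, zero_add, Nat.reduceAdd, Finset.smul_sum,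
    ← Finset.sum_add_distrib]
  refine Finset.sum_congr rfl fun u _ => ?_
  simp only [wsum_two, Finset.smul_sum, ← Finset.sum_add_distrib, ← TensorProduct.tmul_smul,
    ← TensorProduct.tmul_add]
  simp only [hR u v' _ _ k l h, TensorProduct.tmul_add, Finset.sum_add_distrib]
  rw [Finset.sum_comm (f := fun a b => R.E v [i, j] u [a, b] ⊗ₜ[ℂ] (wOff t ε u b a •
    R.E u [b, a] v' [k, l]))]
  simp only [← Finset.sum_add_distrib]
  refine Finset.sum_congr rfl fun a _ => Finset.sum_congr rfl fun b _ => ?_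
  by_cases hab : Valid u [a, b]
  · rw [TensorProduct.tmul_smul, TensorProduct.tmul_smul, TensorProduct.smul_tmul',
      TensorProduct.smul_tmul', ← TensorProduct.add_tmul, hR v u i j a b hab,
      TensorProduct.add_tmul, TensorProduct.tmul_smul, TensorProduct.tmul_smul,
      TensorProduct.smul_tmul', TensorProduct.smul_tmul']
  · rw [R.E_eq_zero (v := u) (fun h2 => hab h2.1)]
    simp

/-- Antisymmetrising the first factor leaves a vertex symbol times the sign of the middle word; that
sign antisymmetrises the second factor. The two ratios of D multiply to one that is independent of
the middle vertex. -/
theorem coprod_det {Q : Loops N L} (hR : R.IsSOS t ε Q) (hP : SOSParams N L t ε) :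
    R.coprod.det t ε Q = ∑ l, ∑ m, R.coprod.ev l m := by
  refine Finset.sum_congr rfl fun l _ => Finset.sum_congr rfl fun m _ => ?_
  have h1 : R.coprod.Phi N (altSign ε Finset.univ) l m (Q.q m) =
      ∑ u, wsum N fun r => R.Phi N (altSign ε Finset.univ) l u r ⊗ₜ[ℂ] R.E u r m (Q.q m) := by
    rw [Phi]
    have h2 : ∀ w : List (Fin N), w.length = N → altSign ε Finset.univ w •
        R.coprod.E l w m (Q.q m) = ∑ u, wsum N fun r =>
          (altSign ε Finset.univ w • R.E l w u r) ⊗ₜ[ℂ] R.E u r m (Q.q m) := by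
      intro w hw
      rw [coprod_E _ _ _ (hw.trans (Q.q_length m).symm), coprodE, Finset.smul_sum, hw]
      refine Finset.sum_congr rfl fun u _ => ?_
      rw [smul_wsum]
      rfl
    rw [wsum_congr h2, wsum_finset_sum]
    refine Finset.sum_congr rfl fun u _ => ?_
    rw [wsum_comm]
    refine wsum_congr fun r _ => ?_
    exact (map_wsum ((TensorProduct.mk ℂ A A).flip (R.E u r m (Q.q m))) N _).symm
  have h3 : ∀ u, (wsum N fun r =>
      R.Phi N (altSign ε Finset.univ) l u r ⊗ₜ[ℂ] R.E u r m (Q.q m)) =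
      (sgn ε (Q.q m) * (qDim t l / qDim t m)) • (R.ev l u ⊗ₜ[ℂ] R.ev u m) := by
    intro u
    have h4 : ∀ r : List (Fin N), r.length = N →
        R.Phi N (altSign ε Finset.univ) l u r ⊗ₜ[ℂ] R.E u r m (Q.q m) =
        TensorProduct.mk ℂ A A ((qDim t l / qDim t u) • R.ev l u)
          (altSign ε Finset.univ r • R.E u r m (Q.q m)) := by
      intro r hr
      rw [TensorProduct.mk_apply, TensorProduct.tmul_smul, TensorProduct.smul_tmul', smul_smul]
      by_cases hv : Valid u r
      · by_cases hn : r.Nodup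
        · rw [hR.Phi_univ hP l hv hn hr, altSign, if_pos ⟨hn, toFinset_eq_univ hn hr⟩]
        · rw [hR.rel.Phi_eq_zero hP hn, altSign, if_neg fun h => hn h.1, zero_mul, zero_smul]
      · rw [R.E_eq_zero (v := u) (fun h2 => hv h2.1), TensorProduct.tmul_zero,
          TensorProduct.tmul_zero]
    rw [wsum_congr h4, ← map_wsum]
    change _ ⊗ₜ[ℂ] R.Phi N (altSign ε Finset.univ) u m (Q.q m) = _
    rw [hR.Phi_univ hP u (Q.q_valid m) (Q.q_nodup m) (Q.q_length m), TensorProduct.tmul_smul,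
      ← TensorProduct.smul_tmul', smul_smul]
    congr 1
    have := hP.qDim_ne_zero u
    field_simp
  rw [h1]
  simp only [h3]
  rw [← Finset.smul_sum, smul_smul, show qDim t m / qDim t l * sgn ε (Q.q m) *
    (sgn ε (Q.q m) * (qDim t l / qDim t m)) = 1 from ?_, one_smul]
  · refine Finset.sum_congr rfl fun u _ => ?_
    change _ = R.E l [] u [] ⊗ₜ[ℂ] R.E u [] m []
    rw [E_nil, E_nil]
  · have h4 := hP.qDim_ne_zero l
    have h5 := hP.qDim_ne_zero m
    have h6 := sgn_mul_self hP.sq (Q.q m)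
    field_simp
    linear_combination h6

end FaceRep

/-! ### The counit -/

section Counit

variable {N L : ℕ}

instance : DecidableEq (Vertex N L) := Classical.decEq _

open scoped Classical in
/-- The representation by matrices indexed by the vertices. -/
def matrixRep (N L : ℕ) : FaceRep N L (Matrix (Vertex N L) (Vertex N L) ℂ) :=
  FaceRep.ofEdges (fun v v' => if v = v' then Matrix.single v v 1 else 0)
    (fun v i v' k => if (v = v' ∧ i = k) ∧ Ok v i then Matrix.single v (act v i) 1 else 0)
    (fun v v' => by
      split_ifs
      · rw [Matrix.single_mul_single_same, one_mul]
      · rw [zero_mul])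
    (fun v v' u u' h => by
      split_ifs with h1 h2
      · rw [Matrix.single_mul_single_of_ne]
        rintro rfl
        exact h ⟨rfl, h1.symm.trans h2⟩
      · rw [mul_zero]
      · rw [zero_mul]
      · rw [mul_zero])
    (fun v i v' k => by
      split_ifs with h1 h2 h2
      · rw [Matrix.single_mul_single_same, one_mul]
      · rw [mul_zero]
      · exact absurd h2.1.1 h1
      · rw [mul_zero])
    (fun v i v' k => by
      split_ifs with h1 h2 h2
      · rw [Matrix.single_mul_single_same, one_mul]
      · obtain ⟨⟨rfl, rfl⟩, -⟩ := h1
        exact absurd rfl h2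
      · rw [zero_mul]
      · rw [zero_mul])
    (fun v i v' k h => if_neg fun h' => h ⟨h'.2, by
      obtain ⟨⟨rfl, rfl⟩, h1⟩ := h'
      exact h1⟩)

open scoped Classical in
theorem matrixRep_E (v v' : Vertex N L) (w w' : List (Fin N)) :
    (matrixRep N L).E v w v' w' =
      if (v = v' ∧ w = w') ∧ Valid v w then Matrix.single v (run v w) 1 else 0 := by
  induction w generalizing v v' w' with
  | nil =>
    cases w' with
    | nil =>
      rw [FaceRep.E_nil]
      change (if v = v' then Matrix.single v v 1 else 0) = _
      by_cases h : v = v'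
      · rw [if_pos h, if_pos ⟨⟨h, rfl⟩, trivial⟩]
        rfl
      · rw [if_neg h, if_neg fun h' => h h'.1.1]
    | cons k w' => rw [FaceRep.E_eq_zero_of_length _ (by simp), if_neg (by simp)]
  | cons i w ih =>
    cases w' with
    | nil => rw [FaceRep.E_eq_zero_of_length _ (by simp), if_neg (by simp)]
    | cons k w' =>
      rw [FaceRep.E_cons, ih, matrixRep, FaceRep.ofEdges_E_singleton]
      by_cases h : (v = v' ∧ i :: w = k :: w') ∧ Valid v (i :: w)
      · obtain ⟨⟨rfl, h2⟩, h3⟩ := h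
        obtain ⟨rfl, rfl⟩ := List.cons.inj h2
        rw [if_pos ⟨⟨rfl, rfl⟩, h3.1⟩, if_pos ⟨⟨rfl, rfl⟩, h3.2⟩, if_pos ⟨⟨rfl, rfl⟩, h3⟩,
          Matrix.single_mul_single_same, one_mul]
        rfl
      · rw [if_neg h]
        by_cases h1 : (v = v' ∧ i = k) ∧ Ok v i
        · rw [if_pos h1, if_neg, mul_zero]
          rintro ⟨⟨-, rfl⟩, h2⟩
          exact h ⟨⟨h1.1.1, by rw [h1.1.2]⟩, h1.2, h2⟩
        · rw [if_neg h1, zero_mul]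

/-- Diagonal terms agree at once. In the off-diagonal terms both paths have the same ends, so the
same matrix unit appears; if only one of them exists, the coefficient is zero. -/
theorem matrixRep_rel {t ε : ℂ} (hP : SOSParams N L t ε) : (matrixRep N L).Rel t ε := by
  intro v v' i j k l h
  simp only [matrixRep_E]
  by_cases hv : v = v'
  · subst hv
    congr 1
    · by_cases h1 : [i, j] = [k, l]
      · obtain ⟨rfl, h2⟩ := List.cons.inj h1
        obtain ⟨rfl, -⟩ := List.cons.inj h2
        rfl
      · rw [if_neg fun hh => h1 hh.1.2, smul_zero, smul_zero]
    · by_cases h1 : i = l ∧ j = k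
      · obtain ⟨rfl, rfl⟩ := h1
        by_cases hij : j = i
        · subst hij
          simp [wOff]
        · by_cases h2 : Valid v [i, j]
          · rw [if_pos ⟨⟨rfl, rfl⟩, h2⟩, if_pos ⟨⟨rfl, rfl⟩, h⟩,
              run_eq_of_perm h2 h (List.Perm.swap j i [])]
          · rw [hP.wOff_eq_zero hij h h2, zero_smul, zero_smul]
      · rw [if_neg, if_neg, smul_zero, smul_zero]
        · rintro ⟨⟨-, h2⟩, -⟩
          simp only [List.cons.injEq, and_true] at h2
          exact h1 ⟨h2.2, h2.1⟩
        · rintro ⟨⟨-, h2⟩, -⟩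
          simp only [List.cons.injEq, and_true] at h2
          exact h1 h2
  · simp [hv]

theorem matrixRep_det {t ε : ℂ} (hP : SOSParams N L t ε) (Q : Loops N L) :
    (matrixRep N L).det t ε Q = ∑ l, ∑ m, (matrixRep N L).ev l m := by
  classical
  refine Finset.sum_congr rfl fun l _ => Finset.sum_congr rfl fun m _ => ?_
  rw [FaceRep.Phi, wsum_eq_single (Q.q m) (Q.q_length m), ← FaceRep.E_nil, matrixRep_E,
    matrixRep_E]
  · by_cases h : l = m
    · subst h
      rw [if_pos ⟨⟨rfl, rfl⟩, Q.q_valid l⟩, if_pos ⟨⟨rfl, rfl⟩, trivial⟩, altSign,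
        if_pos ⟨Q.q_nodup l, Q.q_toFinset l⟩, div_self (hP.qDim_ne_zero l), one_mul, smul_smul,
        sgn_mul_self hP.sq, one_smul,
        (run_eq_iff_nodup (Q.q_valid l) (Q.q_length l)).mpr (Q.q_nodup l)]
      rfl
    · rw [if_neg fun h' => h h'.1.1, if_neg fun h' => h h'.1.1, smul_zero, smul_zero]
  · intro w _ hw
    rw [matrixRep_E, if_neg fun h' => hw h'.1.2, smul_zero]

/-- The sum of the entries of a matrix. -/
def entrySum (N L : ℕ) : Matrix (Vertex N L) (Vertex N L) ℂ →ₗ[ℂ] ℂ where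
  toFun M := ∑ i, ∑ j, M i j
  map_add' M M' := by simp only [Matrix.add_apply, Finset.sum_add_distrib]
  map_smul' c M := by simp only [Matrix.smul_apply, Finset.smul_sum, RingHom.id_apply]

theorem entrySum_single (v v' : Vertex N L) :
    entrySum N L (Matrix.single v v' 1) = 1 := by
  change ∑ i, ∑ j, Matrix.single v v' (1 : ℂ) i j = 1
  rw [Finset.sum_eq_single v, Finset.sum_eq_single v', Matrix.single_apply_same]
  · intro j _ hj
    exact Matrix.single_apply_of_ne _ _ _ _ _ fun h => hj h.2.symm
  · exact fun h => absurd (Finset.mem_univ _) h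
  · intro i _ hi
    exact Finset.sum_eq_zero fun j _ => Matrix.single_apply_of_ne _ _ _ _ _ fun h => hi h.1.symm
  · exact fun h => absurd (Finset.mem_univ _) h

end Counit

/-! ### The face algebra structure -/

section FaceAlgebraStructure

variable {N L : ℕ} {t ε ζ : ℂ}

theorem exists_hom_sosRep (hP : SOSParams N L t ε) (ζ : ℂ) {A : Type*} [Ring A]
    [Algebra ℂ A] (R : FaceRep N L A) (hR : R.Rel t ε)
    (hdet : R.det t ε (sosLoops hP.two_le_N hP.two_le_L) = ∑ l, ∑ m, R.ev l m) :
    ∃ f : SOSAlgebra N L t ε ζ →ₗ[ℂ] A, (∀ a b, f (a * b) = f a * f b) ∧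
      ∀ v w v' w', f ((sosRep N L t ε ζ).E v w v' w') = R.E v w v' w' := by
  obtain ⟨f, hf, hf'⟩ := FaceRep.exists_hom hP ζ R hR hdet
  refine ⟨f, hf, fun v w v' w' => ?_⟩
  by_cases hl : w.length = w'.length
  · by_cases h : Valid v w ∧ Valid v' w'
    · obtain ⟨m, hm⟩ : ∃ m, w.length = m := ⟨_, rfl⟩
      obtain ⟨p, rfl, rfl⟩ := exists_path h.1 hm
      obtain ⟨q, rfl, rfl⟩ := exists_path h.2 (hl.symm.trans hm)
      rw [sosRep_E, ← sosProj_e, hf', FaceRep.hom_e]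
    · rw [FaceRep.E_eq_zero _ h, FaceRep.E_eq_zero _ h, map_zero]
  · rw [FaceRep.E_eq_zero_of_length _ hl, FaceRep.E_eq_zero_of_length _ hl, map_zero]

theorem sos_hom_ext {M : Type*} [AddCommGroup M] [Module ℂ M]
    {f g : SOSAlgebra N L t ε ζ →ₗ[ℂ] M}
    (h : ∀ (m : ℕ) (p q : (sosGraph N L).Path m), f (sosE t ε ζ p q) = g (sosE t ε ζ p q)) :
    f = g := by
  have h1 : f ∘ₗ (sosProj N L t ε ζ).toLinearMap = g ∘ₗ (sosProj N L t ε ζ).toLinearMap :=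
    PathFaceAlgebra.hom_ext fun x => h x.1.1.length ⟨x.1.1, rfl⟩ ⟨x.1.2, x.2.symm⟩
  refine LinearMap.ext fun a => ?_
  obtain ⟨a, rfl⟩ := sosProj_surjective t ε ζ a
  exact LinearMap.congr_fun h1 a

/-- The coproduct. -/
def sosComul (hP : SOSParams N L t ε) (hζ : ζ ≠ 0) :
    SOSAlgebra N L t ε ζ →ₗ[ℂ] SOSAlgebra N L t ε ζ ⊗[ℂ] SOSAlgebra N L t ε ζ :=
  (exists_hom_sosRep hP ζ _ (FaceRep.coprod_rel (sosRep_isSOS hP hζ).rel)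
    (FaceRep.coprod_det (sosRep_isSOS hP hζ) hP)).choose

theorem sosComul_mul (hP : SOSParams N L t ε) (hζ : ζ ≠ 0) (a b : SOSAlgebra N L t ε ζ) :
    sosComul hP hζ (a * b) = sosComul hP hζ a * sosComul hP hζ b :=
  (exists_hom_sosRep hP ζ _ (FaceRep.coprod_rel (sosRep_isSOS hP hζ).rel)
    (FaceRep.coprod_det (sosRep_isSOS hP hζ) hP)).choose_spec.1 a b

theorem sosComul_E (hP : SOSParams N L t ε) (hζ : ζ ≠ 0) (v v' : Vertex N L)
    {w w' : List (Fin N)} (h : w.length = w'.length) :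
    sosComul hP hζ ((sosRep N L t ε ζ).E v w v' w') =
      (sosRep N L t ε ζ).coprodE v w v' w' := by
  rw [← FaceRep.coprod_E _ _ _ h]
  exact (exists_hom_sosRep hP ζ _ (FaceRep.coprod_rel (sosRep_isSOS hP hζ).rel)
    (FaceRep.coprod_det (sosRep_isSOS hP hζ) hP)).choose_spec.2 v w v' w'

theorem sosComul_sosE (hP : SOSParams N L t ε) (hζ : ζ ≠ 0) {m : ℕ}
    (p q : (sosGraph N L).Path m) : sosComul hP hζ (sosE t ε ζ p q) =
      ∑ r : (sosGraph N L).Path m, sosE t ε ζ p r ⊗ₜ[ℂ] sosE t ε ζ r q := by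
  rw [← sosRep_E, sosComul_E hP hζ _ _ ((indices_length p).trans (indices_length q).symm),
    FaceRep.coprodE, indices_length, ← sum_path m (fun u r =>
      (sosRep N L t ε ζ).E p.source (indices p) u r ⊗ₜ[ℂ]
        (sosRep N L t ε ζ).E u r q.source (indices q)) fun v w h => by
      rw [FaceRep.E_eq_zero _ fun h' => h h'.2, TensorProduct.zero_tmul]]
  simp only [sosRep_E]

/-- A lift of the counit to matrices. -/
def sosMatrix (hP : SOSParams N L t ε) (ζ : ℂ) :
    SOSAlgebra N L t ε ζ →ₗ[ℂ] Matrix (Vertex N L) (Vertex N L) ℂ :=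
  (exists_hom_sosRep hP ζ _ (matrixRep_rel hP) (matrixRep_det hP _)).choose

theorem sosMatrix_mul (hP : SOSParams N L t ε) (a b : SOSAlgebra N L t ε ζ) :
    sosMatrix hP ζ (a * b) = sosMatrix hP ζ a * sosMatrix hP ζ b :=
  (exists_hom_sosRep hP ζ _ (matrixRep_rel hP) (matrixRep_det hP _)).choose_spec.1 a b

theorem sosMatrix_E (hP : SOSParams N L t ε) (v v' : Vertex N L) (w w' : List (Fin N)) :
    sosMatrix hP ζ ((sosRep N L t ε ζ).E v w v' w') = (matrixRep N L).E v w v' w' :=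
  (exists_hom_sosRep hP ζ _ (matrixRep_rel hP) (matrixRep_det hP _)).choose_spec.2 v w v' w'

/-- The counit. -/
def sosCounit (hP : SOSParams N L t ε) (ζ : ℂ) : SOSAlgebra N L t ε ζ →ₗ[ℂ] ℂ :=
  entrySum N L ∘ₗ sosMatrix hP ζ

open scoped Classical in
theorem sosCounit_E (hP : SOSParams N L t ε) (v v' : Vertex N L) (w w' : List (Fin N)) :
    sosCounit hP ζ ((sosRep N L t ε ζ).E v w v' w') =
      if (v = v' ∧ w = w') ∧ Valid v w then 1 else 0 := by
  rw [sosCounit, LinearMap.comp_apply, sosMatrix_E, matrixRep_E]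
  split_ifs
  · exact entrySum_single _ _
  · exact map_zero _

theorem sosCounit_sosE (hP : SOSParams N L t ε) {m : ℕ} (p q : (sosGraph N L).Path m) :
    sosCounit hP ζ (sosE t ε ζ p q) = delta ℂ p q := by
  classical
  rw [← sosRep_E, sosCounit_E, delta]
  refine if_congr ⟨fun h => path_ext h.1.1 h.1.2, ?_⟩ rfl rfl
  rintro rfl
  exact ⟨⟨rfl, rfl⟩, path_valid p⟩

theorem sum_delta_smul {X M : Type*} [Fintype X] [AddCommMonoid M] [Module ℂ M] (x : X)
    (F : X → M) : ∑ y, delta ℂ x y • F y = F x := by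
  classical
  simp [delta]

theorem sum_delta_smul' {X M : Type*} [Fintype X] [AddCommMonoid M] [Module ℂ M] (x : X)
    (F : X → M) : ∑ y, delta ℂ y x • F y = F x := by
  classical
  simp [delta]

/-- The coalgebra structure of the `SU(N)_L`-SOS algebra. -/
@[reducible]
def sosCoalgebra (hP : SOSParams N L t ε) (hζ : ζ ≠ 0) : Coalgebra ℂ (SOSAlgebra N L t ε ζ) where
  comul := sosComul hP hζ
  counit := sosCounit hP ζ
  coassoc := sos_hom_ext fun m p q => by
    simp only [LinearMap.comp_apply, LinearEquiv.coe_coe, sosComul_sosE, map_sum,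
      LinearMap.rTensor_tmul, LinearMap.lTensor_tmul, TensorProduct.sum_tmul,
      TensorProduct.tmul_sum, TensorProduct.assoc_tmul]
    exact Finset.sum_comm
  rTensor_counit_comp_comul := sos_hom_ext fun m p q => by
    simp only [LinearMap.comp_apply, sosComul_sosE, map_sum, LinearMap.rTensor_tmul,
      sosCounit_sosE, TensorProduct.mk_apply]
    rw [← sum_delta_smul p fun r => (1 : ℂ) ⊗ₜ[ℂ] sosE t ε ζ r q]
    simp only [TensorProduct.smul_tmul', smul_eq_mul, mul_one]
  lTensor_counit_comp_comul := sos_hom_ext fun m p q => by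
    simp only [LinearMap.comp_apply, sosComul_sosE, map_sum, LinearMap.lTensor_tmul,
      sosCounit_sosE, LinearMap.flip_apply, TensorProduct.mk_apply]
    rw [← sum_delta_smul' q fun r => sosE t ε ζ p r ⊗ₜ[ℂ] (1 : ℂ)]
    simp only [← TensorProduct.tmul_smul, smul_eq_mul, mul_one]

theorem sosFace_eq (m : Vertex N L) : sosFace t ε ζ m = ∑ l, (sosRep N L t ε ζ).ev l m := rfl

theorem sosFace'_eq (l : Vertex N L) : sosFace' t ε ζ l = ∑ m, (sosRep N L t ε ζ).ev l m := rfl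

/-! ### Products of the face idempotents, and the behaviour of the counit on products. -/

namespace FaceRep

variable {A : Type*} [Ring A] (R : FaceRep N L A)

theorem ev_mul_ev (v v' u u' : Vertex N L) :
    R.ev v v' * R.ev u u' = if v = u ∧ v' = u' then R.ev v v' else 0 := by
  split_ifs with h
  · rw [h.1, h.2, ev_mul_self]
  · exact R.ev_mul_ne _ _ _ _ h

theorem sum_left_mul_sum_left [Algebra ℂ A] (v w : Vertex N L) :
    (∑ l, R.ev l v) * ∑ l, R.ev l w = delta ℂ v w • ∑ l, R.ev l v := by
  rw [Finset.sum_mul_sum, delta]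
  by_cases h : v = w
  · simp [ev_mul_ev, h]
  · simp [ev_mul_ev, h]

theorem sum_right_mul_sum_right [Algebra ℂ A] (v w : Vertex N L) :
    (∑ l, R.ev v l) * ∑ l, R.ev w l = delta ℂ v w • ∑ l, R.ev v l := by
  rw [Finset.sum_mul_sum, delta]
  by_cases h : v = w
  · simp [ev_mul_ev, h]
  · simp [ev_mul_ev, h]

theorem sum_left_mul_sum_right (v w : Vertex N L) :
    (∑ l, R.ev l v) * ∑ l, R.ev w l = R.ev w v := by
  rw [Finset.sum_mul_sum]
  simp [ev_mul_ev, ite_and]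

theorem sum_right_mul_sum_left (v w : Vertex N L) :
    (∑ l, R.ev w l) * ∑ l, R.ev l v = R.ev w v := by
  rw [Finset.sum_mul_sum]
  simp [ev_mul_ev, ite_and]

end FaceRep

theorem sosMatrix_sosFace (hP : SOSParams N L t ε) (m : Vertex N L) :
    sosMatrix hP ζ (sosFace t ε ζ m) = Matrix.single m m 1 := by
  rw [sosFace_eq, map_sum]
  simp only [← FaceRep.E_nil, sosMatrix_E, matrixRep_E]
  simp [Valid, run]

theorem sosMatrix_sosFace' (hP : SOSParams N L t ε) (m : Vertex N L) :
    sosMatrix hP ζ (sosFace' t ε ζ m) = Matrix.single m m 1 := by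
  rw [sosFace'_eq, map_sum]
  simp only [← FaceRep.E_nil, sosMatrix_E, matrixRep_E]
  simp [Valid, run]

/-- Both kinds of face idempotents go to diagonal matrix units, and the sum of the entries of AB is
the sum over u of the column sum of A at u times the row sum of B at u. -/
theorem sosCounit_mul (hP : SOSParams N L t ε) (a b : SOSAlgebra N L t ε ζ) :
    sosCounit hP ζ (a * b) = ∑ u, sosCounit hP ζ (a * sosFace t ε ζ u) *
      sosCounit hP ζ (sosFace' t ε ζ u * b) := by
  simp only [sosCounit, LinearMap.comp_apply, sosMatrix_mul, sosMatrix_sosFace,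
    sosMatrix_sosFace']
  generalize sosMatrix hP ζ a = A
  generalize sosMatrix hP ζ b = B
  have h1 : ∀ u, entrySum N L (A * Matrix.single u u 1) = ∑ i, A i u := fun u => by
    refine Finset.sum_congr rfl fun i _ => ?_
    rw [Finset.sum_eq_single u, Matrix.mul_single_apply_same, mul_one]
    · exact fun j _ hj => Matrix.mul_single_apply_of_ne _ _ _ _ _ hj _
    · exact fun h => absurd (Finset.mem_univ _) h
  have h2 : ∀ u, entrySum N L (Matrix.single u u 1 * B) = ∑ j, B u j := fun u => by
    change ∑ i, ∑ j, (Matrix.single u u (1 : ℂ) * B : Matrix (Vertex N L) (Vertex N L) ℂ) i j = _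
    rw [Finset.sum_eq_single u]
    · simp
    · exact fun i _ hi => Finset.sum_eq_zero fun j _ =>
        Matrix.single_mul_apply_of_ne _ _ _ _ _ hi _
    · exact fun h => absurd (Finset.mem_univ _) h
  simp only [h1, h2, Finset.sum_mul_sum]
  change ∑ i, ∑ j, (A * B) i j = _
  simp only [Matrix.mul_apply]
  exact (Finset.sum_congr rfl fun i _ => Finset.sum_comm).trans Finset.sum_comm

theorem sos_isFaceAlgebra (hP : SOSParams N L t ε) (hζ : ζ ≠ 0) :
    letI := sosCoalgebra hP hζ
    IsFaceAlgebra (K := ℂ) (V := Vertex N L) (sosFace t ε ζ) (sosFace' t ε ζ) := by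
  let _ := sosCoalgebra hP hζ
  have hev : ∀ v w, sosFace' t ε ζ v * sosFace t ε ζ w = (sosRep N L t ε ζ).ev v w :=
    fun v w => FaceRep.sum_right_mul_sum_left (sosRep N L t ε ζ) w v
  refine
  { comul_mul := sosComul_mul hP hζ
    e_mul_e := FaceRep.sum_left_mul_sum_left (sosRep N L t ε ζ)
    e'_mul_e' := FaceRep.sum_right_mul_sum_right (sosRep N L t ε ζ)
    e_mul_e' := fun v w => (FaceRep.sum_left_mul_sum_right (sosRep N L t ε ζ) v w).trans (hev w v).symm
    sum_e := Finset.sum_comm.trans (sosRep_isSOS hP hζ).sum_ev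
    sum_e' := (sosRep_isSOS hP hζ).sum_ev
    comul_e'_e := fun v w => ?_
    counit_e'_e := fun v w => ?_
    counit_mul := sosCounit_mul hP }
  · simp only [hev]
    simp only [← FaceRep.E_nil]
    exact sosComul_E hP hζ v w rfl
  · rw [hev, ← FaceRep.E_nil]
    refine (sosCounit_E hP v w [] []).trans ?_
    simp [delta, Valid]

end FaceAlgebraStructure

/-! ### The antipode -/

theorem sum_comm_three {ι κ ι' M : Type*} [Fintype ι] [Fintype κ] [Fintype ι']
    [AddCommMonoid M] (f : ι → κ → ι' → M) :
    ∑ k, ∑ l, ∑ a, f k l a = ∑ a, ∑ l, ∑ k, f k l a :=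
  (Finset.sum_congr rfl fun _ _ => Finset.sum_comm).trans
    (Finset.sum_comm.trans (Finset.sum_congr rfl fun _ _ => Finset.sum_comm))

namespace FaceRep

section

variable {N L : ℕ} {A : Type*} [Ring A] (R : FaceRep N L A)

theorem ev_mul_sum_right (v v' : Vertex N L) : R.ev v v' * ∑ l, R.ev l v' = R.ev v v' := by
  rw [Finset.mul_sum, Finset.sum_eq_single v, ev_mul_self]
  · exact fun m _ hm => R.ev_mul_ne _ _ _ _ fun h => hm h.1.symm
  · exact fun h => absurd (Finset.mem_univ _) h

end

variable {N L : ℕ} {A : Type*} [Ring A] [Algebra ℂ A] (R : FaceRep N L A) (t ε : ℂ) (Q : Loops N L)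

/-- The representation in the opposite algebra that is given by the antipode. -/
def anti : FaceRep N L Aᵐᵒᵖ :=
  ofEdges (fun v v' => MulOpposite.op (R.ev v' v))
    (fun v i v' k => MulOpposite.op (R.cof t ε Q v i v' k))
    (fun _ _ => congrArg MulOpposite.op (R.ev_mul_self _ _))
    (fun _ _ _ _ h => congrArg MulOpposite.op (R.ev_mul_ne _ _ _ _ fun h' => h
      ⟨h'.2.symm, h'.1.symm⟩))
    (fun _ _ _ _ => congrArg MulOpposite.op R.cof_mul_ev)
    (fun _ _ _ _ => congrArg MulOpposite.op R.ev_mul_cof)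
    (fun _ _ _ _ h => congrArg MulOpposite.op (cof_eq_zero h))

/-- The image of the symbol of two words under the antipode. -/
def antiE (v : Vertex N L) (w : List (Fin N)) (v' : Vertex N L) (w' : List (Fin N)) : A :=
  ((R.anti t ε Q).E v w v' w').unop

theorem antiE_nil (v v' : Vertex N L) : R.antiE t ε Q v [] v' [] = R.ev v' v :=
  congrArg MulOpposite.unop ((R.anti t ε Q).E_nil v v')

theorem antiE_singleton (v v' : Vertex N L) (i k : Fin N) :
    R.antiE t ε Q v [i] v' [k] = R.cof t ε Q v i v' k :=
  congrArg MulOpposite.unop (ofEdges_E_singleton _ _ _ _ _ _ _ _ _ _ _)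

theorem antiE_cons (v v' : Vertex N L) (i k : Fin N) (w w' : List (Fin N)) :
    R.antiE t ε Q v (i :: w) v' (k :: w') =
      R.antiE t ε Q (act v i) w (act v' k) w' * R.cof t ε Q v i v' k := by
  rw [← antiE_singleton]
  exact congrArg MulOpposite.unop ((R.anti t ε Q).E_cons v v' i k w w')

theorem antiE_eq_zero {v v' : Vertex N L} {w w' : List (Fin N)} (h : ¬ (Valid v w ∧ Valid v' w')) :
    R.antiE t ε Q v w v' w' = 0 :=
  congrArg MulOpposite.unop ((R.anti t ε Q).E_eq_zero h)

theorem antiE_eq_zero_of_length {w w' : List (Fin N)} (h : w.length ≠ w'.length)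
    (v v' : Vertex N L) : R.antiE t ε Q v w v' w' = 0 :=
  congrArg MulOpposite.unop ((R.anti t ε Q).E_eq_zero_of_length h v v')

theorem antiE_mul_ev (v v' : Vertex N L) (w w' : List (Fin N)) :
    R.antiE t ε Q v w v' w' * R.ev v' v = R.antiE t ε Q v w v' w' :=
  congrArg MulOpposite.unop ((R.anti t ε Q).ev_mul_E_self v v' w w')

theorem ev_mul_antiE {v v' : Vertex N L} {w w' : List (Fin N)} (h : Valid v w)
    (h' : Valid v' w') :
    R.ev (run v' w') (run v w) * R.antiE t ε Q v w v' w' = R.antiE t ε Q v w v' w' :=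
  congrArg MulOpposite.unop ((R.anti t ε Q).E_mul_ev_self h h')

theorem antiE_mul_sum (v v' : Vertex N L) (w w' : List (Fin N)) :
    R.antiE t ε Q v w v' w' * ∑ l, R.ev l v = R.antiE t ε Q v w v' w' := by
  rw [← antiE_mul_ev, mul_assoc, ev_mul_sum_right]

theorem antiE_mul_sum' (v v' : Vertex N L) (w w' : List (Fin N)) :
    R.antiE t ε Q v w v' w' * ∑ l, R.ev v' l = R.antiE t ε Q v w v' w' := by
  rw [← antiE_mul_ev, mul_assoc, ev_mul_sum_left]

theorem sum_mul_antiE {v v' : Vertex N L} {w w' : List (Fin N)} (h : Valid v w) :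
    (∑ l, R.ev l (run v w)) * R.antiE t ε Q v w v' w' = R.antiE t ε Q v w v' w' := by
  by_cases h' : Valid v' w'
  · rw [← ev_mul_antiE _ _ _ _ h h', ← mul_assoc, sum_right_mul_ev]
  · rw [antiE_eq_zero _ _ _ _ fun hh => h' hh.2, mul_zero]

omit [Algebra ℂ A] in
theorem E_mul_sum (v v' : Vertex N L) (i k : Fin N) :
    R.E v [i] v' [k] * ∑ l, R.ev (act v i) l = R.E v [i] v' [k] := by
  rw [← E_singleton_mul_ev, mul_assoc, ev_mul_sum_left]

variable {R t ε Q}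

open scoped Classical in
/-- The antipode is a left inverse. -/
theorem IsSOS.antiE_mul_E (hR : R.IsSOS t ε Q) (hP : SOSParams N L t ε) {m : ℕ} (v v' : Vertex N L)
    {w : List (Fin N)} (hw : w.length = m) (w' : List (Fin N)) :
    (∑ u, wsum m fun r => R.antiE t ε Q v w u r * R.E u r v' w') =
      if (v = v' ∧ w = w') ∧ Valid v w then ∑ l, R.ev l (run v w) else 0 := by
  induction m generalizing v v' w w' with
  | zero =>
    obtain rfl := List.length_eq_zero_iff.mp hw
    cases w' with
    | nil =>
      simp only [wsum, antiE_nil, E_nil]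
      by_cases h : v = v'
      · subst h
        rw [if_pos (by simp [Valid])]
        exact Finset.sum_congr rfl fun u _ => R.ev_mul_self _ _
      · rw [if_neg (by simp [h])]
        exact Finset.sum_eq_zero fun u _ => R.ev_mul_ne _ _ _ _ fun h' => h h'.2
    | cons k w' =>
      rw [if_neg (by simp)]
      refine Finset.sum_eq_zero fun u _ => ?_
      rw [wsum, E_eq_zero_of_length _ (by simp), mul_zero]
  | succ m ih =>
    obtain ⟨i, w, rfl⟩ := List.exists_cons_of_length_eq_add_one hw
    have hw1 : w.length = m := Nat.succ_injective hw
    cases w' with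
    | nil =>
      rw [if_neg (by simp)]
      refine Finset.sum_eq_zero fun u _ => wsum_eq_zero fun r hr => ?_
      rw [E_eq_zero_of_length _ (by simp [hr]), mul_zero]
    | cons k w' =>
      by_cases hok : Ok v i ∧ Ok v' k
      -- The antipode reverses products, so the factors of the first letters meet in the middle and
      -- are contracted by `cof_mul`; the outer factors are left to the induction. The extra sum
      -- over y only introduces terms that vanish.
      · have key : ∀ u a, (wsum m fun r => R.antiE t ε Q v (i :: w) u (a :: r) *
            R.E u (a :: r) v' (k :: w')) =
            ∑ y, wsum m fun r => R.antiE t ε Q (act v i) w y r *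
              (R.cof t ε Q v i u a * R.E u [a] v' [k]) * R.E y r (act v' k) w' := by
          intro u a
          rw [Finset.sum_eq_single (act u a)]
          · refine wsum_congr fun r _ => ?_
            rw [antiE_cons, E_cons]
            simp only [mul_assoc]
          · intro y _ hy
            refine wsum_eq_zero fun r _ => ?_
            rw [← antiE_mul_ev, ← ev_mul_cof, mul_assoc, mul_assoc, mul_assoc,
              mul_assoc, ← mul_assoc (R.ev y _), R.ev_mul_ne _ _ _ _ fun h => hy h.1, zero_mul,
              mul_zero]
          · exact fun h => absurd (Finset.mem_univ _) h
        have h2 : (∑ u, wsum (m + 1) fun r => R.antiE t ε Q v (i :: w) u r *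
            R.E u r v' (k :: w')) = ∑ y, wsum m fun r => R.antiE t ε Q (act v i) w y r *
              (∑ a, ∑ u, R.cof t ε Q v i u a * R.E u [a] v' [k]) * R.E y r (act v' k) w' := by
          simp only [wsum, key]
          rw [sum_comm_three]
          refine Finset.sum_congr rfl fun y _ => ?_
          simp only [Finset.mul_sum, Finset.sum_mul, wsum_finset_sum]
        rw [h2]
        by_cases h : v = v' ∧ i = k
        · obtain ⟨rfl, rfl⟩ := h
          simp only [hR.cof_mul hP hok.1 hok.2, and_self, if_true, antiE_mul_sum]
          rw [ih _ _ hw1]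
          refine if_congr ?_ rfl rfl
          simp [Valid, hok.1]
        · simp only [hR.cof_mul hP hok.1 hok.2, if_neg h, mul_zero, zero_mul, wsum_zero,
            Finset.sum_const_zero]
          rw [if_neg]
          rintro ⟨⟨rfl, h1⟩, -⟩
          exact h ⟨rfl, (List.cons.inj h1).1⟩
      · rw [if_neg]
        · refine Finset.sum_eq_zero fun u _ => wsum_eq_zero fun r hr => ?_
          by_cases hv : Ok v i
          · rw [R.E_eq_zero (v' := v') (w' := k :: w') (fun h => hok ⟨hv, h.2.1⟩), mul_zero]
          · rw [antiE_eq_zero (v := v) (w := i :: w) _ _ _ _ fun h => hv h.1.1, zero_mul]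
        · rintro ⟨⟨rfl, h1⟩, h2⟩
          obtain ⟨rfl, -⟩ := List.cons.inj h1
          exact hok ⟨h2.1, h2.1⟩

open scoped Classical in
/-- The antipode is a right inverse. -/
theorem IsSOS.E_mul_antiE (hR : R.IsSOS t ε Q) (hP : SOSParams N L t ε) {m : ℕ} (v v' : Vertex N L)
    {w : List (Fin N)} (hw : w.length = m) (w' : List (Fin N)) :
    (∑ u, wsum m fun r => R.E v w u r * R.antiE t ε Q u r v' w') =
      if (v = v' ∧ w = w') ∧ Valid v w then ∑ l, R.ev v l else 0 := by
  induction m generalizing v v' w w' with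
  | zero =>
    obtain rfl := List.length_eq_zero_iff.mp hw
    cases w' with
    | nil =>
      simp only [wsum, antiE_nil, E_nil]
      by_cases h : v = v'
      · subst h
        rw [if_pos (by simp [Valid])]
        exact Finset.sum_congr rfl fun u _ => R.ev_mul_self _ _
      · rw [if_neg (by simp [h])]
        exact Finset.sum_eq_zero fun u _ => R.ev_mul_ne _ _ _ _ fun h' => h h'.1
    | cons k w' =>
      rw [if_neg (by simp)]
      refine Finset.sum_eq_zero fun u _ => ?_
      rw [wsum, antiE_eq_zero_of_length _ _ _ _ (by simp), mul_zero]
  | succ m ih =>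
    obtain ⟨i, w, rfl⟩ := List.exists_cons_of_length_eq_add_one hw
    have hw1 : w.length = m := Nat.succ_injective hw
    cases w' with
    | nil =>
      rw [if_neg (by simp)]
      refine Finset.sum_eq_zero fun u _ => wsum_eq_zero fun r hr => ?_
      rw [antiE_eq_zero_of_length _ _ _ _ (by simp [hr]), mul_zero]
    | cons k w' =>
      by_cases hok : Ok v i ∧ Ok v' k
      -- In this order the tails meet in the middle, so induction is applied first and
      -- `mul_cof_right` to the first letters afterwards.
      · have key : ∀ u a, (wsum m fun r => R.E v (i :: w) u (a :: r) *
            R.antiE t ε Q u (a :: r) v' (k :: w')) =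
            R.E v [i] u [a] * (∑ y, wsum m fun r => R.E (act v i) w y r *
              R.antiE t ε Q y r (act v' k) w') * R.cof t ε Q u a v' k := by
          intro u a
          rw [Finset.mul_sum, Finset.sum_eq_single (act u a), mul_wsum, wsum_mul]
          · refine wsum_congr fun r _ => ?_
            rw [antiE_cons, E_cons]
            simp only [mul_assoc]
          · intro y _ hy
            rw [mul_wsum]
            refine wsum_eq_zero fun r _ => ?_
            rw [← mul_assoc, R.E_mul_E_ne (w := [i]) (w' := [a]) (fun h => hy h.2.symm), zero_mul]
          · exact fun h => absurd (Finset.mem_univ _) h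
        simp only [wsum, key, ih _ _ hw1]
        by_cases h1 : (act v i = act v' k ∧ w = w') ∧ Valid (act v i) w
        · simp only [if_pos h1, E_mul_sum]
          rw [Finset.sum_comm, hR.mul_cof_right hP hok.2 hok.1]
          obtain ⟨⟨-, rfl⟩, h2⟩ := h1
          refine if_congr ?_ rfl rfl
          constructor
          · rintro ⟨rfl, rfl⟩
            exact ⟨⟨rfl, rfl⟩, hok.1, h2⟩
          · rintro ⟨⟨rfl, h3⟩, -⟩
            exact ⟨rfl, (List.cons.inj h3).1.symm⟩
        · simp only [if_neg h1, mul_zero, zero_mul, Finset.sum_const_zero]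
          rw [if_neg]
          rintro ⟨⟨rfl, h3⟩, h4⟩
          obtain ⟨rfl, rfl⟩ := List.cons.inj h3
          exact h1 ⟨⟨rfl, rfl⟩, h4.2⟩
      · rw [if_neg]
        · refine Finset.sum_eq_zero fun u _ => wsum_eq_zero fun r hr => ?_
          by_cases hv : Ok v i
          · rw [antiE_eq_zero (v' := v') (w' := k :: w') _ _ _ _ (fun h => hok ⟨hv, h.2.1⟩), mul_zero]
          · rw [R.E_eq_zero (v := v) (w := i :: w) fun h => hv h.1.1, zero_mul]
        · rintro ⟨⟨rfl, h1⟩, h2⟩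
          obtain ⟨rfl, -⟩ := List.cons.inj h1
          exact hok ⟨h2.1, h2.1⟩

end FaceRep

/-! ### The antipode respects the relations and the determinant. -/

namespace FaceRep

variable {N L : ℕ} {A : Type*} [Ring A] [Algebra ℂ A] {R : FaceRep N L A} {t ε : ℂ} {Q : Loops N L}

/-- On words of length 2 the matrix S of values of the antipode is a two-sided inverse of the matrix
E of symbols. As E commutes with the weight W, one has S W = S W E S = S E W S = W S; the
idempotents that replace the identity act trivially on S. -/
theorem IsSOS.antiE_rel (hR : R.IsSOS t ε Q) (hP : SOSParams N L t ε) (v v' : Vertex N L)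
    (i j k l : Fin N) (h : Valid v' [k, l]) :
    wDiag t v' k l • R.antiE t ε Q v [i, j] v' [k, l] +
      wOff t ε v' k l • R.antiE t ε Q v [i, j] v' [l, k] =
    wDiag t v i j • R.antiE t ε Q v [i, j] v' [k, l] +
      wOff t ε v j i • R.antiE t ε Q v [j, i] v' [k, l] := by
  classical
  have hl : ∀ y c d, ∑ x : Vertex N L × Fin N × Fin N,
      R.antiE t ε Q v [i, j] x.1 [x.2.1, x.2.2] * R.E x.1 [x.2.1, x.2.2] y [c, d] =
      if (v = y ∧ [i, j] = [c, d]) ∧ Valid v [i, j] then ∑ l, R.ev l (run v [i, j]) else 0 := by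
    intro y c d
    simp only [Fintype.sum_prod_type]
    exact hR.antiE_mul_E hP (m := 2) v y rfl [c, d]
  have hr : ∀ y c d, ∑ x : Vertex N L × Fin N × Fin N,
      R.E y [c, d] x.1 [x.2.1, x.2.2] * R.antiE t ε Q x.1 [x.2.1, x.2.2] v' [k, l] =
      if (y = v' ∧ [c, d] = [k, l]) ∧ Valid y [c, d] then ∑ l, R.ev y l else 0 := by
    intro y c d
    simp only [Fintype.sum_prod_type]
    exact hR.E_mul_antiE hP (m := 2) y v' rfl [k, l]
  -- This is S E W S: the left inverse property moves the weight to the row.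
  have h1 : ∑ z : Vertex N L × Fin N × Fin N,
      (wDiag t z.1 z.2.1 z.2.2 • ∑ x : Vertex N L × Fin N × Fin N,
        R.antiE t ε Q v [i, j] x.1 [x.2.1, x.2.2] *
          R.E x.1 [x.2.1, x.2.2] z.1 [z.2.1, z.2.2] +
      wOff t ε z.1 z.2.1 z.2.2 • ∑ x : Vertex N L × Fin N × Fin N,
        R.antiE t ε Q v [i, j] x.1 [x.2.1, x.2.2] *
          R.E x.1 [x.2.1, x.2.2] z.1 [z.2.2, z.2.1]) *
      R.antiE t ε Q z.1 [z.2.1, z.2.2] v' [k, l] =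
      wDiag t v i j • R.antiE t ε Q v [i, j] v' [k, l] +
      wOff t ε v j i • R.antiE t ε Q v [j, i] v' [k, l] := by
    simp only [add_mul, Finset.sum_add_distrib, hl]
    congr 1
    · rw [Finset.sum_eq_single (v, i, j)]
      · by_cases hv : Valid v [i, j]
        · rw [if_pos ⟨⟨rfl, rfl⟩, hv⟩, smul_mul_assoc, sum_mul_antiE _ _ _ _ hv]
        · rw [if_neg fun hh => hv hh.2, antiE_eq_zero _ _ _ _ fun hh => hv hh.1]
          simp
      · rintro ⟨y, c, d⟩ _ hne
        rw [if_neg, smul_zero, zero_mul]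
        rintro ⟨⟨rfl, h2⟩, -⟩
        obtain ⟨rfl, h3⟩ := List.cons.inj h2
        obtain ⟨rfl, -⟩ := List.cons.inj h3
        exact hne rfl
      · exact fun h => absurd (Finset.mem_univ _) h
    · rw [Finset.sum_eq_single (v, j, i)]
      · by_cases hv : Valid v [i, j]
        · rw [if_pos ⟨⟨rfl, rfl⟩, hv⟩, smul_mul_assoc]
          by_cases hv' : Valid v [j, i]
          · rw [run_eq_of_perm hv hv' (List.Perm.swap j i []), sum_mul_antiE _ _ _ _ hv']
          · rw [antiE_eq_zero _ _ _ _ fun hh => hv' hh.1, mul_zero]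
        · rw [if_neg fun hh => hv hh.2, smul_zero, zero_mul]
          by_cases hv' : Valid v [j, i]
          · have hne : j ≠ i := by
              rintro rfl
              exact hv hv'
            rw [hP.wOff_eq_zero hne hv' hv, zero_smul]
          · rw [antiE_eq_zero _ _ _ _ fun hh => hv' hh.1, smul_zero]
      · rintro ⟨y, c, d⟩ _ hne
        rw [if_neg, smul_zero, zero_mul]
        rintro ⟨⟨rfl, h2⟩, -⟩
        obtain ⟨rfl, h3⟩ := List.cons.inj h2
        obtain ⟨rfl, -⟩ := List.cons.inj h3
        exact hne rfl
      · exact fun h => absurd (Finset.mem_univ _) h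
  -- This is S W E S: the right inverse property leaves the weight on the column.
  have h2 : ∑ x : Vertex N L × Fin N × Fin N, R.antiE t ε Q v [i, j] x.1 [x.2.1, x.2.2] *
      (wDiag t x.1 x.2.1 x.2.2 • ∑ z : Vertex N L × Fin N × Fin N,
        R.E x.1 [x.2.1, x.2.2] z.1 [z.2.1, z.2.2] *
          R.antiE t ε Q z.1 [z.2.1, z.2.2] v' [k, l] +
      wOff t ε x.1 x.2.2 x.2.1 • ∑ z : Vertex N L × Fin N × Fin N,
        R.E x.1 [x.2.2, x.2.1] z.1 [z.2.1, z.2.2] *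
          R.antiE t ε Q z.1 [z.2.1, z.2.2] v' [k, l]) =
      wDiag t v' k l • R.antiE t ε Q v [i, j] v' [k, l] +
      wOff t ε v' k l • R.antiE t ε Q v [i, j] v' [l, k] := by
    simp only [mul_add, Finset.sum_add_distrib, hr]
    congr 1
    · rw [Finset.sum_eq_single (v', k, l)]
      · rw [if_pos ⟨⟨rfl, rfl⟩, h⟩, mul_smul_comm, antiE_mul_sum']
      · rintro ⟨y, c, d⟩ _ hne
        rw [if_neg, smul_zero, mul_zero]
        rintro ⟨⟨rfl, h2⟩, -⟩
        obtain ⟨rfl, h3⟩ := List.cons.inj h2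
        obtain ⟨rfl, -⟩ := List.cons.inj h3
        exact hne rfl
      · exact fun h => absurd (Finset.mem_univ _) h
    · rw [Finset.sum_eq_single (v', l, k)]
      · rw [if_pos ⟨⟨rfl, rfl⟩, h⟩, mul_smul_comm, antiE_mul_sum']
      · rintro ⟨y, c, d⟩ _ hne
        rw [if_neg, smul_zero, mul_zero]
        rintro ⟨⟨rfl, h2⟩, -⟩
        obtain ⟨rfl, h3⟩ := List.cons.inj h2
        obtain ⟨rfl, -⟩ := List.cons.inj h3
        exact hne rfl
      · exact fun h => absurd (Finset.mem_univ _) h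
  rw [← h1, ← h2]
  simp only [Finset.smul_sum, ← Finset.sum_add_distrib, Finset.mul_sum, Finset.sum_mul]
  rw [Finset.sum_comm]
  refine Finset.sum_congr rfl fun z _ => Finset.sum_congr rfl fun x _ => ?_
  by_cases hz : Valid z.1 [z.2.1, z.2.2]
  · simp only [← mul_smul_comm, ← mul_add]
    rw [hR.rel _ _ _ _ _ _ hz, mul_assoc, add_mul]
    simp only [smul_mul_assoc, mul_smul_comm]
  · rw [antiE_eq_zero (v := z.1) _ _ _ _ fun hh => hz hh.1]
    simp

theorem IsSOS.anti_rel (hR : R.IsSOS t ε Q) (hP : SOSParams N L t ε) :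
    (R.anti t ε Q).Rel t ε := fun v v' i j k l h =>
  MulOpposite.unop_injective (hR.antiE_rel hP v v' i j k l h)

theorem anti_Phi (m : ℕ) (f : List (Fin N) → ℂ) (v v' : Vertex N L) (w' : List (Fin N)) :
    ((R.anti t ε Q).Phi m f v v' w').unop = wsum m fun w => f w • R.antiE t ε Q v w v' w' :=
  map_wsum (MulOpposite.opAddEquiv (α := A)).symm _ _

/-- The images of the columns under S are antisymmetric, hence the sign times one element c(u) for
each vertex u. Contracting with symbols of column `Q.q l` gives, on the one hand, a known sum of
vertex symbols by `antiE_mul_E`, and on the other hand c(u) times a minor evaluated by `Phi_univ`.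
Multiplication by one vertex symbol isolates c(m). -/
theorem IsSOS.qDim_smul_anti_Phi (hR : R.IsSOS t ε Q) (hP : SOSParams N L t ε) (l m : Vertex N L) :
    ((qDim t m / qDim t l) * sgn ε (Q.q m)) •
      ((R.anti t ε Q).Phi N (altSign ε Finset.univ) l m (Q.q m)).unop = R.ev m l := by
  classical
  let c : Vertex N L → A := fun u =>
    sgn ε (Q.q u) • ((R.anti t ε Q).Phi N (altSign ε Finset.univ) l u (Q.q u)).unop
  have hrel := hR.anti_rel hP
  have h1 : ∀ u r, Valid u r → r.length = N →
      ((R.anti t ε Q).Phi N (altSign ε Finset.univ) l u r).unop =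
        altSign ε Finset.univ r • c u := by
    intro u r hr hl
    by_cases hn : r.Nodup
    · have hu := toFinset_eq_univ hn hl
      have h2 := congrArg MulOpposite.unop (hrel.Phi_perm hP (Q.q_valid u) hr (Q.q_nodup u) hn
        ((Q.q_toFinset u).trans hu.symm) N Finset.univ l)
      rw [MulOpposite.unop_smul, MulOpposite.unop_smul] at h2
      rw [altSign, if_pos ⟨hn, hu⟩]
      simp only [c]
      rw [h2, smul_smul, sgn_mul_self hP.sq, one_smul]
    · rw [hrel.Phi_eq_zero hP hn, altSign, if_neg fun h => hn h.1, zero_smul]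
      rfl
  have h2 : ∑ u, (wsum N fun r =>
      ((R.anti t ε Q).Phi N (altSign ε Finset.univ) l u r).unop * R.E u r l (Q.q l)) =
      sgn ε (Q.q l) • ∑ k, R.ev k l := by
    have h3 : ∀ u r, ((R.anti t ε Q).Phi N (altSign ε Finset.univ) l u r).unop *
        R.E u r l (Q.q l) = wsum N fun s => altSign ε Finset.univ s •
          (R.antiE t ε Q l s u r * R.E u r l (Q.q l)) := by
      intro u r
      rw [anti_Phi, wsum_mul]
      simp only [smul_mul_assoc]
    simp only [h3]
    have h4 : (∑ u, wsum N fun r => wsum N fun s => altSign ε Finset.univ s •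
        (R.antiE t ε Q l s u r * R.E u r l (Q.q l))) =
        wsum N fun s => altSign ε Finset.univ s • ∑ u, wsum N fun r =>
        (R.antiE t ε Q l s u r * R.E u r l (Q.q l)) := by
      simp only [Finset.smul_sum, smul_wsum, wsum_finset_sum]
      exact Finset.sum_congr rfl fun u _ => wsum_comm _ _ _
    rw [h4, wsum_eq_single (Q.q l) (Q.q_length l), hR.antiE_mul_E hP l l (Q.q_length l),
      if_pos ⟨⟨rfl, rfl⟩, Q.q_valid l⟩, altSign, if_pos ⟨Q.q_nodup l, Q.q_toFinset l⟩,
      (run_eq_iff_nodup (Q.q_valid l) (Q.q_length l)).mpr (Q.q_nodup l)]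
    intro s hs hne
    rw [hR.antiE_mul_E hP l l hs, if_neg fun h => hne h.1.2, smul_zero]
  have h3 : ∀ u, (wsum N fun r =>
      ((R.anti t ε Q).Phi N (altSign ε Finset.univ) l u r).unop * R.E u r l (Q.q l)) =
      sgn ε (Q.q l) • (qDim t u / qDim t l) • (c u * R.ev u l) := by
    intro u
    have h4 : ∀ r : List (Fin N), r.length = N →
        ((R.anti t ε Q).Phi N (altSign ε Finset.univ) l u r).unop * R.E u r l (Q.q l) =
          c u * (altSign ε Finset.univ r • R.E u r l (Q.q l)) := by
      intro r hr
      by_cases hv : Valid u r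
      · rw [h1 u r hv hr, smul_mul_assoc, mul_smul_comm]
      · rw [R.E_eq_zero fun h => hv h.1, smul_zero, mul_zero, mul_zero]
    rw [wsum_congr h4, ← mul_wsum]
    change c u * R.Phi N (altSign ε Finset.univ) u l (Q.q l) = _
    rw [hR.Phi_univ hP u (Q.q_valid l) (Q.q_nodup l) (Q.q_length l), mul_smul_comm, mul_smul]
  simp only [h3, ← Finset.smul_sum] at h2
  have h4 := congrArg (· * R.ev m l) (smul_right_injective A (sgn_ne_zero hP.sq (Q.q l)) h2)
  have h5 : c m * R.ev m l = c m := by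
    simp only [c]
    rw [anti_Phi, smul_mul_assoc, wsum_mul]
    simp only [smul_mul_assoc, antiE_mul_ev]
  rw [sum_right_mul_ev, Finset.sum_mul, Finset.sum_eq_single m, smul_mul_assoc, mul_assoc,
    ev_mul_self, h5] at h4
  · rw [mul_smul]
    exact h4
  · intro u _ hu
    rw [smul_mul_assoc, mul_assoc, R.ev_mul_ne _ _ _ _ fun h => hu h.1, mul_zero, smul_zero]
  · exact fun h => absurd (Finset.mem_univ _) h

theorem IsSOS.anti_det (hR : R.IsSOS t ε Q) (hP : SOSParams N L t ε) :
    (R.anti t ε Q).det t ε Q = ∑ l, ∑ m, (R.anti t ε Q).ev l m :=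
  Finset.sum_congr rfl fun l _ => Finset.sum_congr rfl fun m _ =>
    MulOpposite.unop_injective (hR.qDim_smul_anti_Phi hP l m)

end FaceRep

/-! ### The antipode of the SOS algebra, its axioms, its values on edges and its square. -/

section Antipode

variable {N L : ℕ} {t ε ζ : ℂ}

/-- The antipode. -/
def sosAntipode (hP : SOSParams N L t ε) (hζ : ζ ≠ 0) :
    SOSAlgebra N L t ε ζ →ₗ[ℂ] SOSAlgebra N L t ε ζ :=
  (MulOpposite.opLinearEquiv ℂ).symm.toLinearMap ∘ₗ (exists_hom_sosRep hP ζ _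
    ((sosRep_isSOS hP hζ).anti_rel hP) ((sosRep_isSOS hP hζ).anti_det hP)).choose

theorem sosAntipode_mul (hP : SOSParams N L t ε) (hζ : ζ ≠ 0) (a b : SOSAlgebra N L t ε ζ) :
    sosAntipode hP hζ (a * b) = sosAntipode hP hζ b * sosAntipode hP hζ a :=
  congrArg MulOpposite.unop ((exists_hom_sosRep hP ζ _
    ((sosRep_isSOS hP hζ).anti_rel hP) ((sosRep_isSOS hP hζ).anti_det hP)).choose_spec.1 a b)

theorem sosAntipode_E (hP : SOSParams N L t ε) (hζ : ζ ≠ 0) (v v' : Vertex N L)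
    (w w' : List (Fin N)) : sosAntipode hP hζ ((sosRep N L t ε ζ).E v w v' w') =
      (sosRep N L t ε ζ).antiE t ε (sosLoops hP.two_le_N hP.two_le_L) v w v' w' :=
  congrArg MulOpposite.unop ((exists_hom_sosRep hP ζ _
    ((sosRep_isSOS hP hζ).anti_rel hP)
    ((sosRep_isSOS hP hζ).anti_det hP)).choose_spec.2 v w v' w')

theorem sosAntipode_ev (hP : SOSParams N L t ε) (hζ : ζ ≠ 0) (v v' : Vertex N L) :
    sosAntipode hP hζ ((sosRep N L t ε ζ).ev v v') = (sosRep N L t ε ζ).ev v' v := by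
  rw [← FaceRep.E_nil, sosAntipode_E, FaceRep.antiE_nil]

theorem sum_sosAntipode_mul (hP : SOSParams N L t ε) (hζ : ζ ≠ 0) {m : ℕ}
    (p q : (sosGraph N L).Path m) :
    ∑ r, sosAntipode hP hζ (sosE t ε ζ p r) * sosE t ε ζ r q =
      delta ℂ p q • sosFace t ε ζ p.range := by
  classical
  simp only [← sosRep_E, sosAntipode_E]
  rw [sum_path m (fun u r => (sosRep N L t ε ζ).antiE t ε (sosLoops hP.two_le_N hP.two_le_L)
    p.source (indices p) u r * (sosRep N L t ε ζ).E u r q.source (indices q)) fun v w h => by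
      rw [FaceRep.E_eq_zero _ fun h' => h h'.1, mul_zero],
    (sosRep_isSOS hP hζ).antiE_mul_E hP _ _ (indices_length p), run_indices, delta, ite_smul,
    one_smul, zero_smul]
  refine if_congr ⟨fun h => path_ext h.1.1 h.1.2, ?_⟩ rfl rfl
  rintro rfl
  exact ⟨⟨rfl, rfl⟩, path_valid p⟩

theorem sum_mul_sosAntipode (hP : SOSParams N L t ε) (hζ : ζ ≠ 0) {m : ℕ}
    (p q : (sosGraph N L).Path m) :
    ∑ r, sosE t ε ζ p r * sosAntipode hP hζ (sosE t ε ζ r q) =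
      delta ℂ p q • sosFace' t ε ζ p.source := by
  classical
  simp only [← sosRep_E, sosAntipode_E]
  rw [sum_path m (fun u r => (sosRep N L t ε ζ).E p.source (indices p) u r *
    (sosRep N L t ε ζ).antiE t ε (sosLoops hP.two_le_N hP.two_le_L) u r q.source (indices q))
    fun v w h => by rw [FaceRep.E_eq_zero _ fun h' => h h'.2, zero_mul],
    (sosRep_isSOS hP hζ).E_mul_antiE hP _ _ (indices_length p), delta, ite_smul,
    one_smul, zero_smul]
  refine if_congr ⟨fun h => path_ext h.1.1 h.1.2, ?_⟩ rfl rfl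
  rintro rfl
  exact ⟨⟨rfl, rfl⟩, path_valid p⟩

theorem sosE_mul_sosFace {m : ℕ} (p q : (sosGraph N L).Path m) (v : Vertex N L) :
    sosE t ε ζ p q * sosFace t ε ζ v = delta ℂ q.range v • sosE t ε ζ p q := by
  rw [← sosRep_E, sosFace_eq, delta]
  have h1 := (sosRep N L t ε ζ).E_mul_ev_self (path_valid p) (path_valid q)
  rw [run_indices, run_indices] at h1
  rw [← h1, mul_assoc]
  split_ifs with h
  · rw [← h, FaceRep.ev_mul_sum_right, one_smul]
  · rw [Finset.mul_sum, Finset.sum_eq_zero fun l _ =>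
      (sosRep N L t ε ζ).ev_mul_ne _ _ _ _ fun h' => h h'.2, mul_zero, zero_smul]

theorem sosFace_mul_sosE {m : ℕ} (p q : (sosGraph N L).Path m) (v : Vertex N L) :
    sosFace t ε ζ v * sosE t ε ζ p q = delta ℂ q.source v • sosE t ε ζ p q := by
  rw [← sosRep_E, sosFace_eq, delta, ← FaceRep.ev_mul_E_self, ← mul_assoc]
  split_ifs with h
  · rw [← h, FaceRep.sum_right_mul_ev, one_smul]
  · rw [Finset.sum_mul, Finset.sum_eq_zero fun l _ =>
      (sosRep N L t ε ζ).ev_mul_ne _ _ _ _ fun h' => h h'.2.symm, zero_mul, zero_smul]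

theorem sos_isAntipode (hP : SOSParams N L t ε) (hζ : ζ ≠ 0) :
    letI := sosCoalgebra hP hζ
    IsAntipode (V := Vertex N L) (sosFace t ε ζ) (sosFace' t ε ζ) (sosAntipode hP hζ) := by
  let _ := sosCoalgebra hP hζ
  have hc : ∀ {m : ℕ} (p q : (sosGraph N L).Path m),
      Coalgebra.comul (R := ℂ) (sosE t ε ζ p q) =
        ∑ r : (sosGraph N L).Path m, sosE t ε ζ p r ⊗ₜ[ℂ] sosE t ε ζ r q :=
    fun p q => sosComul_sosE hP hζ p q
  have hl : ∀ {m : ℕ} (p q : (sosGraph N L).Path m),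
      conv (sosAntipode hP hζ) LinearMap.id (sosE t ε ζ p q) =
        delta ℂ p q • sosFace t ε ζ p.range := by
    intro m p q
    rw [← sum_sosAntipode_mul hP hζ, conv, LinearMap.comp_apply, LinearMap.comp_apply, hc]
    simp only [map_sum, TensorProduct.map_tmul, LinearMap.mul'_apply, LinearMap.id_apply]
  have hr : ∀ {m : ℕ} (p q : (sosGraph N L).Path m),
      conv LinearMap.id (sosAntipode hP hζ) (sosE t ε ζ p q) =
        delta ℂ p q • sosFace' t ε ζ p.source := by
    intro m p q
    rw [← sum_mul_sosAntipode hP hζ, conv, LinearMap.comp_apply, LinearMap.comp_apply, hc]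
    simp only [map_sum, TensorProduct.map_tmul, LinearMap.mul'_apply, LinearMap.id_apply]
  refine ⟨fun a => ?_, fun a => ?_, fun a => ?_⟩
  -- The right side of the axiom is written as a linear map in a, so that it suffices to compare
  -- values on the symbols.
  · have h : conv (sosAntipode hP hζ) LinearMap.id = ∑ v,
        LinearMap.toSpanSingleton ℂ _ (sosFace t ε ζ v) ∘ₗ sosCounit hP ζ ∘ₗ
          LinearMap.mulRight ℂ (sosFace t ε ζ v) := by
      refine sos_hom_ext fun m p q => ?_
      rw [hl, LinearMap.sum_apply]
      simp only [LinearMap.comp_apply, LinearMap.mulRight_apply, sosE_mul_sosFace, map_smul,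
        sosCounit_sosE, LinearMap.toSpanSingleton_apply]
      rw [sum_delta_smul q.range fun v => delta ℂ p q • sosFace t ε ζ v]
      by_cases hpq : p = q
      · rw [hpq]
      · rw [delta, if_neg hpq, zero_smul, zero_smul]
    rw [h, LinearMap.sum_apply]
    rfl
  · have h : conv LinearMap.id (sosAntipode hP hζ) = ∑ v,
        LinearMap.toSpanSingleton ℂ _ (sosFace' t ε ζ v) ∘ₗ sosCounit hP ζ ∘ₗ
          LinearMap.mulLeft ℂ (sosFace t ε ζ v) := by
      refine sos_hom_ext fun m p q => ?_
      rw [hr, LinearMap.sum_apply]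
      simp only [LinearMap.comp_apply, LinearMap.mulLeft_apply, sosFace_mul_sosE, map_smul,
        sosCounit_sosE, LinearMap.toSpanSingleton_apply]
      rw [sum_delta_smul q.source fun v => delta ℂ p q • sosFace' t ε ζ v]
      by_cases hpq : p = q
      · rw [hpq]
      · rw [delta, if_neg hpq, zero_smul, zero_smul]
    rw [h, LinearMap.sum_apply]
    rfl
  · have h : conv (conv (sosAntipode hP hζ) LinearMap.id) (sosAntipode hP hζ) =
        sosAntipode hP hζ := by
      refine sos_hom_ext fun m p q => ?_
      rw [conv, LinearMap.comp_apply, LinearMap.comp_apply, hc]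
      simp only [map_sum, TensorProduct.map_tmul, LinearMap.mul'_apply, hl, smul_mul_assoc]
      rw [sum_delta_smul p fun r => sosFace t ε ζ p.range * sosAntipode hP hζ (sosE t ε ζ r q),
        ← sosRep_E, sosAntipode_E, sosFace_eq, ← run_indices p]
      exact FaceRep.sum_mul_antiE _ _ _ _ (path_valid p)
    rw [h]

/-- By construction S of an edge symbol is the cofactor formed with one fixed return path;
`Rel.Phi_perm` allows any other return path `b`. -/
theorem sosAntipode_edge (hP : SOSParams N L t ε) (hζ : ζ ≠ 0) (x y : Edge N L)
    (b : (sosGraph N L).Path (N - 1))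
    (hb : b ∈ (sosGraph N L).pathsBetween (N - 1) ((sosGraph N L).r x) ((sosGraph N L).s x)) :
    sosAntipode hP hζ (sosE t ε ζ (.ofEdge (sosGraph N L) x) (.ofEdge (sosGraph N L) y)) =
      ((-ε) ^ ((x.index + 1 : ℕ) + (y.index + 1 : ℕ)) *
        (qDim t ((sosGraph N L).r x) / qDim t ((sosGraph N L).r y))) •
      ∑ a ∈ (sosGraph N L).pathsBetween (N - 1) ((sosGraph N L).r y) ((sosGraph N L).s y),
        (-ε) ^ (ell a + ell b) • sosE t ε ζ a b := by
  set Q := sosLoops (N := N) (L := L) hP.two_le_N hP.two_le_L with hQ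
  obtain ⟨hb1, hb2⟩ := mem_pathsBetween.mp hb
  have hx := edge_ok x
  have hy := edge_ok y
  have hbv := path_valid b
  have hbr := run_indices b
  rw [hb1, ← act_edge x] at hbv hbr
  rw [hb2] at hbr
  have hbn := (run_act_eq_iff hx hbv (indices_length b)).mp hbr
  have h1 : sosAntipode hP hζ
      (sosE t ε ζ (.ofEdge (sosGraph N L) x) (.ofEdge (sosGraph N L) y)) =
      (sosRep N L t ε ζ).cof t ε Q ((sosGraph N L).s x) x.index ((sosGraph N L).s y) y.index := by
    rw [← sosRep_E, ← FaceRep.antiE_singleton]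
    exact sosAntipode_E hP hζ _ _ _ _
  have h2 : ∑ a ∈ (sosGraph N L).pathsBetween (N - 1) ((sosGraph N L).r y) ((sosGraph N L).s y),
      (-ε) ^ (ell a + ell b) • sosE t ε ζ a b = sgn ε (indices b) •
        (sosRep N L t ε ζ).Phi (N - 1) (altSign ε (Finset.univ.erase y.index))
          (act ((sosGraph N L).s y) y.index) (act ((sosGraph N L).s x) x.index) (indices b) := by
    rw [FaceRep.Phi, ← sum_pathsBetween_return ε hy (fun v w => (sosRep N L t ε ζ).E v w
      (act ((sosGraph N L).s x) x.index) (indices b))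
      fun v w h => FaceRep.E_eq_zero _ fun h' => h h'.1, Finset.smul_sum, act_edge, act_edge]
    refine Finset.sum_congr rfl fun a _ => ?_
    rw [smul_smul, ← hb1, sosRep_E, sgn_indices, pow_add, mul_comm]
  rw [h1, h2, FaceRep.cof, if_pos ⟨hx, hy⟩, mul_smul, (sosRep_isSOS hP hζ).rel.Phi_perm hP
    (Q.b_valid _ _ hx) hbv (Q.b_nodup _ _ hx) hbn.1 ((Q.b_toFinset _ _ hx).trans hbn.2.symm),
    act_edge, act_edge]
  congr 2
  -- Counting the indices from 1 adds 2 to the exponent, which is harmless as ε² = 1.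
  linear_combination (-((-ε) ^ ((x.index : ℕ) + y.index))) * hP.sq

/-- Applying S to the left inverse relation shows that S² of the edge symbols is inverse to the
cofactors from one side. By `mul_cof` the edge symbols, twisted by ratios of D, are inverse to them
from the other side. Equality of the two inverses is the formula. -/
theorem sosAntipode_sosAntipode_singleton (hP : SOSParams N L t ε) (hζ : ζ ≠ 0)
    (u u' : Vertex N L) (i k : Fin N) :
    sosAntipode hP hζ (sosAntipode hP hζ ((sosRep N L t ε ζ).E u [i] u' [k])) =
      (FaceRep.qRatio t u i / FaceRep.qRatio t u' k) • (sosRep N L t ε ζ).E u [i] u' [k] := by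
  classical
  set Q := sosLoops (N := N) (L := L) hP.two_le_N hP.two_le_L with hQ
  set R := sosRep N L t ε ζ with hR
  set S := sosAntipode hP hζ with hS
  have hRS : R.IsSOS t ε Q := sosRep_isSOS hP hζ
  have hSE : ∀ u i u' k, S (R.E u [i] u' [k]) = R.cof t ε Q u i u' k := fun u i u' k => by
    rw [← FaceRep.antiE_singleton]
    exact sosAntipode_E hP hζ _ _ _ _
  have hSmul : ∀ a b, S (a * b) = S b * S a := sosAntipode_mul hP hζ
  by_cases hok : Ok u i ∧ Ok u' k
  · have h1 : ∀ v z, Ok v z → ∑ a, ∑ y, R.cof t ε Q y a v z * S (R.cof t ε Q u i y a) =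
        if u = v ∧ i = z then ∑ l, R.ev (act u i) l else 0 := by
      intro v z hv
      have h2 := congrArg S (hRS.cof_mul hP hok.1 hv)
      simp only [map_sum, hSmul, hSE] at h2
      rw [h2]
      split_ifs
      · rw [map_sum]
        exact Finset.sum_congr rfl fun l _ => sosAntipode_ev hP hζ _ _
      · exact map_zero _
    -- The triple product below is evaluated with both bracketings, once by this twisted relation
    -- and once by `h1`.
    have h3 : ∀ y a, Ok y a → ∑ v, ∑ z, FaceRep.qRatio t v z • (R.E v [z] u' [k] * R.cof t ε Q y a v z) =
        if y = u' ∧ a = k then FaceRep.qRatio t y a • ∑ v, R.ev v y else 0 := by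
      intro y a hy
      have h4 := fun v => hRS.mul_cof hP hy hok.2 v
      simp only [h4]
      split_ifs
      · rw [Finset.smul_sum]
      · exact Finset.sum_const_zero
    have h5 : ∑ v, ∑ z, FaceRep.qRatio t v z • (R.E v [z] u' [k] *
        ∑ a, ∑ y, R.cof t ε Q y a v z * S (R.cof t ε Q u i y a)) =
        FaceRep.qRatio t u i • R.E u [i] u' [k] := by
      rw [Finset.sum_eq_single u, Finset.sum_eq_single i, h1 u i hok.1, if_pos ⟨rfl, rfl⟩,
        FaceRep.E_mul_sum]
      · intro z _ hz
        by_cases huz : Ok u z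
        · rw [h1 u z huz, if_neg fun h => hz h.2.symm, mul_zero, smul_zero]
        · rw [FaceRep.E_singleton_eq_zero R fun h => huz h.1, zero_mul, smul_zero]
      · exact fun h => absurd (Finset.mem_univ _) h
      · intro v _ hv
        refine Finset.sum_eq_zero fun z _ => ?_
        by_cases huz : Ok v z
        · rw [h1 v z huz, if_neg fun h => hv h.1.symm, mul_zero, smul_zero]
        · rw [FaceRep.E_singleton_eq_zero R fun h => huz h.1, zero_mul, smul_zero]
      · exact fun h => absurd (Finset.mem_univ _) h
    have h6 : ∑ v, ∑ z, FaceRep.qRatio t v z • (R.E v [z] u' [k] *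
        ∑ a, ∑ y, R.cof t ε Q y a v z * S (R.cof t ε Q u i y a)) =
        ∑ a, ∑ y, (∑ v, ∑ z, FaceRep.qRatio t v z • (R.E v [z] u' [k] * R.cof t ε Q y a v z)) *
          S (R.cof t ε Q u i y a) := by
      simp only [Finset.mul_sum, Finset.sum_mul, Finset.smul_sum, smul_mul_assoc, mul_assoc]
      exact sum_comm_four _
    have h7 : ∑ a, ∑ y, (∑ v, ∑ z, FaceRep.qRatio t v z • (R.E v [z] u' [k] * R.cof t ε Q y a v z)) *
          S (R.cof t ε Q u i y a) = FaceRep.qRatio t u' k • S (R.cof t ε Q u i u' k) := by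
      have h8 : ∀ y a, ¬ Ok y a → S (R.cof t ε Q u i y a) = 0 := fun y a h => by
        rw [FaceRep.cof_eq_zero fun h' => h h'.2, map_zero]
      rw [Finset.sum_eq_single k, Finset.sum_eq_single u', h3 u' k hok.2, if_pos ⟨rfl, rfl⟩,
        smul_mul_assoc]
      · congr 1
        rw [← FaceRep.cof_mul_ev, hS, sosAntipode_mul, sosAntipode_ev, ← mul_assoc,
          FaceRep.sum_right_mul_ev]
      · intro y _ hy
        by_cases hyk : Ok y k
        · rw [h3 y k hyk, if_neg fun h => hy h.1, zero_mul]
        · rw [h8 y k hyk, mul_zero]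
      · exact fun h => absurd (Finset.mem_univ _) h
      · intro a _ ha
        refine Finset.sum_eq_zero fun y _ => ?_
        by_cases hya : Ok y a
        · rw [h3 y a hya, if_neg fun h => ha h.2, zero_mul]
        · rw [h8 y a hya, mul_zero]
      · exact fun h => absurd (Finset.mem_univ _) h
    have h9 := h7.symm.trans (h6.symm.trans h5)
    have hk : FaceRep.qRatio t u' k ≠ 0 := div_ne_zero (hP.qDim_ne_zero _) (hP.qDim_ne_zero _)
    rw [hSE]
    apply smul_right_injective _ hk
    simp only
    rw [h9, smul_smul]
    congr 1
    field_simp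
  · rw [FaceRep.E_singleton_eq_zero R hok, map_zero, map_zero, smul_zero]

/-- S² preserves the order of products, so the ratios of D along a path telescope to their values at
its ends. -/
theorem sosAntipode_sosAntipode_E (hP : SOSParams N L t ε) (hζ : ζ ≠ 0) (v v' : Vertex N L)
    (w w' : List (Fin N)) :
    sosAntipode hP hζ (sosAntipode hP hζ ((sosRep N L t ε ζ).E v w v' w')) =
      (qDim t (run v w) * qDim t v' / (qDim t v * qDim t (run v' w'))) •
        (sosRep N L t ε ζ).E v w v' w' := by
  have hD := hP.qDim_ne_zero (N := N) (L := L)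
  induction w generalizing v v' w' with
  | nil =>
    cases w' with
    | nil =>
      rw [FaceRep.E_nil, sosAntipode_ev, sosAntipode_ev]
      simp only [run]
      rw [div_self (mul_ne_zero (hD _) (hD _)), one_smul]
    | cons k w' =>
      rw [FaceRep.E_eq_zero_of_length _ (by simp), map_zero, map_zero, smul_zero]
  | cons i w ih =>
    cases w' with
    | nil => rw [FaceRep.E_eq_zero_of_length _ (by simp), map_zero, map_zero, smul_zero]
    | cons k w' =>
      rw [FaceRep.E_cons, sosAntipode_mul, sosAntipode_mul, ih,
        sosAntipode_sosAntipode_singleton, smul_mul_smul_comm]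
      congr 1
      have h1 := hD v
      have h2 := hD v'
      have h3 := hD (act v i)
      have h4 := hD (act v' k)
      have h5 := hD (run (act v' k) w')
      simp only [run, FaceRep.qRatio]
      field_simp

end Antipode

end

end FaceAlgebra

theorem mainTheorem5 (N L : ℕ) (hN : 2 ≤ N) (hL : 2 ≤ L) (t ε ζ : ℂ)
    (ht : IsPrimitiveRoot t (2 * (N + L))) (hε : ε = 1 ∨ ε = -1) (hζ : ζ ≠ 0) :
    ∃ _ : Coalgebra ℂ (SOSAlgebra N L t ε ζ),
      (∀ (m : ℕ) (p q : (sosGraph N L).Path m),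
        Coalgebra.comul (R := ℂ) (sosE t ε ζ p q) =
          ∑ r : (sosGraph N L).Path m, sosE t ε ζ p r ⊗ₜ[ℂ] sosE t ε ζ r q) ∧
      (∀ (m : ℕ) (p q : (sosGraph N L).Path m),
        Coalgebra.counit (R := ℂ) (sosE t ε ζ p q) = delta ℂ p q) ∧
      IsFaceAlgebra (K := ℂ) (V := Vertex N L) (sosFace t ε ζ) (sosFace' t ε ζ) ∧
      ∃ S : SOSAlgebra N L t ε ζ →ₗ[ℂ] SOSAlgebra N L t ε ζ,
        IsAntipode (V := Vertex N L) (sosFace t ε ζ) (sosFace' t ε ζ) S ∧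
        (∀ x y : Edge N L,
          ∀ b ∈ (sosGraph N L).pathsBetween (N - 1) ((sosGraph N L).r x) ((sosGraph N L).s x),
            S (sosE t ε ζ (.ofEdge (sosGraph N L) x) (.ofEdge (sosGraph N L) y)) =
              ((-ε) ^ ((x.index + 1 : ℕ) + (y.index + 1 : ℕ)) *
                (qDim t ((sosGraph N L).r x) / qDim t ((sosGraph N L).r y))) •
              ∑ a ∈ (sosGraph N L).pathsBetween (N - 1)
                  ((sosGraph N L).r y) ((sosGraph N L).s y),
                (-ε) ^ (ell a + ell b) • sosE t ε ζ a b) ∧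
        (∀ (m : ℕ) (p q : (sosGraph N L).Path m),
          S (S (sosE t ε ζ p q)) =
            (qDim t p.range * qDim t q.source / (qDim t p.source * qDim t q.range)) •
              sosE t ε ζ p q) := by
  -- The sign ε is used only through ε² = 1.
  have hP : SOSParams N L t ε := ⟨hN, hL, ht, by rcases hε with rfl | rfl <;> norm_num⟩
  refine ⟨sosCoalgebra hP hζ, fun m p q => sosComul_sosE hP hζ p q,
    fun m p q => sosCounit_sosE hP p q, sos_isFaceAlgebra hP hζ, sosAntipode hP hζ,
    sos_isAntipode hP hζ, sosAntipode_edge hP hζ, fun m p q => ?_⟩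
  rw [← sosRep_E, sosAntipode_sosAntipode_E, run_indices, run_indices]
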